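/- Let $c\ge 1$ and $\gamma>0$. A hierarchical branching process with parameters $(\{T_k\}_{k\ge1},\{\lambda_j\}_{j\ge1},\{p_K\}_{K\ge1})$ starts with a root branch of order $K$ with probability $p_K$; independently, every branch of order $j$ produces offspring branches of order $i<j$ at rate $\lambda_jT_{j-i}$ and terminates at rate $\lambda_j$; on termination a branch of order $j\ge2$ splits into two branches of order $j-1$, and a branch of order $1$ leaves no offspring. Its history is a random planted binary tree $T$ with edge lengths and no planar embedding. The critical Tokunaga process $S^{\mathrm{Tok}}(t;c,\gamma)$ is the one with $$\lambda_j=\gamma c^{2-j},\qquad p_K=2^{-K},\qquad T_k=(c-1)c^{k-1}.$$ Write $\mathcal R$ for Horton pruning (removal of the leaves with their parental edges, followed by series reduction, which adds the lengths of merged edges), $\phi$ for the empty tree, $L=\limsup_k T_k^{1/k}$ and $\hat t(z)=-1+2z+\sum_{k\ge1}z^kT_k$ for $|z|<1/L$; let the Horton exponent be $R=1/w_0$, where $w_0$ is the unique real root of $\hat t$ in $(0,\tfrac12]$. Then the following hold. 1. (Self-similarity.) The law of $T$ is self-similar with respect to pruning, with scaling exponent $\zeta=c$ and no other: it is coordinated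 in shapes and lengths (for $1\le K\le H$, a uniformly chosen complete subtree of Horton-Strahler order $K$ of $T$ conditioned to have order $H$ has the same law of its shape, and the same conditional law of its edge lengths given the shape, as $T$ conditioned to have order $K$), and prune-invariant in shapes and lengths (conditioned on $\mathcal R(T)\ne\phi$, the shape of $\mathcal R(T)$ has the law of the shape of $T$, and given the shape, the edge lengths of $\mathcal R(T)$ have the law of $\zeta$ times those of $T$). 2. (Criticality.) The expected number of branches alive at time $s$, $C(s)=\sum_{j\ge1}x_j(s)$, where $x_j(s)$ is the expected number of branches of order $j$ alive at time $s$, equals $1$ for all $s\ge0$. 3. (Time-invariance.) Let $\Lambda=\mathrm{diag}(\lambda_1,\lambda_2,\dots)$, $\pi=(p_1,p_2,\dots)$, and let $\mathbb G$ be the upper triangular Toeplitz matrix with $-1$ on the diagonal, $T_1+2$ on the first superdiagonal and $T_k$ on the $k$-th superdiagonal, $k\ge2$. Then $\mathbb G\Lambda$ is a bounded operator on $\ell^1$ and $e^{\mathbb G\Lambda s}\pi=\pi$ for all $s\ge0$. 4. (Edge lengths.) Independently of the combinatorial shape of $T$, its edge lengths are i.i.d. exponential random variables with rate $\gamma c$.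 5. (Constants.) $\displaystyle \hat t(z)=\frac{(1-2cz)(z-1)}{1-cz}$ for complex $z$ with $|z|<1/L$, $cz\neq1$; $R=2c$; $\zeta=c$; $L=c$ if $c>1$ (while $T_k\equiv0$ and $L=0$ if $c=1$); and $p_c:=1-\zeta/R=\tfrac12$. -/

import Mathlib

open MeasureTheory ProbabilityTheory Filter Topology
open scoped ENNReal

namespace HBP

/-! ### Planted binary trees -/

/-- Embedded (planar) non-empty planted reduced binary trees whose edges carry a mark in `α`.
Every non-root vertex is identified with its parental edge: `leaf ℓ` is the tree consisting of the
root and one leaf, joined by an edge of mark `ℓ`; `node ℓ a b` has a root edge of mark `ℓ`, at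
whose lower end the planted trees `a` and `b` are attached. For `α = ℝ` the mark is the edge
length, for `α = Unit` we obtain combinatorial trees. -/
inductive PlanarTree (α : Type) : Type
  | leaf : α → PlanarTree α
  | node : α → PlanarTree α → PlanarTree α → PlanarTree α

namespace PlanarTree

variable {α β : Type}

/-- Apply a function to all edge marks. -/
def map (f : α → β) : PlanarTree α → PlanarTree β
  | leaf x => leaf (f x)
  | node x a b => node (f x) (a.map f) (b.map f)

/-- The combinatorial shape: forget the edge marks. -/
def shape (t : PlanarTree α) : PlanarTree Unit := t.map (fun _ => ())

/-- Two embedded trees represent the same tree without planar embedding: one is obtained from the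
other by interchanging the two offspring at some of the internal vertices. -/
inductive Same : PlanarTree α → PlanarTree α → Prop
  | leaf (x : α) : Same (leaf x) (leaf x)
  | node (x : α) {a b a' b' : PlanarTree α} :
      Same a a' → Same b b' → Same (node x a b) (node x a' b')
  | swap (x : α) {a b a' b' : PlanarTree α} :
      Same a a' → Same b b' → Same (node x a b) (node x b' a')

theorem Same.refl (t : PlanarTree α) : Same t t := by
  induction t with
  | leaf x => exact .leaf x
  | node x a b ha hb => exact .node x ha hb

theorem Same.symm {s t : PlanarTree α} (h : Same s t) : Same t s := by
  induction h with
  | leaf x => exact .leaf x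
  | node x _ _ ha hb => exact .node x ha hb
  | swap x _ _ ha hb => exact .swap x hb ha

theorem Same.trans {s t : PlanarTree α} (h : Same s t) :
    ∀ {u : PlanarTree α}, Same t u → Same s u := by
  induction h with
  | leaf x => exact fun h => h
  | node x _ _ ha hb =>
    intro u hu
    cases hu with
    | node _ h1 h2 => exact .node x (ha h1) (hb h2)
    | swap _ h1 h2 => exact .swap x (ha h1) (hb h2)
  | swap x _ _ ha hb =>
    intro u hu
    cases hu with
    | node _ h1 h2 => exact .swap x (ha h2) (hb h1)
    | swap _ h1 h2 => exact .node x (ha h2) (hb h1)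

instance instSetoid (α : Type) : Setoid (PlanarTree α) := ⟨Same, Same.refl, Same.symm, fun h1 h2 => h1.trans h2⟩

/-- The Horton-Strahler order, by hierarchical counting: a leaf has order `1`, and a vertex whose
offspring have orders `i` and `j` has order `max i j + δ_{ij}`. -/
def order : PlanarTree α → ℕ
  | leaf _ => 1
  | node _ a b => if a.order = b.order then a.order + 1 else max a.order b.order

/-- Add `x` to the mark of the root edge. -/
def addRoot [Add α] (x : α) : PlanarTree α → PlanarTree α
  | leaf y => leaf (x + y)
  | node y a b => node (x + y) a b

/-- Horton pruning: remove the leaves together with their parental edges, then apply series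
reduction, which adds the lengths of merging edges. The value `none` is the empty tree `ϕ`. -/
def prune [Add α] : PlanarTree α → Option (PlanarTree α)
  | leaf _ => none
  | node x a b =>
    match a.prune, b.prune with
    | none, none => some (leaf x)
    | some a', none => some (addRoot x a')
    | none, some b' => some (addRoot x b')
    | some a', some b' => some (node x a' b')

/-- The complete subtrees of order `K` other than the tree itself: the subtrees `T_v`, of order
`K`, with `v` different from the top vertex and such that the parent of `v` has another order than
`v` (that is, `v` is the initial vertex of a branch). They are listed without embedding. -/
def properComplete (K : ℕ) : PlanarTree α → Multiset (Quotient (instSetoid α))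
  | leaf _ => 0
  | node x a b =>
      (if a.order = K ∧ a.order ≠ (node x a b).order then {⟦a⟧} else 0)
        + (if b.order = K ∧ b.order ≠ (node x a b).order then {⟦b⟧} else 0)
        + (a.properComplete K + b.properComplete K)

/-- The multiset of all complete subtrees of order `K`. -/
def completeSubtrees (K : ℕ) (t : PlanarTree α) : Multiset (Quotient (instSetoid α)) :=
  (if t.order = K then {⟦t⟧} else 0) + t.properComplete K

open Classical in
/-- The number of branches of order `j` that are alive at time `s`, i.e. the number of edges of
order `j` that contain a point at distance `s` from the root. -/
noncomputable def alive (j : ℕ) : ℝ → PlanarTree ℝ → ℕ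
  | s, leaf x => if s < x then (if j = 1 then 1 else 0) else 0
  | s, node x a b =>
      if s < x then (if (node x a b).order = j then 1 else 0)
      else alive j (s - x) a + alive j (s - x) b

/-- The mark of the edge with the given address (a list of left/right choices, read from the root);
`0` if there is no such edge. -/
def lengthAt : List Bool → PlanarTree ℝ → ℝ
  | [], leaf x => x
  | _ :: _, leaf _ => 0
  | [], node x _ _ => x
  | false :: p, node _ a _ => lengthAt p a
  | true :: p, node _ _ b => lengthAt p b

/-- The coarsest σ-algebra for which the shape and all edge lengths are measurable. -/
instance instMeasurableSpace : MeasurableSpace (PlanarTree ℝ) :=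
  MeasurableSpace.comap shape ⊤ ⊔ ⨆ p : List Bool, MeasurableSpace.comap (lengthAt p) inferInstance

/-- The law of the random metric tree of shape `σ` whose edge lengths are i.i.d. with law `ρ`. -/
noncomputable def iidLengths (ρ : Measure ℝ) : PlanarTree Unit → Measure (PlanarTree ℝ)
  | leaf _ => ρ.map leaf
  | node _ a b =>
      (ρ.prod ((iidLengths ρ a).prod (iidLengths ρ b))).map fun x => node x.1 x.2.1 x.2.2

/-! Invariance under the choice of an embedding -/

theorem Same.map (f : α → β) {s t : PlanarTree α} (h : Same s t) : Same (s.map f) (t.map f) := by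
  induction h with
  | leaf x => exact .leaf _
  | node x _ _ ha hb => exact .node _ ha hb
  | swap x _ _ ha hb => exact .swap _ ha hb

theorem Same.order_eq {s t : PlanarTree α} (h : Same s t) : s.order = t.order := by
  induction h with
  | leaf x => rfl
  | node x _ _ ha hb => simp only [order, ha, hb]
  | swap x _ _ ha hb =>
    simp only [order, ha, hb]
    split_ifs <;> omega

theorem Same.addRoot [Add α] (x : α) {s t : PlanarTree α} (h : Same s t) :
    Same (s.addRoot x) (t.addRoot x) := by
  cases h with
  | leaf y => exact .leaf _
  | node y ha hb => exact .node _ ha hb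
  | swap y ha hb => exact .swap _ ha hb

theorem Same.prune [Add α] {s t : PlanarTree α} (h : Same s t) :
    Option.Rel Same s.prune t.prune := by
  induction h with
  | leaf x => exact .none
  | @node x a b a' b' _ _ ha hb =>
    simp only [PlanarTree.prune]
    revert ha hb
    generalize PlanarTree.prune a = p1
    generalize PlanarTree.prune b = p2
    generalize PlanarTree.prune a' = p3
    generalize PlanarTree.prune b' = p4
    intro ha hb
    cases ha <;> cases hb <;> constructor
    · exact .node _ ‹_› ‹_›
    · exact .addRoot _ ‹_›
    · exact .addRoot _ ‹_›
    · exact .leaf _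
  | @swap x a b a' b' _ _ ha hb =>
    simp only [PlanarTree.prune]
    revert ha hb
    generalize PlanarTree.prune a = p1
    generalize PlanarTree.prune b = p2
    generalize PlanarTree.prune a' = p3
    generalize PlanarTree.prune b' = p4
    intro ha hb
    cases ha <;> cases hb <;> constructor
    · exact .swap _ ‹_› ‹_›
    · exact .addRoot _ ‹_›
    · exact .addRoot _ ‹_›
    · exact .leaf _

theorem Same.properComplete_eq (K : ℕ) {s t : PlanarTree α} (h : Same s t) :
    s.properComplete K = t.properComplete K := by
  induction h with
  | leaf x => rfl
  | node x h1 h2 ha hb =>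
    simp only [properComplete, ha, hb, (Same.node x h1 h2).order_eq, h1.order_eq, h2.order_eq,
      Quotient.sound (s := instSetoid α) h1, Quotient.sound (s := instSetoid α) h2]
  | swap x h1 h2 ha hb =>
    simp only [properComplete, ha, hb, (Same.swap x h1 h2).order_eq, h1.order_eq, h2.order_eq,
      Quotient.sound (s := instSetoid α) h1, Quotient.sound (s := instSetoid α) h2]
    abel

theorem Same.completeSubtrees_eq (K : ℕ) {s t : PlanarTree α} (h : Same s t) :
    s.completeSubtrees K = t.completeSubtrees K := by
  simp only [completeSubtrees, h.properComplete_eq, h.order_eq,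
    Quotient.sound (s := instSetoid α) h]

theorem Same.alive_eq (j : ℕ) {s t : PlanarTree ℝ} (h : Same s t) :
    ∀ u : ℝ, s.alive j u = t.alive j u := by
  induction h with
  | leaf x => exact fun _ => rfl
  | node x h1 h2 ha hb =>
    intro u
    simp only [alive, ha, hb, (Same.node x h1 h2).order_eq]
  | swap x h1 h2 ha hb =>
    intro u
    simp only [alive, ha, hb, (Same.swap x h1 h2).order_eq]
    split_ifs <;> omega

end PlanarTree

/-- Non-empty planted reduced binary trees with edge marks in `α` and with no planar embedding.
`Tree Unit` is the space of non-empty combinatorial trees, `Tree ℝ` that of trees with edge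
lengths. -/
def Tree (α : Type) : Type := Quotient (PlanarTree.instSetoid α)

namespace Tree

variable {α : Type}

/-- Forget the planar embedding. -/
def mk (t : PlanarTree α) : Tree α := Quotient.mk _ t

instance instMeasurableSpace : MeasurableSpace (Tree ℝ) :=
  MeasurableSpace.map Tree.mk PlanarTree.instMeasurableSpace

/-- The combinatorial shape. -/
def shape : Tree α → Tree Unit :=
  Quotient.map PlanarTree.shape fun _ _ h => PlanarTree.Same.map _ h

/-- Multiply all edge lengths by `ζ`. -/
def scale (ζ : ℝ) : Tree ℝ → Tree ℝ :=
  Quotient.map (PlanarTree.map fun x => ζ * x) fun _ _ h => PlanarTree.Same.map _ h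

/-- The Horton-Strahler order. -/
def order : Tree α → ℕ :=
  Quotient.lift PlanarTree.order fun _ _ h => PlanarTree.Same.order_eq h

/-- Horton pruning; `none` is the empty tree. -/
def prune [Add α] : Tree α → Option (Tree α) :=
  Quotient.lift (fun t => t.prune.map Tree.mk) fun s t h => by
    have h' := PlanarTree.Same.prune h
    revert h'
    generalize s.prune = p1
    generalize t.prune = p2
    intro h'
    cases h' with
    | none => rfl
    | some h => exact congrArg some (Quotient.sound h)

/-- The multiset of complete subtrees of order `K`. -/
def completeSubtrees (K : ℕ) : Tree α → Multiset (Tree α) :=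
  Quotient.lift (PlanarTree.completeSubtrees K) fun _ _ h => PlanarTree.Same.completeSubtrees_eq K h

/-- The number of branches of order `j` alive at time `s`. -/
noncomputable def alive (j : ℕ) (s : ℝ) : Tree ℝ → ℕ :=
  Quotient.lift (PlanarTree.alive j s) fun _ _ h => PlanarTree.Same.alive_eq j h s

end Tree

/-! ### Self-similarity of a measure on trees with edge lengths -/

/-- The uniform distribution on a finite multiset. -/
noncomputable def uniformLaw {Ω : Type} [MeasurableSpace Ω] (m : Multiset Ω) : Measure Ω :=
  ((m.card : ℝ≥0∞)⁻¹) • (m.map Measure.dirac).sum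

/-- The law `η_H` of a random tree conditioned to have order `H`. -/
noncomputable def orderLaw (η : Measure (Tree ℝ)) (H : ℕ) : Measure (Tree ℝ) :=
  cond η {T | T.order = H}

/-- The law of `subtree_{K,H}`: a complete subtree of order `K` chosen uniformly at random from a
random tree with law `η_H`. -/
noncomputable def subtreeLaw (η : Measure (Tree ℝ)) (K H : ℕ) : Measure (Tree ℝ) :=
  (orderLaw η H).bind fun T => uniformLaw (T.completeSubtrees K)

/-- The law of the pruned tree `R(T)` conditioned on `R(T) ≠ ϕ`. (The default value of `getD` is
irrelevant under this conditioning.) -/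
noncomputable def prunedLaw (η : Measure (Tree ℝ)) : Measure (Tree ℝ) :=
  (cond η {T | T.prune ≠ none}).map fun T => T.prune.getD T

/-- The law of a tree conditioned on its shape being `τ`. Given the shape, the tree is determined
by its total length and its relative edge lengths, so this is the joint conditional law of those. -/
noncomputable def lawGivenShape (η : Measure (Tree ℝ)) (τ : Tree Unit) : Measure (Tree ℝ) :=
  cond η {T | T.shape = τ}

/-- Self-similarity with respect to pruning, with scaling exponent `ζ`, of a measure on the space
of trees with edge lengths. -/
structure IsSelfSimilar (η : Measure (Tree ℝ)) (ζ : ℝ) : Prop where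
  isProbability : IsProbabilityMeasure η
  /-- coordination in shapes -/
  coord_shape : ∀ K H : ℕ, 1 ≤ K → K ≤ H → ∀ τ : Tree Unit, τ.order = K →
    subtreeLaw η K H {T | T.shape = τ} = orderLaw η K {T | T.shape = τ}
  /-- coordination in lengths -/
  coord_length : ∀ K H : ℕ, 1 ≤ K → K ≤ H → ∀ τ : Tree Unit, τ.order = K →
    lawGivenShape (subtreeLaw η K H) τ = lawGivenShape η τ
  /-- prune-invariance in shapes -/
  prune_shape : ∀ τ : Tree Unit, η {T | T.shape = τ} = prunedLaw η {T | T.shape = τ}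
  exponent_pos : 0 < ζ
  /-- prune-invariance in lengths: given the shape, the relative edge lengths of the pruned tree
  have the same law as those of the original tree, and its total length has the law of `ζ` times
  the total length of the original tree -/
  prune_length : ∀ τ : Tree Unit,
    lawGivenShape (prunedLaw η) τ = (lawGivenShape η τ).map (Tree.scale ζ)

/-- Independently of the combinatorial shape, the edge lengths are i.i.d. with law `ρ`: given that
the shape is that of `σ`, the tree is distributed as `σ` equipped with i.i.d. edge lengths. -/
def HasIIDEdgeLengths (η : Measure (Tree ℝ)) (ρ : Measure ℝ) : Prop :=
  ∀ σ : PlanarTree Unit, η {T | T.shape = Tree.mk σ} ≠ 0 →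
    lawGivenShape η (Tree.mk σ) = (PlanarTree.iidLengths ρ σ).map Tree.mk

/-! ### Hierarchical branching processes -/

/-- The parameters of a hierarchical branching process: Tokunaga coefficients `T k`, `k ≥ 1`,
termination rates `rate j`, `j ≥ 1`, and the distribution `p K`, `K ≥ 1`, of the order of the root
branch. (Values at the index `0` play no role.) -/
structure Hierarchical where
  T : ℕ → ℝ
  rate : ℕ → ℝ
  p : ℕ → ℝ
  T_nonneg : ∀ k, 1 ≤ k → 0 ≤ T k
  rate_pos : ∀ j, 1 ≤ j → 0 < rate j
  p_nonneg : ∀ K, 1 ≤ K → 0 ≤ p K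
  p_sum : HasSum (fun n => p (n + 1)) 1

/-- The law of an exponential clock of rate `r ≥ 0`; a clock of rate `0` never rings. -/
noncomputable def clockLaw (r : ℝ) : Measure ℝ≥0∞ :=
  if r = 0 then Measure.dirac ⊤ else (expMeasure r).map ENNReal.ofReal

namespace Hierarchical

variable (S : Hierarchical)

/-- The rates of the events that may happen to a living branch of order `K + 1`: termination
(`none`) at rate `λ_{K+1}`, and the production of an offspring of order `i + 1 < K + 1` (`some i`)
at rate `λ_{K+1} T_{(K+1)-(i+1)}`. -/
def eventRate (K : ℕ) : Option (Fin K) → ℝ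
  | none => S.rate (K + 1)
  | some i => S.rate (K + 1) * S.T (K - i)

/-- Let independent exponential clocks run, one for every event that may happen to a branch of
order `K + 1`. This is the law of the ringing time of the clock `e`, on the event that it is the
first one to ring (hence a measure of mass at most `1`). -/
noncomputable def firstRing (K : ℕ) (e : Option (Fin K)) : Measure ℝ :=
  ((Measure.pi fun e' => clockLaw (S.eventRate K e')).restrict {x | ∀ e', e' ≠ e → x e < x e'}).map
    fun x => (x e).toReal

/-- The law, for `K = m + 1`, of the tree below a branch of order `K + 1` on the event that
nothing happens to it before it terminates and splits into two branches of order `K`, which evolve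
independently with law `Q`; for `K = 0` the branch terminates without offspring. -/
noncomputable def terminate (K : ℕ) (Q : Fin K → Measure (PlanarTree ℝ)) :
    Measure (PlanarTree ℝ) :=
  match K, Q with
  | 0, _ => (S.firstRing 0 none).map PlanarTree.leaf
  | m + 1, Q =>
      ((S.firstRing (m + 1) none).prod ((Q (Fin.last m)).prod (Q (Fin.last m)))).map
        fun x => PlanarTree.node x.1 x.2.1 x.2.2

/-- One step of the evolution of a branch of order `K + 1`: the first event is the birth of an
offspring of some order `i + 1 < K + 1`, which then independently generates a tree with law `Q i`,
while the branch itself continues to live, with all clocks restarted, and generates a tree with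
law `ν`. -/
noncomputable def sideBranch (K : ℕ) (Q : Fin K → Measure (PlanarTree ℝ))
    (ν : Measure (PlanarTree ℝ)) : Measure (PlanarTree ℝ) :=
  ∑ i : Fin K, ((S.firstRing K (some i)).prod (ν.prod (Q i))).map
    fun x => PlanarTree.node x.1 x.2.1 x.2.2

/-- The law of the tree generated by a branch of order `K + 1`, as a sum over the number `m` of
offspring that are produced before termination. -/
noncomputable def branchLaw (K : ℕ) : Measure (PlanarTree ℝ) :=
  Measure.sum fun m : ℕ =>
    (S.sideBranch K fun i => branchLaw i)^[m] (S.terminate K fun i => branchLaw i)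
termination_by K
decreasing_by all_goals exact i.isLt

/-- The law of the random tree `T[S]` generated by the process: the root branch has order `K` with
probability `p_K`. -/
noncomputable def treeLaw : Measure (Tree ℝ) :=
  (Measure.sum fun K : ℕ => ENNReal.ofReal (S.p (K + 1)) • S.branchLaw K).map Tree.mk

/-! ### Criticality and time-invariance -/

/-- `x_j(s)`: the expected number of branches of order `j` alive at time `s`. -/
noncomputable def meanAlive (j : ℕ) (s : ℝ) : ℝ≥0∞ := ∫⁻ T, (T.alive j s : ℝ≥0∞) ∂S.treeLaw

/-- The width function `C(s) = ∑_{j ≥ 1} x_j(s)`: the average progeny at time `s`. -/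
noncomputable def width (s : ℝ) : ℝ≥0∞ := ∑' n : ℕ, S.meanAlive (n + 1) s

/-- The process is critical: `C(s) = 1` for all `s ≥ 0`. -/
def IsCritical : Prop := ∀ s : ℝ, 0 ≤ s → S.width s = 1

/-- The sequence space `ℓ¹`; the index `n` stands for the order `n + 1`. -/
abbrev L1 : Type := lp (fun _ : ℕ => ℝ) 1

/-- The initial distribution `π = ∑ p_K e_K`, as an element of `ℓ¹`. -/
def initial : L1 :=
  ⟨fun n => S.p (n + 1), memℓp_gen (by
    have h : (fun n => ‖S.p (n + 1)‖ ^ (1 : ℝ≥0∞).toReal) = fun n => S.p (n + 1) := by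
      funext n
      simp [abs_of_nonneg (S.p_nonneg (n + 1) (by omega))]
    rw [h]
    exact S.p_sum.summable)⟩

/-- The entries of the upper triangular Toeplitz matrix `G`, with `-1` on the diagonal, `T_1 + 2`
on the first superdiagonal and `T_k` on the `k`-th superdiagonal, `k ≥ 2`. -/
def G (n m : ℕ) : ℝ :=
  if m = n then -1 else if m = n + 1 then S.T 1 + 2 else if n < m then S.T (m - n) else 0

/-- `A` is the operator `GΛ` on `ℓ¹`, where `Λ = diag(λ_1, λ_2, …)`. -/
def IsGenerator (A : L1 →L[ℝ] L1) : Prop :=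
  ∀ (x : L1) (n : ℕ), HasSum (fun m : ℕ => S.G n m * S.rate (m + 1) * x m) (A x n)

/-- The process is time-invariant: `GΛ` is a bounded operator on `ℓ¹` and `e^{GΛs} π = π` for all
`s ≥ 0`. -/
def IsTimeInvariant : Prop :=
  ∃ A : L1 →L[ℝ] L1, S.IsGenerator A ∧
    ∀ s : ℝ, 0 ≤ s → NormedSpace.exp (s • A) S.initial = S.initial

/-! ### Characteristics of the Tokunaga sequence -/

/-- `L = limsup T_k^{1/k}`. -/
noncomputable def L : ℝ≥0∞ :=
  limsup (fun k : ℕ => ENNReal.ofReal (S.T k) ^ (1 / (k : ℝ))) atTop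

/-- `t̂(z) = -1 + 2z + ∑_{k ≥ 1} z^k T_k`. -/
noncomputable def tHat (z : ℂ) : ℂ := -1 + 2 * z + ∑' n : ℕ, z ^ (n + 1) * (S.T (n + 1) : ℂ)

/-- `v` is a real root of `t̂` in `(0, 1/2]`, inside the disc `|z| < 1/L` where `t̂` is defined. -/
def IsSmallRoot (v : ℝ) : Prop :=
  0 < v ∧ v ≤ 1 / 2 ∧ ‖v‖ₑ * S.L < 1 ∧ S.tHat (v : ℂ) = 0

/-- `R = 1 / w_0` is the Horton exponent, where `w_0` is the unique real root of `t̂` in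
`(0, 1/2]`. -/
def IsHortonExponent (R : ℝ) : Prop :=
  ∃ w₀ : ℝ, (∀ v : ℝ, S.IsSmallRoot v ↔ v = w₀) ∧ R = w₀⁻¹

end Hierarchical

/-- The critical probability `p_c = 1 - ζ / R`. -/
noncomputable def criticalProb (ζ R : ℝ) : ℝ := 1 - ζ / R

/-- The critical Tokunaga process `S^Tok(t; c, γ)`. -/
noncomputable def tokunaga (c γ : ℝ) (hc : 1 ≤ c) (hγ : 0 < γ) : Hierarchical where
  T k := (c - 1) * c ^ (k - 1)
  rate j := γ * c ^ (2 - (j : ℤ))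
  p K := (2 : ℝ)⁻¹ ^ K
  T_nonneg k _ := mul_nonneg (by linarith) (pow_nonneg (by linarith) _)
  rate_pos j _ := mul_pos hγ (zpow_pos (by linarith) _)
  p_nonneg K _ := by positivity
  p_sum := by
    have h := (hasSum_geometric_of_lt_one (r := (2 : ℝ)⁻¹) (by norm_num) (by norm_num)).mul_left
      ((2 : ℝ)⁻¹)
    have e : (2 : ℝ)⁻¹ * (1 - 2⁻¹)⁻¹ = 1 := by norm_num
    rw [e] at h
    simpa only [pow_succ'] using h

end HBP

open HBP

/-! Everything rests on one cancellation of rates. A branch of order `K + 1` terminates at rate `γ c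
· c^(-K)`, and because `T_k = (c-1) c^(k-1)` it bears offspring of order `i + 1` at rate `γ c (c-1)
c^(-(i+1))`, which no longer depends on `K`. These rates telescope to the total `γ c` for every
order (`tokunaga_sum_eventRate`). Hence the waiting time to the next event is always exponential of
rate `γ c`, independent of the type of the event. Edge lengths are therefore i.i.d. and independent
of the shape, and the law of the tree below a branch satisfies a first-event equation (`tokLaw_eq`)
with the explicit probabilities `stopProb` and `birthProb`.

Pruning erases offspring of order one, which appear with probability `1 - 1/c`, and merges the edges
around them; the other probabilities acquire a factor `1/c` when orders are shifted by one. A merged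
edge is a geometric sum of exponentials of rate `γ c`, that is, exponential of rate `γ`, or `c`
times an original edge (`expMeasure_renewal`). So the pruned tree of a branch of order `K + 2` and
the `c`-scaled tree of a branch of order `K + 1` solve the same affine equation `prunedStep`, whose
linear part strictly decreases mass (`prunedStep_unique`), and they coincide (`map_pruned_tokLaw`).
Since `p_(K+1) = p_K / 2`, this passes to the mixture over the root order. The exponent is unique
because the one-edge tree already detects the scale.

Coordination expresses the branching property: complete subtrees are copies of the same random tree,
whatever their number. The identity `CoordinatedWith`, which carries an arbitrary weight depending
on that number, is stable under grafting; the weight `1/n` gives the uniform choice.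

For criticality, edges are sorted by depth. The depth reached at time `s` has a Poisson law of
parameter `γ c s`, and the mean number of edges of each order at a given depth evolves by a mean
matrix that leaves `2^(-K)` invariant (`tsum_meanStep`), since the tail of this geometric law equals
its last mass. Thus `x_j(s) = p_j` for all `s ≥ 0`. In the generator the decay of `λ_j` compensates
the growth of `T_k`, so its columns are bounded in `ℓ¹`; it annihilates `π`, and its exponential
fixes `π`. The constants come from a geometric series. -/

namespace HBP

namespace PlanarTree

/-! ### Measurability on the space of planar trees -/

variable {α β : Type}

/-- An injective numbering of combinatorial trees. -/
def number : PlanarTree Unit → ℕ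
  | leaf _ => 0
  | node _ a b => Nat.pair a.number b.number + 1

theorem number_injective : Function.Injective number := by
  intro s
  induction s with
  | leaf x =>
    intro t h
    cases t with
    | leaf y => rfl
    | node y a b => simp [number] at h
  | node x a b ha hb =>
    intro t h
    cases t with
    | leaf y => simp [number] at h
    | node y a' b' =>
      simp only [number, Nat.add_right_cancel_iff, Nat.pair_eq_pair] at h
      rw [ha h.1, hb h.2]

instance : Countable (PlanarTree Unit) := number_injective.countable

@[simp] theorem shape_leaf (x : α) : (leaf x).shape = leaf () := rfl

@[simp] theorem shape_node (x : α) (a b : PlanarTree α) :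
    (node x a b).shape = node () a.shape b.shape := rfl

/-- The tree of shape `σ` whose edge lengths are prescribed at every address. -/
def fill : PlanarTree Unit → (List Bool → ℝ) → PlanarTree ℝ
  | leaf _, ℓ => leaf (ℓ [])
  | node _ a b, ℓ =>
      node (ℓ []) (fill a fun p => ℓ (false :: p)) (fill b fun p => ℓ (true :: p))

theorem shape_fill (σ : PlanarTree Unit) (ℓ : List Bool → ℝ) : (fill σ ℓ).shape = σ := by
  induction σ generalizing ℓ with
  | leaf x => rfl
  | node x a b ha hb => simp [fill, ha, hb]

theorem fill_shape (t : PlanarTree ℝ) : fill t.shape (fun p => lengthAt p t) = t := by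
  induction t with
  | leaf x => rfl
  | node x a b ha hb => simp [fill, lengthAt, ha, hb]

theorem measurableSet_shape (A : Set (PlanarTree Unit)) :
    MeasurableSet {t : PlanarTree ℝ | t.shape ∈ A} := by
  have h : MeasurableSpace.comap (shape (α := ℝ)) ⊤ ≤ instMeasurableSpace := le_sup_left
  exact h _ ⟨A, trivial, rfl⟩

theorem measurable_lengthAt (p : List Bool) : Measurable (lengthAt p) := by
  have h : MeasurableSpace.comap (lengthAt p) inferInstance ≤ instMeasurableSpace :=
    le_sup_of_le_right (le_iSup (fun p => MeasurableSpace.comap (lengthAt p) inferInstance) p)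
  exact fun s hs => h _ ⟨s, hs, rfl⟩

/-- The σ-algebra is a supremum of pullbacks, so generators can be tested separately; as there are
countably many shapes, single shapes suffice. -/
theorem measurable_iff {δ : Type*} [MeasurableSpace δ] {f : δ → PlanarTree ℝ} :
    Measurable f ↔
      (∀ σ, MeasurableSet {x | (f x).shape = σ}) ∧ ∀ p, Measurable fun x => lengthAt p (f x) := by
  refine ⟨fun h => ⟨fun σ => h (measurableSet_shape {σ}), fun p => (measurable_lengthAt p).comp h⟩,
    fun h => ?_⟩
  rw [measurable_iff_comap_le, instMeasurableSpace, MeasurableSpace.comap_sup, sup_le_iff,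
    MeasurableSpace.comap_iSup, iSup_le_iff]
  constructor
  · rintro _ ⟨_, ⟨A, -, rfl⟩, rfl⟩
    have : f ⁻¹' (shape ⁻¹' A) = ⋃ σ ∈ A, {x | (f x).shape = σ} := by
      ext x; simp
    rw [this]
    exact MeasurableSet.biUnion A.to_countable fun σ _ => h.1 σ
  · intro p
    rintro _ ⟨_, ⟨A, hA, rfl⟩, rfl⟩
    exact h.2 p hA

theorem lengthAt_fill_measurable (σ : PlanarTree Unit) (p : List Bool) :
    Measurable fun ℓ => lengthAt p (fill σ ℓ) := by
  induction σ generalizing p with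
  | leaf x =>
    cases p with
    | nil => exact measurable_pi_apply _
    | cons b p => exact measurable_const
  | node x a b ha hb =>
    match p with
    | [] => exact measurable_pi_apply _
    | false :: p => exact (ha p).comp (measurable_pi_lambda _ fun q => measurable_pi_apply _)
    | true :: p => exact (hb p).comp (measurable_pi_lambda _ fun q => measurable_pi_apply _)

theorem measurable_fill (σ : PlanarTree Unit) : Measurable (fill σ) := by
  refine measurable_iff.2 ⟨fun τ => ?_, lengthAt_fill_measurable σ⟩
  simp only [shape_fill]
  exact MeasurableSet.const _

/-- The space is a countable union of measurable cells, one per shape, on each of which a tree is a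
function of its lengths. Measurability thus becomes an induction on shapes. -/
theorem measurable_of_fill {δ : Type*} [MeasurableSpace δ] {g : PlanarTree ℝ → δ}
    (h : ∀ σ, Measurable fun ℓ => g (fill σ ℓ)) : Measurable g := by
  intro S hS
  have : g ⁻¹' S = ⋃ σ, {t : PlanarTree ℝ | t.shape ∈ ({σ} : Set _)} ∩
      (fun t p => lengthAt p t) ⁻¹' ((fun ℓ => g (fill σ ℓ)) ⁻¹' S) := by
    ext t
    simp [fill_shape]
  rw [this]
  exact MeasurableSet.iUnion fun σ => (measurableSet_shape _).inter
    (measurable_pi_lambda _ measurable_lengthAt (h σ hS))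

theorem measurable_leaf : Measurable (leaf : ℝ → PlanarTree ℝ) := by
  refine measurable_iff.2 ⟨fun σ => ?_, fun p => ?_⟩
  · simp only [shape_leaf]
    exact MeasurableSet.const _
  cases p with
  | nil => exact measurable_id
  | cons b p => exact measurable_const

theorem measurable_node :
    Measurable fun x : ℝ × PlanarTree ℝ × PlanarTree ℝ => node x.1 x.2.1 x.2.2 := by
  refine measurable_iff.2 ⟨fun σ => ?_, fun p => ?_⟩
  · cases σ with
    | leaf => simp
    | node y a b =>
      have : {x : ℝ × PlanarTree ℝ × PlanarTree ℝ | (node x.1 x.2.1 x.2.2).shape = node y a b} =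
          {x | x.2.1.shape ∈ ({a} : Set _)} ∩ {x | x.2.2.shape ∈ ({b} : Set _)} := by
        ext x; simp
      rw [this]
      exact (measurable_snd.fst (measurableSet_shape _)).inter
        (measurable_snd.snd (measurableSet_shape _))
  · match p with
    | [] => exact measurable_fst
    | false :: p => exact (measurable_lengthAt p).comp measurable_snd.fst
    | true :: p => exact (measurable_lengthAt p).comp measurable_snd.snd

theorem _root_.Measurable.planarNode {δ : Type*} [MeasurableSpace δ] {f : δ → ℝ}
    {g h : δ → PlanarTree ℝ} (hf : Measurable f) (hg : Measurable g) (hh : Measurable h) :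
    Measurable fun x => node (f x) (g x) (h x) :=
  measurable_node.comp (hf.prodMk (hg.prodMk hh))

/-- A statistic that is given on `node x a b` by a measurable function of `x`, `a`, `b` and of its
own values at `a` and `b`, is measurable. -/
theorem measurable_of_rec {δ : Type*} [MeasurableSpace δ] {g : PlanarTree ℝ → δ}
    (F : ℝ → PlanarTree ℝ → PlanarTree ℝ → δ → δ → δ)
    (hl : Measurable fun x => g (leaf x))
    (hF : Measurable fun x : ℝ × PlanarTree ℝ × PlanarTree ℝ × δ × δ =>
      F x.1 x.2.1 x.2.2.1 x.2.2.2.1 x.2.2.2.2)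
    (hg : ∀ x a b, g (node x a b) = F x a b (g a) (g b)) : Measurable g := by
  refine measurable_of_fill fun σ => ?_
  induction σ with
  | leaf y => exact hl.comp (measurable_pi_apply _)
  | node y a b ha hb =>
    have hs : ∀ e : Bool, Measurable fun (ℓ : List Bool → ℝ) (p : List Bool) => ℓ (e :: p) :=
      fun e => measurable_pi_lambda _ fun q => measurable_pi_apply _
    simp only [fill, hg]
    exact hF.comp ((measurable_pi_apply _).prodMk
      (((measurable_fill a).comp (hs _)).prodMk (((measurable_fill b).comp (hs _)).prodMk
        ((ha.comp (hs _)).prodMk (hb.comp (hs _))))))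

/-- The planar tree space is the disjoint union of `ℝ` and `ℝ × PlanarTree ℝ × PlanarTree ℝ`. -/
theorem measurable_of_leaf_node {δ : Type*} [MeasurableSpace δ] {g : PlanarTree ℝ → δ}
    (hl : Measurable fun x => g (leaf x))
    (hn : Measurable fun x : ℝ × PlanarTree ℝ × PlanarTree ℝ => g (node x.1 x.2.1 x.2.2)) :
    Measurable g :=
  measurable_of_rec (fun x a b _ _ => g (node x a b)) hl
    (hn.comp (measurable_fst.prodMk (measurable_snd.fst.prodMk measurable_snd.snd.fst)))
    fun _ _ _ => rfl

/-- A statistic of the shape is measurable. -/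
theorem measurable_comp_shape {δ : Type*} [MeasurableSpace δ] (g : PlanarTree Unit → δ) :
    Measurable fun t : PlanarTree ℝ => g t.shape :=
  measurable_of_fill fun σ => by simp only [shape_fill]; exact measurable_const

theorem order_map (f : α → β) (t : PlanarTree α) : (t.map f).order = t.order := by
  induction t with
  | leaf x => rfl
  | node x a b ha hb => simp only [map, order, ha, hb]

theorem order_shape (t : PlanarTree α) : t.shape.order = t.order := order_map _ t

theorem measurable_order : Measurable (order : PlanarTree ℝ → ℕ) := by
  simpa only [order_shape] using measurable_comp_shape order

theorem one_le_order (t : PlanarTree α) : 1 ≤ t.order := by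
  induction t with
  | leaf x => rfl
  | node x a b ha hb =>
    simp only [order]
    split_ifs <;> omega

theorem measurable_map {f : ℝ → ℝ} (hf : Measurable f) :
    Measurable (map f : PlanarTree ℝ → PlanarTree ℝ) :=
  measurable_of_rec (fun x _ _ a' b' => node (f x) a' b') (measurable_leaf.comp hf)
    ((hf.comp measurable_fst).planarNode measurable_snd.snd.snd.fst measurable_snd.snd.snd.snd)
    fun _ _ _ => rfl

theorem measurable_addRoot :
    Measurable fun x : ℝ × PlanarTree ℝ => addRoot x.1 x.2 := by
  refine measurable_iff.2 ⟨fun σ => ?_, fun p => ?_⟩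
  · have : ∀ (x : ℝ) (t : PlanarTree ℝ), (addRoot x t).shape = t.shape := by
      intro x t; cases t <;> rfl
    simp only [this]
    exact measurable_snd (measurableSet_shape {σ})
  · match p with
    | [] =>
      have : ∀ (x : ℝ) (t : PlanarTree ℝ), lengthAt [] (addRoot x t) = x + lengthAt [] t := by
        intro x t; cases t <;> rfl
      simp only [this]
      exact measurable_fst.add ((measurable_lengthAt _).comp measurable_snd)
    | e :: p =>
      have : ∀ (x : ℝ) (t : PlanarTree ℝ), lengthAt (e :: p) (addRoot x t) = lengthAt (e :: p) t := by
        intro x t; cases t <;> cases e <;> rfl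
      simp only [this]
      exact (measurable_lengthAt _).comp measurable_snd

/-- The σ-algebra of `Tree ℝ` is the final one along `Tree.mk`, so measurability of maps out of it
is checked on planar representatives, by definition. -/
theorem measurable_mk : Measurable (Tree.mk : PlanarTree ℝ → Tree ℝ) := fun _ h => h

theorem _root_.HBP.Tree.measurable_of_mk {δ : Type*} [MeasurableSpace δ] {g : Tree ℝ → δ}
    (h : Measurable fun t => g (Tree.mk t)) : Measurable g := fun _ hS => h hS

theorem _root_.HBP.Tree.measurableSet_shape (τ : Tree Unit) :
    MeasurableSet {T : Tree ℝ | T.shape = τ} :=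
  PlanarTree.measurableSet_shape {σ | Tree.mk σ = τ}

theorem _root_.HBP.Tree.measurableSet_order (K : ℕ) :
    MeasurableSet {T : Tree ℝ | T.order = K} :=
  measurable_order (measurableSet_singleton K)

theorem _root_.HBP.Tree.measurable_scale (ζ : ℝ) : Measurable (Tree.scale ζ) :=
  Tree.measurable_of_mk (measurable_mk.comp (measurable_map (measurable_const_mul ζ)))

/-- Pruning, with the convention that trees without side branches are left unchanged. -/
noncomputable def pruned (t : PlanarTree ℝ) : PlanarTree ℝ := t.prune.getD t

-- Pruning empties exactly the trees of order one, so the case distinction on pruned children can be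
-- made on their orders, which are almost surely known under each branch law.
open Classical in
theorem pruned_node (x : ℝ) (a b : PlanarTree ℝ) :
    pruned (node x a b) =
      if a.order = 1 then (if b.order = 1 then leaf x else addRoot x b.pruned)
      else if b.order = 1 then addRoot x a.pruned else node x a.pruned b.pruned := by
  have h1 : ∀ (x : ℝ) (a b : PlanarTree ℝ), (node x a b).order ≠ 1 := by
    intro x a b
    have := one_le_order a
    have := one_le_order b
    simp only [order]
    split_ifs <;> omega
  have h2 : ∀ t : PlanarTree ℝ, (t.order = 1 ∧ t.prune = none) ∨
      (t.order ≠ 1 ∧ t.prune = some t.pruned) := by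
    intro t
    cases t with
    | leaf x => exact .inl ⟨rfl, rfl⟩
    | node x a b =>
      refine .inr ⟨h1 _ _ _, ?_⟩
      unfold pruned
      simp only [prune]
      cases a.prune <;> cases b.prune <;> rfl
  unfold pruned
  simp only [prune]
  rcases h2 a with ⟨ha, ha'⟩ | ⟨ha, ha'⟩ <;> rcases h2 b with ⟨hb, hb'⟩ | ⟨hb, hb'⟩ <;>
    rw [ha', hb'] <;> simp [ha, hb]

theorem prune_eq_none_iff (t : PlanarTree ℝ) : t.prune = none ↔ t.order = 1 := by
  cases t with
  | leaf x => simp [prune, order]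
  | node x a b =>
    have ha := one_le_order a
    have hb := one_le_order b
    have h1 : (node x a b).order ≠ 1 := by
      simp only [order]
      split_ifs <;> omega
    simp only [prune, h1, iff_false]
    cases a.prune <;> cases b.prune <;> simp

theorem measurable_pruned : Measurable pruned := by
  classical
  refine measurable_of_rec (fun x a b a' b' =>
    if a.order = 1 then (if b.order = 1 then leaf x else addRoot x b')
      else if b.order = 1 then addRoot x a' else node x a' b') measurable_leaf ?_
    (fun x a b => pruned_node x a b)
  have e1 : MeasurableSet {x : ℝ × PlanarTree ℝ × PlanarTree ℝ × PlanarTree ℝ × PlanarTree ℝ |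
      x.2.1.order = 1} := (measurable_order.comp measurable_snd.fst) (measurableSet_singleton 1)
  have e2 : MeasurableSet {x : ℝ × PlanarTree ℝ × PlanarTree ℝ × PlanarTree ℝ × PlanarTree ℝ |
      x.2.2.1.order = 1} :=
    (measurable_order.comp measurable_snd.snd.fst) (measurableSet_singleton 1)
  exact Measurable.ite e1 (Measurable.ite e2 (measurable_leaf.comp measurable_fst)
      (measurable_addRoot.comp (measurable_fst.prodMk measurable_snd.snd.snd.snd)))
    (Measurable.ite e2 (measurable_addRoot.comp (measurable_fst.prodMk measurable_snd.snd.snd.fst))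
      (measurable_fst.planarNode measurable_snd.snd.snd.fst measurable_snd.snd.snd.snd))

end PlanarTree

/-! ### Exponential clocks -/

theorem expMeasure_eq_withDensity (r : ℝ) :
    expMeasure r = volume.withDensity (exponentialPDF r) := rfl

theorem measurable_exponentialPDF (r : ℝ) : Measurable (exponentialPDF r) :=
  (measurable_exponentialPDFReal r).ennreal_ofReal

theorem expMeasure_Ioi {r : ℝ} (hr : 0 < r) {x : ℝ} (hx : 0 ≤ x) :
    expMeasure r (Set.Ioi x) = ENNReal.ofReal (Real.exp (-(r * x))) := by
  have := isProbabilityMeasure_expMeasure hr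
  have h := cdf_expMeasure_eq hr x
  rw [if_pos hx, cdf_eq_real] at h
  have h2 : (expMeasure r).real (Set.Ioi x) = Real.exp (-(r * x)) := by
    rw [← Set.compl_Iic, probReal_compl_eq_one_sub measurableSet_Iic, h]; ring
  rw [← h2, ofReal_measureReal]

theorem expMeasure_nonneg {r : ℝ} (hr : 0 < r) : ∀ᵐ x ∂expMeasure r, 0 < x := by
  have := isProbabilityMeasure_expMeasure hr
  have h := expMeasure_Ioi hr le_rfl
  rw [mul_zero, neg_zero, Real.exp_zero, ENNReal.ofReal_one] at h
  exact (prob_compl_eq_zero_iff measurableSet_Ioi).2 h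

theorem expMeasure_Ioi_of_neg {r : ℝ} (hr : 0 < r) {x : ℝ} (hx : x ≤ 0) :
    expMeasure r (Set.Ioi x) = 1 := by
  have := isProbabilityMeasure_expMeasure hr
  rw [← prob_compl_eq_zero_iff measurableSet_Ioi]
  refine measure_mono_null ?_ (ae_iff.1 (expMeasure_nonneg hr))
  intro y hy hy'
  exact hy (hx.trans_lt hy')

theorem measure_ext_of_Ioi {μ ν : Measure ℝ} [IsFiniteMeasure μ] [IsFiniteMeasure ν]
    (huniv : μ Set.univ = ν Set.univ) (h : ∀ t, μ (Set.Ioi t) = ν (Set.Ioi t)) : μ = ν := by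
  refine Measure.ext_of_Iic μ ν fun t => ?_
  rw [← Set.compl_Ioi, measure_compl measurableSet_Ioi (measure_ne_top _ _),
    measure_compl measurableSet_Ioi (measure_ne_top _ _), huniv, h]

theorem map_mul_expMeasure {r c : ℝ} (hr : 0 < r) (hc : 0 < c) :
    (expMeasure r).map (fun x => c * x) = expMeasure (r / c) := by
  have := isProbabilityMeasure_expMeasure hr
  have := isProbabilityMeasure_expMeasure (div_pos hr hc)
  have hm : Measurable fun x : ℝ => c * x := measurable_const_mul c
  have := Measure.isProbabilityMeasure_map (μ := expMeasure r) hm.aemeasurable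
  refine measure_ext_of_Ioi (by simp) fun t => ?_
  rw [Measure.map_apply hm measurableSet_Ioi]
  have : (fun x => c * x) ⁻¹' Set.Ioi t = Set.Ioi (t / c) := by
    ext x; simp [div_lt_iff₀' hc]
  rw [this]
  rcases le_total 0 t with h | h
  · rw [expMeasure_Ioi hr (div_nonneg h hc.le), expMeasure_Ioi (div_pos hr hc) h]
    congr 3; ring
  · rw [expMeasure_Ioi_of_neg hr (div_nonpos_of_nonpos_of_nonneg h hc.le),
      expMeasure_Ioi_of_neg (div_pos hr hc) h]

/-- Turns integrals against an exponential law into interval integrals, to which the fundamental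
theorem of calculus applies. Nonnegativity of `h` is needed on `[0, s]` only. -/
theorem lintegral_Iic_expMeasure {r : ℝ} (hr : 0 < r) {s : ℝ} (hs : 0 ≤ s) {h : ℝ → ℝ}
    (hc : Continuous h) (h0 : ∀ x, 0 ≤ x → x ≤ s → 0 ≤ h x) :
    ∫⁻ x in Set.Iic s, ENNReal.ofReal (h x) ∂expMeasure r =
      ENNReal.ofReal (∫ x in (0 : ℝ)..s, r * Real.exp (-(r * x)) * h x) := by
  have e1 : (expMeasure r).restrict (Set.Iic s) = (expMeasure r).restrict (Set.Ioc 0 s) := by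
    refine Measure.restrict_congr_set ?_
    filter_upwards [expMeasure_nonneg hr] with x hx
    exact propext ⟨fun h => ⟨hx, h⟩, fun h => h.2⟩
  have hcont : Continuous fun x => r * Real.exp (-(r * x)) * h x := by fun_prop
  rw [e1, expMeasure_eq_withDensity, restrict_withDensity measurableSet_Ioc,
    lintegral_withDensity_eq_lintegral_mul _ (measurable_exponentialPDF r)
      hc.measurable.ennreal_ofReal, intervalIntegral.integral_of_le hs,
    ofReal_integral_eq_lintegral_ofReal]
  · refine setLIntegral_congr_fun measurableSet_Ioc fun x hx => ?_
    simp only [Pi.mul_apply]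
    rw [exponentialPDF_of_nonneg hx.1.le, ← ENNReal.ofReal_mul (by positivity)]
  · exact (hcont.integrableOn_Icc (a := 0) (b := s)).mono_set Set.Ioc_subset_Icc_self
  · filter_upwards [ae_restrict_mem measurableSet_Ioc] with x hx
    exact mul_nonneg (by positivity) (h0 x hx.1.le hx.2)

/-- A geometric sum of exponential variables is exponential: a variable with rate `b` is with
probability `b / a` a variable of rate `a`, and otherwise the sum of such a variable and of an
independent copy of itself. -/
theorem expMeasure_renewal {a b : ℝ} (hb : 0 < b) (hab : b ≤ a) :
    ENNReal.ofReal (1 - b / a) • ((expMeasure a).prod (expMeasure b)).map (fun x => x.1 + x.2) +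
      ENNReal.ofReal (b / a) • expMeasure a = expMeasure b := by
  have ha : 0 < a := hb.trans_le hab
  have := isProbabilityMeasure_expMeasure ha
  have := isProbabilityMeasure_expMeasure hb
  rcases hab.eq_or_lt with rfl | hlt
  -- For `b = a` the weight of the convolution vanishes; the primitive used below divides by `a -
  -- b`.
  · simp [div_self hb.ne']
  have hm : Measurable fun x : ℝ × ℝ => x.1 + x.2 := by fun_prop
  have := Measure.isProbabilityMeasure_map
    (μ := (expMeasure a).prod (expMeasure b)) hm.aemeasurable
  have hba : b / a < 1 := (div_lt_one ha).2 hlt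
  have hba0 : 0 < b / a := div_pos hb ha
  have htot : ENNReal.ofReal (1 - b / a) + ENNReal.ofReal (b / a) = 1 := by
    rw [← ENNReal.ofReal_add (by linarith) hba0.le]; simp
  have huniv : (ENNReal.ofReal (1 - b / a) •
      ((expMeasure a).prod (expMeasure b)).map (fun x => x.1 + x.2) +
      ENNReal.ofReal (b / a) • expMeasure a) Set.univ = 1 := by simp [htot]
  have : IsFiniteMeasure (ENNReal.ofReal (1 - b / a) •
      ((expMeasure a).prod (expMeasure b)).map (fun x => x.1 + x.2) +
      ENNReal.ofReal (b / a) • expMeasure a) := ⟨by rw [huniv]; exact ENNReal.one_lt_top⟩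
  refine measure_ext_of_Ioi (by rw [huniv]; simp) fun t => ?_
  -- Survival functions are compared, conditioning on the first summand.
  have hconv : ((expMeasure a).prod (expMeasure b)).map (fun x => x.1 + x.2) (Set.Ioi t) =
      ∫⁻ x, expMeasure b (Set.Ioi (t - x)) ∂expMeasure a := by
    rw [Measure.map_apply hm measurableSet_Ioi, Measure.prod_apply (hm measurableSet_Ioi)]
    refine lintegral_congr fun x => ?_
    congr 1
    ext y
    simp [sub_lt_iff_lt_add']
  simp only [Measure.add_apply, Measure.smul_apply, smul_eq_mul, hconv]
  rcases le_total t 0 with ht | ht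
  · have : ∫⁻ x, expMeasure b (Set.Ioi (t - x)) ∂expMeasure a = 1 := by
      rw [lintegral_congr_ae (g := fun _ => 1)]
      · simp
      · filter_upwards [expMeasure_nonneg ha] with x hx
        exact expMeasure_Ioi_of_neg hb (by linarith)
    rw [this, expMeasure_Ioi_of_neg ha ht, expMeasure_Ioi_of_neg hb ht, mul_one, mul_one, htot]
  · have hint : ∫ x in (0 : ℝ)..t, a * Real.exp (-(a * x)) * Real.exp (-(b * (t - x))) =
        a / (a - b) * (Real.exp (-(b * t)) - Real.exp (-(a * t))) := by
      have hd : ∀ x ∈ Set.uIcc 0 t, HasDerivAt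
          (fun x => -(a / (a - b)) * Real.exp (-(b * t) - (a - b) * x))
          (a * Real.exp (-(a * x)) * Real.exp (-(b * (t - x)))) x := by
        intro x _
        have h1 : HasDerivAt (fun x => -(b * t) - (a - b) * x) (-((a - b) * 1)) x :=
          ((hasDerivAt_id x).const_mul (a - b)).const_sub _
        convert! (h1.exp.const_mul (-(a / (a - b)))) using 1
        have : a - b ≠ 0 := by linarith
        rw [mul_assoc, ← Real.exp_add,
          show -(a * x) + -(b * (t - x)) = -(b * t) - (a - b) * x by ring]
        field_simp
      rw [intervalIntegral.integral_eq_sub_of_hasDerivAt hd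
        (Continuous.intervalIntegrable (by fun_prop) _ _),
        show -(b * t) - (a - b) * t = -(a * t) by ring]
      simp only [mul_zero, sub_zero]
      ring
    -- Split at `x = t`: beyond it the first summand alone exceeds `t`, which contributes the term
    -- `exp (-(a * t))`.
    have hi : ∫⁻ x, expMeasure b (Set.Ioi (t - x)) ∂expMeasure a =
        ENNReal.ofReal (a / (a - b) * (Real.exp (-(b * t)) - Real.exp (-(a * t)))) +
          ENNReal.ofReal (Real.exp (-(a * t))) := by
      rw [← lintegral_add_compl _ (measurableSet_Iic (a := t)), Set.compl_Iic, ← hint,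
        ← lintegral_Iic_expMeasure ha ht (by fun_prop) (fun _ _ _ => (Real.exp_pos _).le)]
      congr 1
      · exact setLIntegral_congr_fun measurableSet_Iic fun x hx =>
          expMeasure_Ioi hb (sub_nonneg.2 hx)
      · rw [setLIntegral_congr_fun (g := fun _ => 1) measurableSet_Ioi fun x hx =>
          expMeasure_Ioi_of_neg hb (sub_nonpos.2 (le_of_lt hx))]
        simp [expMeasure_Ioi ha ht]
    have hle : Real.exp (-(a * t)) ≤ Real.exp (-(b * t)) :=
      Real.exp_le_exp.2 (by nlinarith)
    have h0 : 0 < a - b := by linarith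
    have e0 : 0 ≤ a / (a - b) * (Real.exp (-(b * t)) - Real.exp (-(a * t))) :=
      mul_nonneg (by positivity) (by linarith)
    rw [hi, expMeasure_Ioi ha ht, expMeasure_Ioi hb ht,
      ← ENNReal.ofReal_add e0 (Real.exp_pos _).le, ← ENNReal.ofReal_mul (by linarith),
      ← ENNReal.ofReal_mul hba0.le, ← ENNReal.ofReal_add
        (mul_nonneg (by linarith) (add_nonneg e0 (Real.exp_pos _).le)) (by positivity)]
    congr 1
    field_simp
    ring

instance isProbabilityMeasure_clockLaw {r : ℝ} [h : Fact (0 ≤ r)] :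
    IsProbabilityMeasure (clockLaw r) := by
  unfold clockLaw
  split_ifs with h0
  · infer_instance
  · have := isProbabilityMeasure_expMeasure (lt_of_le_of_ne h.out (Ne.symm h0))
    exact Measure.isProbabilityMeasure_map ENNReal.measurable_ofReal.aemeasurable

theorem clockLaw_Ioi {r : ℝ} (hr : 0 ≤ r) {x : ℝ} (hx : 0 ≤ x) :
    clockLaw r (Set.Ioi (ENNReal.ofReal x)) = ENNReal.ofReal (Real.exp (-(r * x))) := by
  unfold clockLaw
  split_ifs with h0
  · simp [h0]
  · rw [Measure.map_apply ENNReal.measurable_ofReal measurableSet_Ioi,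
      ← expMeasure_Ioi (lt_of_le_of_ne hr (Ne.symm h0)) hx]
    congr 1
    ext y
    simp [ENNReal.ofReal_lt_ofReal_iff_of_nonneg hx]

/-- Among independent exponential clocks of rates `r i`, the clock `e` rings first with probability
`r e / ∑ r i`, and then at an exponential time of rate `∑ r i`. -/
theorem map_firstClock {ι : Type*} [Fintype ι] [DecidableEq ι] (r : ι → ℝ) (hr : ∀ i, 0 ≤ r i)
    (e : ι) (he : 0 < r e) :
    ((Measure.pi fun i => clockLaw (r i)).restrict {x | ∀ i, i ≠ e → x e < x i}).map
      (fun x => (x e).toReal) = ENNReal.ofReal (r e / ∑ i, r i) • expMeasure (∑ i, r i) := by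
  have hF : ∀ i, Fact (0 ≤ r i) := fun i => ⟨hr i⟩
  have hR : 0 < ∑ i, r i := Finset.sum_pos' (fun i _ => hr i) ⟨e, Finset.mem_univ _, he⟩
  have hmeas : Measurable fun x : ι → ℝ≥0∞ => (x e).toReal :=
    (measurable_pi_apply e).ennreal_toReal
  ext A hA
  have hset : MeasurableSet {x : ι → ℝ≥0∞ | ∀ i, i ≠ e → x e < x i} := by
    simp only [Set.ofPred_forall]
    exact MeasurableSet.iInter fun i => MeasurableSet.iInter fun _ =>
      measurableSet_lt (measurable_pi_apply e) (measurable_pi_apply i)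
  rw [Measure.map_apply hmeas hA, Measure.restrict_apply (hmeas hA)]
  -- Separate the coordinate `e` from the others, in order to condition on the time at which this
  -- clock rings.
  have hmp := measurePreserving_piEquivPiSubtypeProd (fun i => clockLaw (r i)) (fun i => i = e)
  let E : Set (({i // i = e} → ℝ≥0∞) × ({i // ¬ i = e} → ℝ≥0∞)) :=
    {q | (q.1 ⟨e, rfl⟩).toReal ∈ A} ∩ {q | ∀ i, q.1 ⟨e, rfl⟩ < q.2 i}
  have hE : MeasurableSet E := by
    refine MeasurableSet.inter ?_ ?_
    · exact ((measurable_pi_apply _).comp measurable_fst).ennreal_toReal hA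
    · simp only [Set.ofPred_forall]
      exact MeasurableSet.iInter fun i => measurableSet_lt
        ((measurable_pi_apply _).comp measurable_fst) ((measurable_pi_apply i).comp measurable_snd)
  have hpre : (fun x : ι → ℝ≥0∞ => (x e).toReal) ⁻¹' A ∩ {x | ∀ i, i ≠ e → x e < x i} =
      MeasurableEquiv.piEquivPiSubtypeProd (fun _ : ι => ℝ≥0∞) (fun i => i = e) ⁻¹' E := by
    ext x
    simp [E, MeasurableEquiv.piEquivPiSubtypeProd, Equiv.piEquivPiSubtypeProd]
  rw [hpre, hmp.measure_preimage hE.nullMeasurableSet, Measure.prod_apply hE]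
  -- Once `e` rings at time `y`, the remaining clocks must lie in a box, whose mass is the product
  -- of their survival functions.
  have hsec : ∀ u : {i // i = e} → ℝ≥0∞,
      (Measure.pi fun i : {i // ¬ i = e} => clockLaw (r i)) (Prod.mk u ⁻¹' E) =
      (fun y => A.indicator 1 y.toReal * ∏ i : {i // ¬ i = e}, clockLaw (r i) (Set.Ioi y))
        (u ⟨e, rfl⟩) := by
    intro u
    by_cases hu : (u ⟨e, rfl⟩).toReal ∈ A
    · have : Prod.mk u ⁻¹' E = Set.univ.pi fun _ => Set.Ioi (u ⟨e, rfl⟩) := by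
        ext v
        simp [E, hu]
      rw [this, Measure.pi_pi]
      simp [hu]
    · have : Prod.mk u ⁻¹' E = ∅ := by
        ext v
        simp [E, hu]
      simp [this, hu]
  have hIoi : ∀ i, Measurable fun y => clockLaw (r i) (Set.Ioi y) := fun i =>
    (show Antitone fun y => clockLaw (r i) (Set.Ioi y) from
      fun y z hyz => measure_mono (Set.Ioi_subset_Ioi hyz)).measurable
  have hf : Measurable fun y : ℝ≥0∞ => (A.indicator 1 y.toReal : ℝ≥0∞) *
      ∏ i : {i // ¬ i = e}, clockLaw (r i) (Set.Ioi y) :=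
    ((measurable_one.indicator hA).comp ENNReal.measurable_toReal).mul
      (Finset.measurable_prod _ fun i _ => hIoi i)
  rw [lintegral_congr hsec]
  have hev := measurePreserving_eval (fun i : {i // i = e} => clockLaw (r i)) ⟨e, rfl⟩
  -- The two sides carry different `Fintype` instances on `{i // i = e}`.
  rw [Subsingleton.elim (Fintype.subtypeEq e) (Subtype.fintype fun i => i = e)] at hev
  refine (hev.lintegral_comp hf).trans ?_
  rw [show clockLaw (r e) = (expMeasure (r e)).map ENNReal.ofReal from if_neg he.ne', lintegral_map hf ENNReal.measurable_ofReal]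
  have hsum : r e + ∑ i : {i // ¬ i = e}, r i = ∑ i, r i := by
    rw [← Fintype.sum_subtype_add_sum_subtype (fun i => i = e) r]
    congr 1
    rw [← Subsingleton.elim (Fintype.subtypeEq e) (Subtype.fintype fun i => i = e)]
    exact (Fintype.sum_unique fun i : {i // i = e} => r i).symm
  have hg : Measurable fun x : ℝ => (A.indicator 1 (ENNReal.ofReal x).toReal : ℝ≥0∞) *
      ∏ i : {i // ¬ i = e}, clockLaw (r i) (Set.Ioi (ENNReal.ofReal x)) :=
    hf.comp ENNReal.measurable_ofReal
  rw [Measure.smul_apply, expMeasure_eq_withDensity, expMeasure_eq_withDensity]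
  refine (lintegral_withDensity_eq_lintegral_mul _ (measurable_exponentialPDF _) hg).trans ?_
  rw [withDensity_apply _ hA, ← lintegral_indicator hA, smul_eq_mul,
    ← lintegral_const_mul _ ((measurable_exponentialPDF _).indicator hA)]
  refine lintegral_congr fun x => ?_
  rcases lt_or_ge x 0 with hx | hx
  · simp [exponentialPDF_of_neg hx]
  · classical
    simp only [Pi.mul_apply, ENNReal.toReal_ofReal hx]
    rw [exponentialPDF_of_nonneg hx, Set.indicator_apply, Set.indicator_apply,
      exponentialPDF_of_nonneg hx]
    split_ifs with hxA
    · rw [Finset.prod_congr (s₁ := (Finset.univ : Finset {i // ¬ i = e})) rfl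
          fun i _ => clockLaw_Ioi (hr i) hx, ← ENNReal.ofReal_prod_of_nonneg fun i _ => (Real.exp_pos _).le, ← Real.exp_sum,
        Pi.one_apply, one_mul, ← ENNReal.ofReal_mul (by positivity),
        ← ENNReal.ofReal_mul (by positivity)]
      congr 1
      -- The density of clock `e` times the survival of all the others has the total rate in its
      -- exponent.
      have : -((∑ i, r i) * x) = -(r e * x) + ∑ i : {i // ¬ i = e}, -(r i * x) := by
        rw [← hsum, Finset.sum_neg_distrib, ← Finset.sum_mul]; ring
      rw [this, Real.exp_add]
      field_simp
    · simp

/-- A silent clock sits at `⊤` and cannot strictly precede another clock, here `j`. -/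
theorem map_firstClock_of_zero {ι : Type*} [Fintype ι] (r : ι → ℝ) (hr : ∀ i, 0 ≤ r i)
    (e j : ι) (hj : j ≠ e) (he : r e = 0) :
    ((Measure.pi fun i => clockLaw (r i)).restrict {x | ∀ i, i ≠ e → x e < x i}).map
      (fun x => (x e).toReal) = 0 := by
  classical
  have hF : ∀ i, Fact (0 ≤ r i) := fun i => ⟨hr i⟩
  have : (Measure.pi fun i => clockLaw (r i)) {x | ∀ i, i ≠ e → x e < x i} = 0 := by
    refine measure_mono_null (t := Function.eval e ⁻¹' {⊤}ᶜ) ?_ ?_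
    · intro x hx hxe
      have := hx j hj
      rw [show x e = ⊤ from hxe] at this
      exact not_top_lt this
    · rw [(measurePreserving_eval (fun i => clockLaw (r i)) e).measure_preimage
        (measurableSet_singleton _).compl.nullMeasurableSet]
      simp [clockLaw, he]
  rw [Measure.restrict_eq_zero.2 this, Measure.map_zero]

open PlanarTree

/-! ### Grafting two random trees -/

/-- The law of the tree with a root edge of law `ρ`, to which independent trees of law `μ` and `ν`
are attached. -/
noncomputable def nodeLaw (ρ : Measure ℝ) (μ ν : Measure (PlanarTree ℝ)) :
    Measure (PlanarTree ℝ) :=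
  (ρ.prod (μ.prod ν)).map fun x => node x.1 x.2.1 x.2.2

section nodeLaw

variable {ρ : Measure ℝ} {μ ν : Measure (PlanarTree ℝ)}

theorem nodeLaw_smul_root [SFinite μ] [SFinite ν] (r : ℝ≥0∞) : nodeLaw (r • ρ) μ ν = r • nodeLaw ρ μ ν := by
  rw [nodeLaw, Measure.prod_smul_left, Measure.map_smul, nodeLaw]

theorem lintegral_nodeLaw [SFinite μ] [SFinite ν] {f : PlanarTree ℝ → ℝ≥0∞} (hf : Measurable f) :
    ∫⁻ t, f t ∂nodeLaw ρ μ ν = ∫⁻ x, ∫⁻ a, ∫⁻ b, f (node x a b) ∂ν ∂μ ∂ρ := by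
  have h := hf.comp measurable_node
  rw [nodeLaw, lintegral_map hf measurable_node]
  refine (lintegral_prod _ h.aemeasurable).trans ?_
  refine lintegral_congr fun x => ?_
  exact lintegral_prod _ (h.comp measurable_prodMk_left).aemeasurable

theorem nodeLaw_univ [IsProbabilityMeasure ρ] [SFinite μ] [SFinite ν] :
    nodeLaw ρ μ ν Set.univ = μ Set.univ * ν Set.univ := by
  rw [← lintegral_one, lintegral_nodeLaw (f := fun _ => 1) measurable_const]
  simp [mul_comm]

instance isProbabilityMeasure_nodeLaw [IsProbabilityMeasure ρ] [IsProbabilityMeasure μ]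
    [IsProbabilityMeasure ν] : IsProbabilityMeasure (nodeLaw ρ μ ν) := by
  constructor
  simp [nodeLaw_univ]

theorem nodeLaw_sum_left {ι : Type*} [Countable ι] (μ : ι → Measure (PlanarTree ℝ))
    [∀ i, SFinite (μ i)] [SFinite ν] :
    nodeLaw ρ (Measure.sum μ) ν = Measure.sum fun i => nodeLaw ρ (μ i) ν := by
  rw [nodeLaw, Measure.prod_sum_left, Measure.prod_sum_right,
    Measure.map_sum measurable_node.aemeasurable]
  rfl

theorem nodeLaw_add_root {ρ' : Measure ℝ} [SFinite ρ] [SFinite ρ'] [SFinite μ] [SFinite ν] :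
    nodeLaw (ρ + ρ') μ ν = nodeLaw ρ μ ν + nodeLaw ρ' μ ν := by
  rw [nodeLaw, Measure.add_prod, Measure.map_add _ _ measurable_node]
  rfl

/-- An image of a grafted tree that is obtained by grafting the images. -/
theorem map_nodeLaw [SFinite ρ] [SFinite μ] [SFinite ν] {f : PlanarTree ℝ → PlanarTree ℝ}
    (hf : Measurable f) {g : ℝ → ℝ} (hg : Measurable g) {h k : PlanarTree ℝ → PlanarTree ℝ}
    (hh : Measurable h) (hk : Measurable k)
    (e : ∀ᵐ a ∂μ, ∀ᵐ b ∂ν, ∀ x, f (node x a b) = node (g x) (h a) (k b)) :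
    (nodeLaw ρ μ ν).map f = nodeLaw (ρ.map g) (μ.map h) (ν.map k) := by
  refine Measure.ext_of_lintegral _ fun φ hφ => ?_
  rw [lintegral_map hφ hf, lintegral_nodeLaw (f := fun t => φ (f t)) (hφ.comp hf),
    lintegral_nodeLaw hφ, lintegral_map _ hg]
  · refine lintegral_congr fun x => ?_
    rw [lintegral_map _ hh]
    · refine lintegral_congr_ae ?_
      filter_upwards [e] with a ha
      rw [lintegral_map _ hk]
      · refine lintegral_congr_ae ?_
        filter_upwards [ha] with b hb
        rw [hb]
      · exact hφ.comp (measurable_const.planarNode measurable_const measurable_id)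
    · exact (hφ.comp (measurable_const.planarNode measurable_fst measurable_snd)).lintegral_prod_right'
  · exact Measurable.lintegral_prod_right'
      (f := fun p : ℝ × PlanarTree ℝ => ∫⁻ b, φ (node p.1 p.2 b) ∂ν.map k)
      (hφ.comp (measurable_fst.fst.planarNode measurable_fst.snd
        measurable_snd)).lintegral_prod_right'

theorem ae_nodeLaw [SFinite ρ] [SFinite μ] [SFinite ν] {p : PlanarTree ℝ → Prop}
    (hp : MeasurableSet {t | p t}) (h : ∀ᵐ a ∂μ, ∀ᵐ b ∂ν, ∀ x, p (node x a b)) :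
    ∀ᵐ t ∂nodeLaw ρ μ ν, p t := by
  rw [nodeLaw, ae_map_iff measurable_node.aemeasurable hp]
  have hm : MeasurableSet {x : ℝ × PlanarTree ℝ × PlanarTree ℝ | p (node x.1 x.2.1 x.2.2)} :=
    measurable_node hp
  rw [Measure.ae_prod_iff_ae_ae hm]
  refine Eventually.of_forall fun x => ?_
  refine (Measure.ae_prod_iff_ae_ae (measurable_prodMk_left hm)).2 ?_
  filter_upwards [h] with a ha
  filter_upwards [ha] with b hb
  exact hb x

end nodeLaw

/-! ### The critical Tokunaga process -/

section tokunaga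

variable (c γ : ℝ) (hc : 1 ≤ c) (hγ : 0 < γ)

/-- The probability that the first event of a branch of order `K + 1` is its termination. -/
noncomputable def stopProb (K : ℕ) : ℝ := (c⁻¹) ^ K

/-- The probability that the first event of a branch, of order larger than `i + 1`, is the birth of
an offspring of order `i + 1`. -/
noncomputable def birthProb (i : ℕ) : ℝ := (c - 1) * (c⁻¹) ^ (i + 1)

variable {c γ}

include hc in
theorem stopProb_pos (K : ℕ) : 0 < stopProb c K := pow_pos (inv_pos.2 (by linarith)) _

include hc in
theorem birthProb_nonneg (i : ℕ) : 0 ≤ birthProb c i :=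
  mul_nonneg (by linarith) (pow_nonneg (inv_nonneg.2 (by linarith)) _)

-- Telescoping: `birthProb c i = stopProb c i - stopProb c (i + 1)`.
include hc in
theorem sum_birthProb (K : ℕ) : ∑ i ∈ Finset.range K, birthProb c i = 1 - stopProb c K := by
  have : c ≠ 0 := by linarith
  induction K with
  | zero => simp [stopProb]
  | succ K ih =>
    rw [Finset.sum_range_succ, ih]
    simp only [stopProb, birthProb, pow_succ]
    field_simp
    ring

theorem tokunaga_rate (K : ℕ) : (tokunaga c γ hc hγ).rate (K + 1) = γ * c * stopProb c K := by
  have : c ≠ 0 := by linarith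
  simp only [tokunaga, stopProb]
  rw [show (2 : ℤ) - ((K + 1 : ℕ) : ℤ) = 1 - (K : ℤ) by push_cast; ring, zpow_sub₀ this]
  simp
  field_simp

/-- The power `c ^ (K - i - 1)` in `T` cancels against `c⁻¹ ^ K` in the termination rate, so the
order of the parent drops out. -/
theorem tokunaga_eventRate_some (K : ℕ) (i : Fin K) :
    (tokunaga c γ hc hγ).eventRate K (some i) = γ * c * birthProb c i := by
  have h0 : c ≠ 0 := by linarith
  rw [Hierarchical.eventRate, tokunaga_rate]
  simp only [tokunaga, stopProb, birthProb]
  obtain ⟨k, hk⟩ : ∃ k, K = i + 1 + k := ⟨K - (i + 1), by omega⟩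
  rw [show K - (i : ℕ) - 1 = k by omega]
  have : (c⁻¹) ^ K = (c⁻¹) ^ ((i : ℕ) + 1) * (c⁻¹) ^ k := by rw [← pow_add, ← hk]
  rw [this, inv_pow _ k]
  field_simp

theorem tokunaga_eventRate_nonneg (K : ℕ) (e : Option (Fin K)) :
    0 ≤ (tokunaga c γ hc hγ).eventRate K e := by
  have h0 : 0 < γ * c := mul_pos hγ (by linarith)
  cases e with
  | none =>
    rw [Hierarchical.eventRate, tokunaga_rate]
    exact mul_nonneg h0.le (stopProb_pos hc K).le
  | some i =>
    rw [tokunaga_eventRate_some]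
    exact mul_nonneg h0.le (birthProb_nonneg hc i)

/-- The total event rate is the same for all orders. This is why all edges share one exponential
law. -/
theorem tokunaga_sum_eventRate (K : ℕ) :
    ∑ e, (tokunaga c γ hc hγ).eventRate K e = γ * c := by
  rw [Fintype.sum_option]
  simp only [tokunaga_eventRate_some]
  rw [Fin.sum_univ_eq_sum_range (fun i => γ * c * birthProb c i), ← Finset.mul_sum,
    sum_birthProb hc, Hierarchical.eventRate, tokunaga_rate]
  ring

theorem tokunaga_firstRing_none (K : ℕ) :
    (tokunaga c γ hc hγ).firstRing K none =
      ENNReal.ofReal (stopProb c K) • expMeasure (γ * c) := by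
  have h0 : 0 < γ * c := mul_pos hγ (by linarith)
  have hr : 0 < (tokunaga c γ hc hγ).eventRate K none := by
    rw [Hierarchical.eventRate, tokunaga_rate]
    exact mul_pos h0 (stopProb_pos hc K)
  rw [Hierarchical.firstRing, map_firstClock _ (tokunaga_eventRate_nonneg hc hγ K) none hr,
    tokunaga_sum_eventRate, Hierarchical.eventRate, tokunaga_rate, mul_div_cancel_left₀ _ h0.ne']

theorem tokunaga_firstRing_some (K : ℕ) (i : Fin K) :
    (tokunaga c γ hc hγ).firstRing K (some i) =
      ENNReal.ofReal (birthProb c i) • expMeasure (γ * c) := by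
  have h0 : 0 < γ * c := mul_pos hγ (by linarith)
  -- A birth rate vanishes when `c = 1`; such a clock never rings and both sides are zero.
  rcases (tokunaga_eventRate_nonneg hc hγ K (some i)).eq_or_lt with hr | hr
  · rw [Hierarchical.firstRing, map_firstClock_of_zero _ (tokunaga_eventRate_nonneg hc hγ K)
      (some i) none (by simp) hr.symm]
    rw [tokunaga_eventRate_some] at hr
    rw [(mul_eq_zero.1 hr.symm).resolve_left h0.ne', ENNReal.ofReal_zero, zero_smul]
  · rw [Hierarchical.firstRing, map_firstClock _ (tokunaga_eventRate_nonneg hc hγ K) _ hr,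
      tokunaga_sum_eventRate, tokunaga_eventRate_some, mul_div_cancel_left₀ _ h0.ne']

/-- The law of the tree generated by a branch of order `K + 1`. -/
noncomputable def tokLaw (K : ℕ) : Measure (PlanarTree ℝ) :=
  (tokunaga c γ hc hγ).branchLaw K

theorem tokunaga_terminate_zero (Q : Fin 0 → Measure (PlanarTree ℝ)) :
    (tokunaga c γ hc hγ).terminate 0 Q = (expMeasure (γ * c)).map leaf := by
  rw [Hierarchical.terminate, tokunaga_firstRing_none]
  simp [stopProb]

theorem tokunaga_terminate_succ (K : ℕ) (Q : Fin (K + 1) → Measure (PlanarTree ℝ))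
    [SFinite (Q (Fin.last K))] :
    (tokunaga c γ hc hγ).terminate (K + 1) Q = ENNReal.ofReal (stopProb c (K + 1)) •
      nodeLaw (expMeasure (γ * c)) (Q (Fin.last K)) (Q (Fin.last K)) := by
  rw [Hierarchical.terminate, tokunaga_firstRing_none, ← nodeLaw_smul_root]
  rfl

theorem tokunaga_sideBranch (K : ℕ) (Q : Fin K → Measure (PlanarTree ℝ))
    (ν : Measure (PlanarTree ℝ)) [∀ i, SFinite (Q i)] [SFinite ν] :
    (tokunaga c γ hc hγ).sideBranch K Q ν = ∑ i : Fin K, ENNReal.ofReal (birthProb c i) •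
      nodeLaw (expMeasure (γ * c)) ν (Q i) := by
  rw [Hierarchical.sideBranch]
  refine Finset.sum_congr rfl fun i _ => ?_
  rw [tokunaga_firstRing_some, ← nodeLaw_smul_root]
  rfl

/-- The law of the tree below a branch of order `K + 1` on the event that it has exactly `m`
offspring before its termination. -/
noncomputable def tokPart (K m : ℕ) : Measure (PlanarTree ℝ) :=
  ((tokunaga c γ hc hγ).sideBranch K fun i => tokLaw hc hγ i)^[m]
    ((tokunaga c γ hc hγ).terminate K fun i => tokLaw hc hγ i)

theorem tokLaw_eq_sum (K : ℕ) : tokLaw hc hγ K = Measure.sum (tokPart hc hγ K) := by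
  rw [tokLaw, Hierarchical.branchLaw]
  rfl

theorem tokPart_zero_zero : tokPart hc hγ 0 0 = (expMeasure (γ * c)).map leaf :=
  tokunaga_terminate_zero hc hγ fun i => tokLaw hc hγ i

theorem tokPart_succ_zero (K : ℕ) [h : SFinite (tokLaw hc hγ K)] : tokPart hc hγ (K + 1) 0 =
    ENNReal.ofReal (stopProb c (K + 1)) •
      nodeLaw (expMeasure (γ * c)) (tokLaw hc hγ K) (tokLaw hc hγ K) := by
  have : SFinite ((fun i : Fin (K + 1) => tokLaw hc hγ i) (Fin.last K)) := h
  exact tokunaga_terminate_succ hc hγ K fun i => tokLaw hc hγ i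

theorem tokPart_succ (K m : ℕ) [∀ i : Fin K, SFinite (tokLaw hc hγ i)]
    [h : SFinite (tokPart hc hγ K m)] : tokPart hc hγ K (m + 1) =
    ∑ i : Fin K, ENNReal.ofReal (birthProb c i) •
      nodeLaw (expMeasure (γ * c)) (tokPart hc hγ K m) (tokLaw hc hγ i) := by
  rw [tokPart, Function.iterate_succ_apply']
  exact tokunaga_sideBranch hc hγ K (fun i => tokLaw hc hγ i) (tokPart hc hγ K m)

include hc in
theorem sum_ofReal_birthProb (K : ℕ) : ∑ i : Fin K, ENNReal.ofReal (birthProb c i) =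
    ENNReal.ofReal (1 - stopProb c K) := by
  rw [Fin.sum_univ_eq_sum_range fun i => ENNReal.ofReal (birthProb c i),
    ← ENNReal.ofReal_sum_of_nonneg fun i _ => birthProb_nonneg hc i, ← sum_birthProb hc]

/-- The number of offspring is geometric: each further birth multiplies the mass by `1 - stopProb c
K`. Normalisation is assumed for lower orders only, so that the lemma can serve in the induction
which establishes it. -/
theorem tokPart_univ (K m : ℕ) (h : ∀ i ≤ K, i < K → IsProbabilityMeasure (tokLaw hc hγ i)) :
    tokPart hc hγ K m Set.univ =
      ENNReal.ofReal (1 - stopProb c K) ^ m * ENNReal.ofReal (stopProb c K) := by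
  have h0 : 0 < γ * c := mul_pos hγ (by linarith)
  have := isProbabilityMeasure_expMeasure h0
  induction m with
  | zero =>
    cases K with
    | zero => simp [tokPart_zero_zero, Measure.map_apply measurable_leaf, stopProb]
    | succ K =>
      have := h K (by omega) (by omega)
      rw [tokPart_succ_zero, Measure.smul_apply, nodeLaw_univ]
      simp
  | succ m ih =>
    have hfin : IsFiniteMeasure (tokPart hc hγ K m) := ⟨by
      rw [ih]
      exact ENNReal.mul_lt_top (ENNReal.pow_lt_top ENNReal.ofReal_lt_top) ENNReal.ofReal_lt_top⟩
    have hprob : ∀ i : Fin K, IsProbabilityMeasure (tokLaw hc hγ i) :=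
      fun i => h i (by omega) (by omega)
    have e : ∀ i : Fin K, (ENNReal.ofReal (birthProb c i) • nodeLaw (expMeasure (γ * c))
        (tokPart hc hγ K m) (tokLaw hc hγ i)) Set.univ =
        ENNReal.ofReal (birthProb c i) * tokPart hc hγ K m Set.univ := by
      intro i
      rw [Measure.smul_apply, nodeLaw_univ]
      simp
    rw [tokPart_succ, Measure.finsetSum_apply, Finset.sum_congr rfl fun i _ => e i,
      ← Finset.sum_mul, sum_ofReal_birthProb hc, ih, pow_succ', mul_assoc]

theorem stopProb_le_one (hc : 1 ≤ c) (K : ℕ) : stopProb c K ≤ 1 :=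
  pow_le_one₀ (inv_nonneg.2 (by linarith)) (inv_le_one_of_one_le₀ hc)

/-- As `stopProb c K > 0`, the geometric series has sum one: a branch almost surely has finitely
many offspring. -/
instance isProbabilityMeasure_tokLaw (K : ℕ) : IsProbabilityMeasure (tokLaw hc hγ K) := by
  induction K using Nat.strong_induction_on with
  | _ K ih =>
    constructor
    rw [tokLaw_eq_sum, Measure.sum_apply _ MeasurableSet.univ]
    simp only [tokPart_univ hc hγ K _ fun i _ hi => ih i hi]
    have h1 := stopProb_pos hc K
    have e : 1 - ENNReal.ofReal (1 - stopProb c K) = ENNReal.ofReal (stopProb c K) := by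
      rw [← ENNReal.ofReal_one, ← ENNReal.ofReal_sub _ (by linarith [stopProb_le_one hc K]),
        sub_sub_cancel]
    rw [ENNReal.tsum_mul_right, ENNReal.tsum_geometric, e]
    exact ENNReal.inv_mul_cancel (by simpa using h1) ENNReal.ofReal_ne_top

instance isFiniteMeasure_tokPart (K m : ℕ) : IsFiniteMeasure (tokPart hc hγ K m) := by
  constructor
  rw [tokPart_univ hc hγ K m fun i _ _ => inferInstance]
  exact ENNReal.mul_lt_top (ENNReal.pow_lt_top ENNReal.ofReal_lt_top) ENNReal.ofReal_lt_top

/-- The generating equation: decomposition of the tree of a branch at its first event. -/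
theorem tokLaw_eq (K : ℕ) : tokLaw hc hγ K = tokPart hc hγ K 0 +
    ∑ i : Fin K, ENNReal.ofReal (birthProb c i) •
      nodeLaw (expMeasure (γ * c)) (tokLaw hc hγ K) (tokLaw hc hγ i) := by
  ext A hA
  have e : ∀ i : Fin K, nodeLaw (expMeasure (γ * c)) (tokLaw hc hγ K) (tokLaw hc hγ i) =
      Measure.sum fun m => nodeLaw (expMeasure (γ * c)) (tokPart hc hγ K m) (tokLaw hc hγ i) := by
    intro i
    rw [tokLaw_eq_sum hc hγ K, nodeLaw_sum_left]
  have h1 : tokLaw hc hγ K A = ∑' m, tokPart hc hγ K m A := by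
    conv_lhs => rw [tokLaw_eq_sum hc hγ K]
    exact Measure.sum_apply _ hA
  have h2 : ∀ m, tokPart hc hγ K (m + 1) A = ∑ i : Fin K, ENNReal.ofReal (birthProb c i) *
      nodeLaw (expMeasure (γ * c)) (tokPart hc hγ K m) (tokLaw hc hγ i) A := by
    intro m
    rw [tokPart_succ, Measure.finsetSum_apply]
    simp only [Measure.smul_apply, smul_eq_mul]
  -- The term `m = 0` is immediate termination; in all others the first event is a birth, after
  -- which `m` offspring remain.
  have h3 : ∑' m, tokPart hc hγ K m A =
      tokPart hc hγ K 0 A + ∑' m, tokPart hc hγ K (m + 1) A :=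
    tsum_eq_zero_add' ENNReal.summable
  have h4 : ∑' m, tokPart hc hγ K (m + 1) A = ∑ i : Fin K, ENNReal.ofReal (birthProb c i) *
      nodeLaw (expMeasure (γ * c)) (tokLaw hc hγ K) (tokLaw hc hγ i) A := by
    rw [tsum_congr h2, Summable.tsum_finsetSum fun i _ => ENNReal.summable]
    refine Finset.sum_congr rfl fun i _ => ?_
    rw [ENNReal.tsum_mul_left, e i, Measure.sum_apply _ hA]
  have h5 : (∑ i : Fin K, ENNReal.ofReal (birthProb c i) •
      nodeLaw (expMeasure (γ * c)) (tokLaw hc hγ K) (tokLaw hc hγ i)) A =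
      ∑ i : Fin K, ENNReal.ofReal (birthProb c i) *
        nodeLaw (expMeasure (γ * c)) (tokLaw hc hγ K) (tokLaw hc hγ i) A := by
    rw [Measure.finsetSum_apply]
    simp only [Measure.smul_apply, smul_eq_mul]
  rw [Measure.add_apply, h1, h3, h4, h5]

/-- To prove that a property is shared by the laws of the trees of all branches, it suffices that
it is preserved by grafting and by superposition. -/
theorem tokLaw_induction {A : ℕ → Measure (PlanarTree ℝ) → Prop}
    (leaf : A 0 ((expMeasure (γ * c)).map leaf))
    (node : ∀ K, A K (tokLaw hc hγ K) →
      A (K + 1) (nodeLaw (expMeasure (γ * c)) (tokLaw hc hγ K) (tokLaw hc hγ K)))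
    (side : ∀ K i ν, i < K → IsFiniteMeasure ν → A K ν → A i (tokLaw hc hγ i) →
      A K (nodeLaw (expMeasure (γ * c)) ν (tokLaw hc hγ i)))
    (smul : ∀ K (r : ℝ≥0∞) μ, A K μ → A K (r • μ))
    (sum : ∀ K (ι : Type) [Countable ι] (μ : ι → Measure (PlanarTree ℝ)),
      (∀ i, A K (μ i)) → A K (Measure.sum μ)) (K : ℕ) : A K (tokLaw hc hγ K) := by
  induction K using Nat.strong_induction_on with
  | _ K ih =>
    rw [tokLaw_eq_sum]
    refine sum _ _ _ fun m => ?_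
    induction m with
    | zero =>
      cases K with
      | zero => rwa [tokPart_zero_zero]
      | succ K =>
        rw [tokPart_succ_zero]
        exact smul _ _ _ (node K (ih K (by omega)))
    -- The continuing branch has law `tokPart hc hγ K m` rather than a full branch law, which is why
    -- `side` allows every finite `ν`.
    | succ m ihm =>
      rw [tokPart_succ, ← Measure.sum_fintype]
      exact sum _ _ _ fun i => smul _ _ _
        (side K i _ i.isLt inferInstance ihm (ih i i.isLt))

/-- Termination joins two trees of equal order and raises it by one, while a side branch has smaller
order and leaves it unchanged. The order thus reveals which component of the mixture over root
orders a tree comes from. -/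
theorem tokLaw_order (K : ℕ) : ∀ᵐ t ∂tokLaw hc hγ K, t.order = K + 1 := by
  have h0 : 0 < γ * c := mul_pos hγ (by linarith)
  have := isProbabilityMeasure_expMeasure h0
  have hm : ∀ K : ℕ, MeasurableSet {t : PlanarTree ℝ | t.order = K + 1} :=
    fun K => measurable_order (measurableSet_singleton _)
  refine tokLaw_induction (A := fun K μ => ∀ᵐ t ∂μ, t.order = K + 1) hc hγ ?_ ?_ ?_ ?_ ?_ K
  · rw [ae_map_iff measurable_leaf.aemeasurable (hm 0)]
    exact Eventually.of_forall fun x => rfl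
  · intro K hK
    refine ae_nodeLaw (hm _) ?_
    filter_upwards [hK] with a ha
    filter_upwards [hK] with b hb
    intro x
    simp [order, ha, hb]
  · intro K i ν hi hν h1 h2
    refine ae_nodeLaw (hm _) ?_
    filter_upwards [h1] with a ha
    filter_upwards [h2] with b hb
    intro x
    simp only [order, ha, hb]
    split_ifs <;> omega
  · intro K r μ h
    exact Measure.ae_smul_measure h r
  · intro K ι _ μ h
    exact Measure.ae_sum_iff.2 h

end tokunaga

/-! ### Pruning -/

/-- An affine equation between finite measures, whose linear part decreases the total mass by a
factor, has at most one solution. -/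
theorem measure_fixedPoint_unique {X : Type*} [MeasurableSpace X] {L : Measure X → Measure X}
    {κ ν ν' : Measure X} {q : ℝ≥0∞} (hq : q < 1)
    (hadd : ∀ (μ₁ μ₂ : Measure X) [IsFiniteMeasure μ₁] [IsFiniteMeasure μ₂],
      L (μ₁ + μ₂) = L μ₁ + L μ₂)
    (hmass : ∀ (μ : Measure X) [IsFiniteMeasure μ], L μ Set.univ = q * μ Set.univ)
    [IsFiniteMeasure ν] [IsFiniteMeasure ν'] (h : ν = κ + L ν) (h' : ν' = κ + L ν') : ν = ν' := by
  -- Iterating the equation `n` times gives both solutions a common part `S`, with remainders of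
  -- mass at most `q ^ n` times the original; no subtraction of measures occurs.
  have key : ∀ n : ℕ, ∃ S E E' : Measure X, ν = S + E ∧ ν' = S + E' ∧
      E Set.univ ≤ q ^ n * ν Set.univ ∧ E' Set.univ ≤ q ^ n * ν' Set.univ := by
    intro n
    induction n with
    | zero => exact ⟨0, ν, ν', by simp, by simp, by simp, by simp⟩
    | succ n ih =>
      obtain ⟨S, E, E', h1, h2, h3, h4⟩ := ih
      have hS : IsFiniteMeasure S :=
        isFiniteMeasure_of_le ν (by rw [h1]; exact Measure.le_add_right le_rfl)
      have hE : IsFiniteMeasure E :=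
        isFiniteMeasure_of_le ν (by rw [h1]; exact Measure.le_add_left le_rfl)
      have hE' : IsFiniteMeasure E' :=
        isFiniteMeasure_of_le ν' (by rw [h2]; exact Measure.le_add_left le_rfl)
      refine ⟨κ + L S, L E, L E', ?_, ?_, ?_, ?_⟩
      · rw [add_assoc, ← hadd, ← h1, ← h]
      · rw [add_assoc, ← hadd, ← h2, ← h']
      · rw [hmass, pow_succ', mul_assoc]
        gcongr
      · rw [hmass, pow_succ', mul_assoc]
        gcongr
  have hlim : ∀ (C D : ℝ≥0∞), C ≠ ⊤ → Tendsto (fun n : ℕ => D + q ^ n * C) atTop (𝓝 D) := by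
    intro C D hC
    have h0 := ENNReal.Tendsto.mul_const (b := C)
      (ENNReal.tendsto_pow_atTop_nhds_zero_of_lt_one hq) (.inr hC)
    simpa using tendsto_const_nhds.add h0
  ext A hA
  refine le_antisymm ?_ ?_
  · refine ge_of_tendsto' (hlim (ν Set.univ) (ν' A) (measure_ne_top _ _)) fun n => ?_
    obtain ⟨S, E, E', h1, h2, h3, h4⟩ := key n
    calc ν A = S A + E A := by conv_lhs => rw [h1, Measure.add_apply]
      _ ≤ ν' A + q ^ n * ν Set.univ := by
        refine add_le_add ?_ ((measure_mono (Set.subset_univ _)).trans h3)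
        conv_rhs => rw [h2, Measure.add_apply]
        exact le_self_add
  · refine ge_of_tendsto' (hlim (ν' Set.univ) (ν A) (measure_ne_top _ _)) fun n => ?_
    obtain ⟨S, E, E', h1, h2, h3, h4⟩ := key n
    calc ν' A = S A + E' A := by conv_lhs => rw [h2, Measure.add_apply]
      _ ≤ ν A + q ^ n * ν' Set.univ := by
        refine add_le_add ?_ ((measure_mono (Set.subset_univ _)).trans h4)
        conv_rhs => rw [h1, Measure.add_apply]
        exact le_self_add

theorem nodeLaw_add_left {ρ : Measure ℝ} {μ μ' ν : Measure (PlanarTree ℝ)} [SFinite ρ] [SFinite μ]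
    [SFinite μ'] [SFinite ν] : nodeLaw ρ (μ + μ') ν = nodeLaw ρ μ ν + nodeLaw ρ μ' ν := by
  rw [nodeLaw, Measure.add_prod, Measure.prod_add, Measure.map_add _ _ measurable_node]
  rfl

/-- The law of a tree of law `ν` whose root edge is extended by an independent length. -/
noncomputable def extendRoot (ρ : Measure ℝ) (ν : Measure (PlanarTree ℝ)) :
    Measure (PlanarTree ℝ) :=
  (ρ.prod ν).map fun x => addRoot x.1 x.2

section extendRoot

variable {ρ : Measure ℝ}

theorem lintegral_extendRoot {ν : Measure (PlanarTree ℝ)} [SFinite ν] {f : PlanarTree ℝ → ℝ≥0∞}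
    (hf : Measurable f) : ∫⁻ t, f t ∂extendRoot ρ ν = ∫⁻ x, ∫⁻ t, f (addRoot x t) ∂ν ∂ρ := by
  rw [extendRoot, lintegral_map hf measurable_addRoot]
  exact lintegral_prod _ (hf.comp measurable_addRoot).aemeasurable

theorem extendRoot_add [SFinite ρ] {μ ν : Measure (PlanarTree ℝ)} [SFinite μ] [SFinite ν] :
    extendRoot ρ (μ + ν) = extendRoot ρ μ + extendRoot ρ ν := by
  rw [extendRoot, Measure.prod_add, Measure.map_add _ _ measurable_addRoot]
  rfl

theorem extendRoot_univ [IsProbabilityMeasure ρ] {ν : Measure (PlanarTree ℝ)} [SFinite ν] :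
    extendRoot ρ ν Set.univ = ν Set.univ := by
  rw [← lintegral_one, lintegral_extendRoot (f := fun _ => 1) measurable_const]
  simp

theorem extendRoot_smul [SFinite ρ] {ν : Measure (PlanarTree ℝ)} [SFinite ν] (r : ℝ≥0∞) :
    extendRoot ρ (r • ν) = r • extendRoot ρ ν := by
  rw [extendRoot, Measure.prod_smul_right, Measure.map_smul]
  rfl

theorem extendRoot_sum [SFinite ρ] {ι : Type*} [Fintype ι] (ν : ι → Measure (PlanarTree ℝ))
    [∀ i, SFinite (ν i)] : extendRoot ρ (∑ i, ν i) = ∑ i, extendRoot ρ (ν i) := by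
  rw [extendRoot, ← Measure.sum_fintype, Measure.prod_sum_right,
    Measure.map_sum measurable_addRoot.aemeasurable, Measure.sum_fintype]
  rfl

theorem extendRoot_leaf [SFinite ρ] {ρ' : Measure ℝ} [SFinite ρ'] :
    extendRoot ρ (ρ'.map leaf) = ((ρ.prod ρ').map fun x => x.1 + x.2).map leaf := by
  refine Measure.ext_of_lintegral _ fun f hf => ?_
  have hm : Measurable fun x : ℝ × ℝ => x.1 + x.2 := by fun_prop
  have h1 : Measurable fun x => f (leaf x) := hf.comp measurable_leaf
  rw [lintegral_extendRoot hf, lintegral_map hf measurable_leaf, lintegral_map h1 hm]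
  refine Eq.trans ?_ (lintegral_prod _ (h1.comp hm).aemeasurable).symm
  refine lintegral_congr fun x => ?_
  exact lintegral_map (hf.comp (measurable_addRoot.comp measurable_prodMk_left)) measurable_leaf

theorem extendRoot_nodeLaw [SFinite ρ] {ρ' : Measure ℝ} [SFinite ρ'] {μ ν : Measure (PlanarTree ℝ)}
    [SFinite μ] [SFinite ν] :
    extendRoot ρ (nodeLaw ρ' μ ν) = nodeLaw ((ρ.prod ρ').map fun x => x.1 + x.2) μ ν := by
  have : SFinite (nodeLaw ρ' μ ν) := by unfold nodeLaw; infer_instance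
  have hm : Measurable fun x : ℝ × ℝ => x.1 + x.2 := by fun_prop
  refine Measure.ext_of_lintegral _ fun f hf => ?_
  have hg : Measurable fun y : ℝ => ∫⁻ a, ∫⁻ b, f (node y a b) ∂ν ∂μ :=
    Measurable.lintegral_prod_right'
      (f := fun p : ℝ × PlanarTree ℝ => ∫⁻ b, f (node p.1 p.2 b) ∂ν)
      (hf.comp (measurable_fst.fst.planarNode measurable_fst.snd
        measurable_snd)).lintegral_prod_right'
  rw [lintegral_extendRoot hf, lintegral_nodeLaw hf, lintegral_map hg hm]
  refine Eq.trans ?_ (lintegral_prod _ (hg.comp hm).aemeasurable).symm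
  refine lintegral_congr fun x => ?_
  exact lintegral_nodeLaw (hf.comp (measurable_addRoot.comp measurable_prodMk_left))

end extendRoot

/-! ### Pruning the tree of a single branch -/

section tokunaga

variable {c γ : ℝ} (hc : 1 ≤ c) (hγ : 0 < γ)

/-- The law of the tree generated by a branch of order `K + 1`, with all lengths multiplied
by `c`. -/
noncomputable def scaledLaw (K : ℕ) : Measure (PlanarTree ℝ) :=
  (tokLaw hc hγ K).map (PlanarTree.map fun x => c * x)

theorem measurable_scaleMap : Measurable (PlanarTree.map (fun x : ℝ => c * x)) :=
  measurable_map (measurable_const_mul c)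

instance isProbabilityMeasure_scaledLaw (K : ℕ) : IsProbabilityMeasure (scaledLaw hc hγ K) :=
  Measure.isProbabilityMeasure_map measurable_scaleMap.aemeasurable

/-- The event of termination, with trees scaled by `c` below the root edge. -/
noncomputable def scaledStop : ℕ → Measure ℝ → Measure (PlanarTree ℝ)
  | 0, r => r.map leaf
  | m + 1, r => ENNReal.ofReal (stopProb c (m + 1)) •
      nodeLaw r (scaledLaw hc hγ m) (scaledLaw hc hγ m)

/-- The first event, when the length of the root edge has law `r`, with trees scaled by `c` below
the root edge; after the birth of an offspring the branch continues with law `ν`. -/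
noncomputable def scaledStep (K : ℕ) (ν : Measure (PlanarTree ℝ)) (r : Measure ℝ) :
    Measure (PlanarTree ℝ) :=
  scaledStop hc hγ K r + ∑ i : Fin K, ENNReal.ofReal (birthProb c i) •
    nodeLaw r ν (scaledLaw hc hγ i)

theorem scaledStop_add (K : ℕ) (r r' : Measure ℝ) [SFinite r] [SFinite r'] :
    scaledStop hc hγ K (r + r') = scaledStop hc hγ K r + scaledStop hc hγ K r' := by
  cases K with
  | zero => exact Measure.map_add _ _ measurable_leaf
  | succ K => simp only [scaledStop, nodeLaw_add_root, smul_add]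

theorem scaledStop_smul (K : ℕ) (r : Measure ℝ) (q : ℝ≥0∞) :
    scaledStop hc hγ K (q • r) = q • scaledStop hc hγ K r := by
  cases K with
  | zero => exact Measure.map_smul _ _ _
  | succ K => simp only [scaledStop, nodeLaw_smul_root, smul_comm q]

theorem scaledStep_add (K : ℕ) (ν : Measure (PlanarTree ℝ)) [SFinite ν] (r r' : Measure ℝ)
    [SFinite r] [SFinite r'] :
    scaledStep hc hγ K ν (r + r') = scaledStep hc hγ K ν r + scaledStep hc hγ K ν r' := by
  simp only [scaledStep, scaledStop_add, nodeLaw_add_root, smul_add, Finset.sum_add_distrib]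
  abel

theorem scaledStep_smul (K : ℕ) (ν : Measure (PlanarTree ℝ)) [SFinite ν] (r : Measure ℝ)
    (q : ℝ≥0∞) : scaledStep hc hγ K ν (q • r) = q • scaledStep hc hγ K ν r := by
  simp only [scaledStep, scaledStop_smul, nodeLaw_smul_root, smul_add, Finset.smul_sum,
    smul_comm q]

instance sFinite_nodeLaw (ρ : Measure ℝ) (μ ν : Measure (PlanarTree ℝ)) [SFinite ρ] [SFinite μ]
    [SFinite ν] : SFinite (nodeLaw ρ μ ν) := by
  unfold nodeLaw; infer_instance

instance sFinite_scaledStop (K : ℕ) (r : Measure ℝ) [SFinite r] :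
    SFinite (scaledStop hc hγ K r) := by
  cases K <;> (unfold scaledStop; infer_instance)

/-- In each case of the first event the extension affects only the root edge, whose law gets
convolved with `ρ`. -/
theorem extendRoot_scaledStep (K : ℕ) (ν : Measure (PlanarTree ℝ)) [SFinite ν] (ρ r : Measure ℝ)
    [SFinite ρ] [SFinite r] :
    extendRoot ρ (scaledStep hc hγ K ν r) =
      scaledStep hc hγ K ν ((ρ.prod r).map fun x => x.1 + x.2) := by
  have h : extendRoot ρ (scaledStop hc hγ K r) =
      scaledStop hc hγ K ((ρ.prod r).map fun x => x.1 + x.2) := by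
    cases K with
    | zero => exact extendRoot_leaf
    | succ K => simp only [scaledStop, extendRoot_smul, extendRoot_nodeLaw]
  have : SFinite (∑ i : Fin K, ENNReal.ofReal (birthProb c i) •
      nodeLaw r ν (scaledLaw hc hγ i)) := by
    rw [← Measure.sum_fintype]; infer_instance
  rw [scaledStep, extendRoot_add, h, extendRoot_sum]
  simp only [extendRoot_smul, extendRoot_nodeLaw]
  rfl

/-- The first-event equation commutes with scaling, which turns the root edge of rate `γ * c` into
one of rate `γ`. -/
theorem scaledLaw_eq (K : ℕ) :
    scaledLaw hc hγ K = scaledStep hc hγ K (scaledLaw hc hγ K) (expMeasure γ) := by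
  have hc0 : 0 < c := by linarith
  have := isProbabilityMeasure_expMeasure (mul_pos hγ hc0)
  have hρ : (expMeasure (γ * c)).map (fun x => c * x) = expMeasure γ := by
    rw [map_mul_expMeasure (mul_pos hγ hc0) hc0, mul_div_cancel_right₀ _ hc0.ne']
  have hn : ∀ i j, (nodeLaw (expMeasure (γ * c)) (tokLaw hc hγ i) (tokLaw hc hγ j)).map
      (PlanarTree.map fun x => c * x) = nodeLaw (expMeasure γ) (scaledLaw hc hγ i) (scaledLaw hc hγ j) := by
    intro i j
    rw [map_nodeLaw (g := fun x => c * x) measurable_scaleMap (measurable_const_mul c)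
      measurable_scaleMap measurable_scaleMap
      (Eventually.of_forall fun a => Eventually.of_forall fun b x => rfl), hρ]
    rfl
  have h_term : (tokPart hc hγ K 0).map (PlanarTree.map fun x => c * x) =
      scaledStop hc hγ K (expMeasure γ) := by
    cases K with
    | zero =>
      rw [tokPart_zero_zero, Measure.map_map measurable_scaleMap measurable_leaf, scaledStop, ← hρ,
        Measure.map_map measurable_leaf (measurable_const_mul c)]
      rfl
    | succ K => rw [tokPart_succ_zero, Measure.map_smul, hn, scaledStop]
  conv_lhs => rw [scaledLaw, tokLaw_eq, Measure.map_add _ _ measurable_scaleMap,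
    Measure.map_finset_sum' measurable_scaleMap.aemeasurable, h_term]
  simp only [Measure.map_smul, hn]
  rfl

/-- The equation for the law of the pruned tree. -/
noncomputable def prunedStep (K : ℕ) (ν : Measure (PlanarTree ℝ)) : Measure (PlanarTree ℝ) :=
  ENNReal.ofReal (birthProb c 0) • extendRoot (expMeasure (γ * c)) ν +
    ENNReal.ofReal c⁻¹ • scaledStep hc hγ K ν (expMeasure (γ * c))

/-- The renewal identity splits the root edge of rate `γ`: with probability `1/c` it is an edge of
rate `γ * c`, otherwise such an edge followed by an independent edge of rate `γ`. In the latter case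
the part below the first piece is again the scaled tree. -/
theorem scaledLaw_eq_prunedStep (K : ℕ) :
    scaledLaw hc hγ K = prunedStep hc hγ K (scaledLaw hc hγ K) := by
  have hc0 : 0 < c := by linarith
  have := isProbabilityMeasure_expMeasure (mul_pos hγ hc0)
  have := isProbabilityMeasure_expMeasure hγ
  have h := expMeasure_renewal (a := γ * c) hγ (by nlinarith)
  have e1 : γ / (γ * c) = c⁻¹ := by field_simp
  have e2 : birthProb c 0 = 1 - c⁻¹ := by simp only [birthProb, zero_add, pow_one]; field_simp
  rw [e1] at h
  have e3 : extendRoot (expMeasure (γ * c)) (scaledLaw hc hγ K) =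
      scaledStep hc hγ K (scaledLaw hc hγ K)
        (((expMeasure (γ * c)).prod (expMeasure γ)).map fun x => x.1 + x.2) := by
    conv_lhs => rw [scaledLaw_eq]
    exact extendRoot_scaledStep hc hγ K _ _ _
  rw [prunedStep, e3, ← scaledStep_smul, ← scaledStep_smul, ← scaledStep_add, e2, h]
  exact scaledLaw_eq hc hγ K

/-- The termination term does not involve `ν`; the remaining linear part multiplies mass by `(1 -
c⁻¹) + c⁻¹ (1 - c⁻¹ ^ K) = 1 - c⁻¹ ^ (K + 1) < 1`. -/
theorem prunedStep_unique (K : ℕ) {ν : Measure (PlanarTree ℝ)} [IsFiniteMeasure ν]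
    (h : ν = prunedStep hc hγ K ν) : ν = scaledLaw hc hγ K := by
  have hc0 : 0 < c := by linarith
  have := isProbabilityMeasure_expMeasure (mul_pos hγ hc0)
  have hq : ENNReal.ofReal (1 - stopProb c (K + 1)) < 1 := by
    rw [ENNReal.ofReal_lt_one]
    linarith [stopProb_pos hc (K + 1)]
  let L : Measure (PlanarTree ℝ) → Measure (PlanarTree ℝ) := fun ν =>
    ENNReal.ofReal (birthProb c 0) • extendRoot (expMeasure (γ * c)) ν +
    ENNReal.ofReal c⁻¹ • ∑ i : Fin K, ENNReal.ofReal (birthProb c i) •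
      nodeLaw (expMeasure (γ * c)) ν (scaledLaw hc hγ i)
  have hL : ∀ ν, prunedStep hc hγ K ν =
      ENNReal.ofReal c⁻¹ • scaledStop hc hγ K (expMeasure (γ * c)) + L ν := by
    intro ν
    simp only [prunedStep, scaledStep, L, smul_add]
    abel
  refine measure_fixedPoint_unique (L := L) hq ?_ ?_ (h.trans (hL ν))
    ((scaledLaw_eq_prunedStep hc hγ K).trans (hL _))
  · intro μ₁ μ₂ _ _
    simp only [L, extendRoot_add, nodeLaw_add_left, smul_add, Finset.sum_add_distrib]
    abel
  · intro μ _
    simp only [L, Measure.add_apply, Measure.smul_apply, Measure.finsetSum_apply, nodeLaw_univ,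
      extendRoot_univ, smul_eq_mul, measure_univ, mul_one]
    rw [← Finset.sum_mul, sum_ofReal_birthProb hc, ← mul_assoc, ← add_mul,
      ← ENNReal.ofReal_mul (by positivity), ← ENNReal.ofReal_add (birthProb_nonneg hc 0)
        (mul_nonneg (by positivity) (by linarith [stopProb_le_one hc K]))]
    congr 2
    have hcc : c * c⁻¹ = 1 := mul_inv_cancel₀ hc0.ne'
    simp only [birthProb, stopProb]
    rw [pow_succ]
    linear_combination hcc

/-- Prune the first-event equation. A birth of order one leaves only an extension of the root edge;
every other event survives with all orders lowered by one, and its probability is `c⁻¹` times that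
of the lowered event. With the subtrees of lower order known by induction, this is the fixed-point
equation `prunedStep`. -/
theorem map_pruned_tokLaw (K : ℕ) : (tokLaw hc hγ (K + 1)).map pruned = scaledLaw hc hγ K := by
  have hc0 : 0 < c := by linarith
  have := isProbabilityMeasure_expMeasure (mul_pos hγ hc0)
  induction K using Nat.strong_induction_on with
  | _ K ih =>
    have := Measure.isProbabilityMeasure_map (μ := tokLaw hc hγ (K + 1))
      measurable_pruned.aemeasurable
    refine prunedStep_unique hc hγ K ?_
    have hn : ∀ i j : ℕ, (nodeLaw (expMeasure (γ * c)) (tokLaw hc hγ (i + 1))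
        (tokLaw hc hγ (j + 1))).map pruned = nodeLaw (expMeasure (γ * c))
          ((tokLaw hc hγ (i + 1)).map pruned) ((tokLaw hc hγ (j + 1)).map pruned) := by
      intro i j
      rw [map_nodeLaw (g := id) measurable_pruned measurable_id measurable_pruned measurable_pruned,
        Measure.map_id]
      filter_upwards [tokLaw_order hc hγ (i + 1)] with a ha
      filter_upwards [tokLaw_order hc hγ (j + 1)] with b hb
      intro x
      rw [pruned_node, if_neg (by omega), if_neg (by omega)]
      rfl
    have h0 : (nodeLaw (expMeasure (γ * c)) (tokLaw hc hγ (K + 1)) (tokLaw hc hγ 0)).map pruned =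
        extendRoot (expMeasure (γ * c)) ((tokLaw hc hγ (K + 1)).map pruned) := by
      refine Measure.ext_of_lintegral _ fun f hf => ?_
      rw [lintegral_map hf measurable_pruned,
        lintegral_nodeLaw (f := fun t => f t.pruned) (hf.comp measurable_pruned),
        lintegral_extendRoot hf]
      refine lintegral_congr fun x => ?_
      rw [lintegral_map (f := fun t => f (addRoot x t))
        (hf.comp (measurable_addRoot.comp measurable_prodMk_left)) measurable_pruned]
      refine lintegral_congr_ae ?_
      filter_upwards [tokLaw_order hc hγ (K + 1)] with a ha
      have : ∀ᵐ b ∂tokLaw hc hγ 0, f (node x a b).pruned = f (addRoot x a.pruned) := by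
        filter_upwards [tokLaw_order hc hγ 0] with b hb
        rw [pruned_node, if_neg (by omega), if_pos (by omega)]
      rw [lintegral_congr_ae this]
      simp
    have hcon : ∀ r : ℝ, ENNReal.ofReal c⁻¹ * ENNReal.ofReal r = ENNReal.ofReal (c⁻¹ * r) :=
      fun r => (ENNReal.ofReal_mul (by positivity)).symm
    have h_term : (tokPart hc hγ (K + 1) 0).map pruned =
        ENNReal.ofReal c⁻¹ • scaledStop hc hγ K (expMeasure (γ * c)) := by
      rw [tokPart_succ_zero, Measure.map_smul]
      -- For `K = 0` both children are leaves and disappear, so the root edge becomes a leaf; the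
      -- factor `stopProb c 1` is `c⁻¹`.
      cases K with
      | zero =>
        have : (nodeLaw (expMeasure (γ * c)) (tokLaw hc hγ 0) (tokLaw hc hγ 0)).map pruned =
            (expMeasure (γ * c)).map leaf := by
          refine Measure.ext_of_lintegral _ fun f hf => ?_
          rw [lintegral_map hf measurable_pruned,
            lintegral_nodeLaw (f := fun t => f t.pruned) (hf.comp measurable_pruned),
            lintegral_map hf measurable_leaf]
          refine lintegral_congr fun x => ?_
          have : ∀ᵐ a ∂tokLaw hc hγ 0,
              ∫⁻ b, f (node x a b).pruned ∂tokLaw hc hγ 0 = f (leaf x) := by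
            filter_upwards [tokLaw_order hc hγ 0] with a ha
            have : ∀ᵐ b ∂tokLaw hc hγ 0, f (node x a b).pruned = f (leaf x) := by
              filter_upwards [tokLaw_order hc hγ 0] with b hb
              rw [pruned_node, if_pos (by omega), if_pos (by omega)]
            rw [lintegral_congr_ae this]
            simp
          rw [lintegral_congr_ae this]
          simp
        rw [this, scaledStop]
        simp [stopProb]
      | succ K =>
        rw [hn, ih K (by omega), scaledStop, smul_smul, hcon]
        congr 2
        simp only [stopProb]
        rw [pow_succ']
    conv_lhs => rw [tokLaw_eq, Measure.map_add _ _ measurable_pruned,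
      Measure.map_finset_sum' measurable_pruned.aemeasurable, h_term]
    simp only [Measure.map_smul, Fin.sum_univ_succ, Fin.val_zero, Fin.val_succ, h0]
    -- The shift of orders uses `birthProb c (i + 1) = c⁻¹ * birthProb c i`.
    have hs : ∀ i : Fin K, ENNReal.ofReal (birthProb c (i + 1)) •
        (nodeLaw (expMeasure (γ * c)) (tokLaw hc hγ (K + 1)) (tokLaw hc hγ (i + 1))).map pruned =
        ENNReal.ofReal c⁻¹ • ENNReal.ofReal (birthProb c i) • nodeLaw (expMeasure (γ * c))
          ((tokLaw hc hγ (K + 1)).map pruned) (scaledLaw hc hγ i) := by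
      intro i
      rw [hn, ih i i.isLt, smul_smul, hcon]
      congr 2
      simp only [birthProb]
      rw [pow_succ _ ((i : ℕ) + 1)]
      ring
    rw [Finset.sum_congr rfl fun i _ => hs i, ← Finset.smul_sum, prunedStep, scaledStep, smul_add]
    abel

end tokunaga

/-! ### The law of the random tree -/

section tokunaga

variable {c γ : ℝ} (hc : 1 ≤ c) (hγ : 0 < γ)

/-- The probability that the root branch has order `K + 1`. -/
noncomputable def rootProb (K : ℕ) : ℝ≥0∞ := ENNReal.ofReal ((2 : ℝ)⁻¹ ^ (K + 1))

theorem rootProb_eq (K : ℕ) : rootProb K = 2⁻¹ ^ (K + 1) := by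
  rw [rootProb, ENNReal.ofReal_pow (by norm_num), ENNReal.ofReal_inv_of_pos (by norm_num)]
  simp

theorem rootProb_succ (K : ℕ) : rootProb (K + 1) = 2⁻¹ * rootProb K := by
  rw [rootProb_eq, rootProb_eq, pow_succ']

theorem rootProb_ne_zero (K : ℕ) : rootProb K ≠ 0 := by
  rw [rootProb_eq]
  exact pow_ne_zero _ (by simp)

theorem rootProb_ne_top (K : ℕ) : rootProb K ≠ ⊤ := ENNReal.ofReal_ne_top

theorem tsum_rootProb : ∑' K, rootProb K = 1 := by
  simp only [rootProb_eq, pow_succ']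
  rw [ENNReal.tsum_mul_left, ENNReal.tsum_geometric, ENNReal.one_sub_inv_two, inv_inv]
  exact ENNReal.inv_mul_cancel (by simp) (by simp)

/-- The law of the random tree, as a tree with planar embedding. -/
noncomputable def planarLaw : Measure (PlanarTree ℝ) :=
  Measure.sum fun K => rootProb K • tokLaw hc hγ K

theorem treeLaw_eq : (tokunaga c γ hc hγ).treeLaw = (planarLaw hc hγ).map Tree.mk := rfl

theorem planarLaw_apply {A : Set (PlanarTree ℝ)} (hA : MeasurableSet A) :
    planarLaw hc hγ A = ∑' K, rootProb K * tokLaw hc hγ K A := by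
  rw [planarLaw, Measure.sum_apply _ hA]
  rfl

instance isProbabilityMeasure_planarLaw : IsProbabilityMeasure (planarLaw hc hγ) := by
  constructor
  rw [planarLaw_apply hc hγ MeasurableSet.univ]
  simp [tsum_rootProb]

instance isProbabilityMeasure_treeLaw : IsProbabilityMeasure (tokunaga c γ hc hγ).treeLaw := by
  rw [treeLaw_eq]
  exact Measure.isProbabilityMeasure_map measurable_mk.aemeasurable

theorem measurableSet_order_eq (K : ℕ) : MeasurableSet {t : PlanarTree ℝ | t.order = K} :=
  measurable_order (measurableSet_singleton K)

theorem tokLaw_inter_order (K : ℕ) (A : Set (PlanarTree ℝ)) :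
    tokLaw hc hγ K (A ∩ {t | t.order = K + 1}) = tokLaw hc hγ K A := by
  refine measure_congr ?_
  filter_upwards [tokLaw_order hc hγ K] with t ht
  exact propext ⟨fun h => h.1, fun h => ⟨h, ht⟩⟩

theorem tokLaw_inter_order_of_ne {j K : ℕ} (h : j ≠ K) (A : Set (PlanarTree ℝ)) :
    tokLaw hc hγ j (A ∩ {t | t.order = K + 1}) = 0 := by
  refine measure_mono_null ?_ (ae_iff.1 (tokLaw_order hc hγ j))
  intro t ht ht'
  have : t.order = K + 1 := ht.2
  omega

/-- The components of the mixture are concentrated on disjoint sets of orders, so restricting to an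
order isolates one of them. -/
theorem planarLaw_restrict_order (K : ℕ) :
    (planarLaw hc hγ).restrict {t | t.order = K + 1} = rootProb K • tokLaw hc hγ K := by
  ext A hA
  rw [Measure.restrict_apply hA, planarLaw_apply hc hγ (hA.inter (measurableSet_order_eq _)),
    tsum_eq_single K fun j hj => by rw [tokLaw_inter_order_of_ne hc hγ hj, mul_zero],
    tokLaw_inter_order]
  rfl

theorem planarLaw_order (K : ℕ) : planarLaw hc hγ {t | t.order = K + 1} = rootProb K := by
  rw [← Measure.restrict_apply_univ, planarLaw_restrict_order]
  simp

theorem orderLaw_treeLaw (K : ℕ) :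
    orderLaw (tokunaga c γ hc hγ).treeLaw (K + 1) = (tokLaw hc hγ K).map Tree.mk := by
  have hm := Tree.measurableSet_order (K + 1)
  rw [orderLaw, ProbabilityTheory.cond, treeLaw_eq, Measure.restrict_map measurable_mk hm,
    Measure.map_apply measurable_mk hm]
  change (planarLaw hc hγ {t | t.order = K + 1})⁻¹ •
    ((planarLaw hc hγ).restrict {t | t.order = K + 1}).map Tree.mk = _
  rw [planarLaw_restrict_order, planarLaw_order, Measure.map_smul, smul_smul,
    ENNReal.inv_mul_cancel (rootProb_ne_zero K) (rootProb_ne_top K), one_smul]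

/-- Pruning lowers the root order by one, and `rootProb (K + 1)` is half of `rootProb K`. The factor
`1/2` is the probability that the pruned tree is not empty. -/
theorem map_pruned_planarLaw :
    ((planarLaw hc hγ).restrict {t | t.order ≠ 1}).map pruned =
      (2⁻¹ : ℝ≥0∞) • (planarLaw hc hγ).map (PlanarTree.map fun x => c * x) := by
  have hne : MeasurableSet {t : PlanarTree ℝ | t.order ≠ 1} := (measurableSet_order_eq 1).compl
  ext A hA
  have hA' := measurable_pruned hA
  rw [Measure.map_apply measurable_pruned hA, Measure.restrict_apply hA', Measure.smul_apply,
    Measure.map_apply measurable_scaleMap hA, planarLaw_apply hc hγ (hA'.inter hne),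
    planarLaw_apply hc hγ (measurable_scaleMap hA), tsum_eq_zero_add' ENNReal.summable,
    smul_eq_mul, ← ENNReal.tsum_mul_left]
  have h0 : tokLaw hc hγ 0 (pruned ⁻¹' A ∩ {t | t.order ≠ 1}) = 0 :=
    measure_mono_null (fun t ht => ht.2) (ae_iff.1 (tokLaw_order hc hγ 0))
  rw [h0, mul_zero, zero_add]
  refine tsum_congr fun K => ?_
  have h1 : tokLaw hc hγ (K + 1) (pruned ⁻¹' A ∩ {t | t.order ≠ 1}) =
      tokLaw hc hγ (K + 1) (pruned ⁻¹' A) := by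
    refine measure_congr ?_
    filter_upwards [tokLaw_order hc hγ (K + 1)] with t ht
    have ht' : t.order ≠ 1 := by omega
    exact propext ⟨fun h => h.1, fun h => ⟨h, ht'⟩⟩
  rw [h1, ← Measure.map_apply measurable_pruned hA, map_pruned_tokLaw, scaledLaw,
    Measure.map_apply measurable_scaleMap hA, rootProb_succ, mul_assoc]

/-- The pruned tree has the law of the tree with all lengths multiplied by `c`. -/
theorem prunedLaw_treeLaw : prunedLaw (tokunaga c γ hc hγ).treeLaw =
    (tokunaga c γ hc hγ).treeLaw.map (Tree.scale c) := by
  have hpre : Tree.mk ⁻¹' {T : Tree ℝ | T.prune ≠ none} = {t | t.order ≠ 1} := by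
    ext t
    have : (Tree.mk t).prune = t.prune.map Tree.mk := rfl
    simp only [Set.mem_preimage, Set.mem_ofPred_eq, this, ne_eq, Option.map_eq_none_iff,
      prune_eq_none_iff]
  have hne : MeasurableSet {T : Tree ℝ | T.prune ≠ none} := by
    have : MeasurableSet (Tree.mk ⁻¹' {T : Tree ℝ | T.prune ≠ none}) := by
      rw [hpre]; exact (measurableSet_order_eq 1).compl
    exact this
  have hgm : ∀ t : PlanarTree ℝ, (Tree.mk t).prune.getD (Tree.mk t) = Tree.mk t.pruned := by
    intro t
    have : (Tree.mk t).prune = t.prune.map Tree.mk := rfl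
    rw [this, pruned]
    cases t.prune <;> rfl
  have hg : Measurable fun T : Tree ℝ => T.prune.getD T := by
    refine Tree.measurable_of_mk ?_
    simp only [hgm]
    exact measurable_mk.comp measurable_pruned
  have hmass : (planarLaw hc hγ) {t | t.order ≠ 1} = 2⁻¹ := by
    have h := congrArg (fun μ => μ Set.univ) (map_pruned_planarLaw hc hγ)
    simpa [Measure.map_apply measurable_pruned, Measure.map_apply measurable_scaleMap] using h
  rw [prunedLaw, ProbabilityTheory.cond, treeLaw_eq, Measure.restrict_map measurable_mk hne,
    Measure.map_apply measurable_mk hne, hpre, hmass, Measure.map_smul,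
    Measure.map_map hg measurable_mk, Measure.map_map (Tree.measurable_scale c) measurable_mk]
  have e1 : (fun T : Tree ℝ => T.prune.getD T) ∘ Tree.mk = Tree.mk ∘ pruned := funext hgm
  have e2 : Tree.scale c ∘ Tree.mk = Tree.mk ∘ PlanarTree.map fun x => c * x := rfl
  rw [e1, e2, ← Measure.map_map measurable_mk measurable_pruned, map_pruned_planarLaw,
    Measure.map_smul, smul_smul, Measure.map_map measurable_mk measurable_scaleMap, inv_inv,
    ENNReal.mul_inv_cancel (by simp) (by simp), one_smul]

end tokunaga

/-! ### Complete subtrees -/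

namespace PlanarTree

variable {α : Type}

theorem properComplete_of_le {K : ℕ} {t : PlanarTree α} (h : t.order ≤ K) :
    t.properComplete K = 0 := by
  induction t with
  | leaf x => rfl
  | node x a b ha hb =>
    have hle : a.order ≤ (node x a b).order ∧ b.order ≤ (node x a b).order := by
      simp only [order]
      split_ifs <;> omega
    rw [properComplete, ha (hle.1.trans h), hb (hle.2.trans h), if_neg (by omega),
      if_neg (by omega)]
    rfl

theorem completeSubtrees_of_order_eq {K : ℕ} {t : PlanarTree α} (h : t.order = K) :
    (Tree.mk t).completeSubtrees K = {Tree.mk t} := by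
  change t.completeSubtrees K = {⟦t⟧}
  rw [completeSubtrees, if_pos h, properComplete_of_le h.le, add_zero]

theorem completeSubtrees_leaf {K : ℕ} (hK : K ≠ 1) (x : α) :
    (Tree.mk (leaf x)).completeSubtrees K = 0 := by
  change (leaf x).completeSubtrees K = 0
  rw [completeSubtrees, if_neg (by simpa [order] using hK.symm)]
  rfl

/-- If the top vertex does not have order `K`, a child of order `K` automatically begins a new
branch. Number and sums over complete subtrees are therefore additive. -/
theorem completeSubtrees_node {K : ℕ} {x : α} {a b : PlanarTree α}
    (h : (node x a b).order ≠ K) :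
    (Tree.mk (node x a b)).completeSubtrees K =
      (Tree.mk a).completeSubtrees K + (Tree.mk b).completeSubtrees K := by
  change (node x a b).completeSubtrees K = a.completeSubtrees K + b.completeSubtrees K
  have e : ∀ d : PlanarTree α, (d.order = K ∧ d.order ≠ (node x a b).order) ↔ d.order = K := by
    intro d
    constructor
    · exact fun h => h.1
    · exact fun h1 => ⟨h1, by omega⟩
  rw [completeSubtrees, if_neg h, zero_add, properComplete]
  simp only [e, completeSubtrees]
  abel

theorem completeSubtrees_ne_zero {K : ℕ} (hK : 1 ≤ K) {t : PlanarTree α} (h : K ≤ t.order) :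
    (Tree.mk t).completeSubtrees K ≠ 0 := by
  induction t with
  | leaf x =>
    rw [completeSubtrees_of_order_eq (t := leaf x) (le_antisymm h hK).symm]
    simp
  | node x a b ha hb =>
    by_cases hn : (node x a b).order = K
    · rw [completeSubtrees_of_order_eq hn]
      simp
    · rw [completeSubtrees_node hn]
      have : K ≤ a.order ∨ K ≤ b.order := by
        simp only [order] at h hn
        split_ifs at h hn <;> omega
      intro h0
      rw [add_eq_zero] at h0
      rcases this with h1 | h1
      · exact ha h1 h0.1
      · exact hb h1 h0.2

/-- The number of complete subtrees of order `K`. -/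
def completeCount (K : ℕ) (t : PlanarTree α) : ℕ := ((Tree.mk t).completeSubtrees K).card

/-- The sum of a statistic over the complete subtrees of order `K`. -/
noncomputable def completeSum (K : ℕ) (f : Tree α → ℝ≥0∞) (t : PlanarTree α) : ℝ≥0∞ :=
  (((Tree.mk t).completeSubtrees K).map f).sum

open Classical in
theorem completeCount_node_eq (K : ℕ) (x : α) (a b : PlanarTree α) :
    completeCount K (node x a b) =
      if (node x a b).order = K then 1 else completeCount K a + completeCount K b := by
  unfold completeCount
  split_ifs with h
  · rw [completeSubtrees_of_order_eq h, Multiset.card_singleton]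
  · rw [completeSubtrees_node h, Multiset.card_add]

open Classical in
theorem completeSum_node_eq (K : ℕ) (f : Tree α → ℝ≥0∞) (x : α) (a b : PlanarTree α) :
    completeSum K f (node x a b) =
      if (node x a b).order = K then f (Tree.mk (node x a b))
      else completeSum K f a + completeSum K f b := by
  unfold completeSum
  split_ifs with h
  · rw [completeSubtrees_of_order_eq h, Multiset.map_singleton, Multiset.sum_singleton]
  · rw [completeSubtrees_node h, Multiset.map_add, Multiset.sum_add]

theorem measurable_nodeOrder {δ : Type*} [MeasurableSpace δ] :
    Measurable fun x : ℝ × PlanarTree ℝ × PlanarTree ℝ × δ =>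
      (node x.1 x.2.1 x.2.2.1).order :=
  measurable_order.comp
    (measurable_fst.planarNode measurable_snd.fst measurable_snd.snd.fst)

theorem measurable_completeCount (K : ℕ) :
    Measurable (completeCount K : PlanarTree ℝ → ℕ) := by
  classical
  refine measurable_of_rec (fun x a b m n => if (node x a b).order = K then 1 else m + n) ?_ ?_
    (completeCount_node_eq K)
  · have : ∀ x : ℝ, completeCount K (leaf x) = if K = 1 then 1 else 0 := by
      intro x
      unfold completeCount
      split_ifs with h
      · rw [completeSubtrees_of_order_eq (by rw [h]; rfl), Multiset.card_singleton]
      · rw [completeSubtrees_leaf h, Multiset.card_zero]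
    simp only [this]
    exact measurable_const
  · exact Measurable.ite (measurable_nodeOrder (measurableSet_singleton K)) measurable_const
      (measurable_snd.snd.snd.fst.add measurable_snd.snd.snd.snd)

theorem measurable_completeSum (K : ℕ) {f : Tree ℝ → ℝ≥0∞} (hf : Measurable f) :
    Measurable (completeSum K f) := by
  classical
  refine measurable_of_rec (fun x a b m n =>
    if (node x a b).order = K then f (Tree.mk (node x a b)) else m + n) ?_ ?_
    (completeSum_node_eq K f)
  · by_cases h : K = 1
    · have : ∀ x : ℝ, completeSum K f (leaf x) = f (Tree.mk (leaf x)) := by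
        intro x
        rw [completeSum, completeSubtrees_of_order_eq (by rw [h]; rfl), Multiset.map_singleton,
          Multiset.sum_singleton]
      simp only [this]
      exact hf.comp (measurable_mk.comp measurable_leaf)
    · have : ∀ x : ℝ, completeSum K f (leaf x) = 0 := by
        intro x
        rw [completeSum, completeSubtrees_leaf h, Multiset.map_zero, Multiset.sum_zero]
      simp only [this]
      exact measurable_const
  · refine Measurable.ite (measurable_nodeOrder (measurableSet_singleton K)) ?_
      (measurable_snd.snd.snd.fst.add measurable_snd.snd.snd.snd)
    exact hf.comp (measurable_mk.comp
      (measurable_fst.planarNode measurable_snd.fst measurable_snd.snd.fst))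

end PlanarTree

theorem uniformLaw_apply {Ω : Type} [MeasurableSpace Ω] (m : Multiset Ω) {A : Set Ω}
    (hA : MeasurableSet A) :
    uniformLaw m A = (m.card : ℝ≥0∞)⁻¹ * (m.map (A.indicator 1)).sum := by
  rw [uniformLaw, Measure.smul_apply, smul_eq_mul]
  congr 1
  induction m using Multiset.induction_on with
  | empty => simp
  | cons x m ih =>
    rw [Multiset.map_cons, Multiset.sum_cons, Measure.add_apply, ih, Multiset.map_cons,
      Multiset.sum_cons, Measure.dirac_apply' _ hA]

/-- The complete subtrees of a random tree with law `μ` are, given their number, distributed on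
average as a tree whose statistics `f` have mean `E f`. -/
def CoordinatedWith (K : ℕ) (E : (Tree ℝ → ℝ≥0∞) → ℝ≥0∞) (μ : Measure (PlanarTree ℝ)) : Prop :=
  ∀ (φ : ℕ → ℝ≥0∞) (f : Tree ℝ → ℝ≥0∞), Measurable f →
    ∫⁻ t, φ (completeCount K t) * completeSum K f t ∂μ =
      E f * ∫⁻ t, φ (completeCount K t) * completeCount K t ∂μ

/-- Fix one child: its count `m` only changes the weight on the other child to `n ↦ φ (m + n)`, to
which the hypothesis still applies. This is why the property quantifies over all weights. -/
theorem CoordinatedWith.nodeLaw {K : ℕ} {E : (Tree ℝ → ℝ≥0∞) → ℝ≥0∞} {ρ : Measure ℝ}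
    {μ ν : Measure (PlanarTree ℝ)} [SFinite μ] [SFinite ν] (hμ : CoordinatedWith K E μ)
    (hν : CoordinatedWith K E ν)
    (hord : ∀ᵐ a ∂μ, ∀ᵐ b ∂ν, ∀ x, (node x a b).order ≠ K) :
    CoordinatedWith K E (nodeLaw ρ μ ν) := by
  intro φ f hf
  have hN := measurable_completeCount K
  have hS := measurable_completeSum K hf
  have hφ : Measurable φ := measurable_of_countable φ
  have hNe : Measurable fun t : PlanarTree ℝ => (completeCount K t : ℝ≥0∞) :=
    (measurable_of_countable (fun n : ℕ => (n : ℝ≥0∞))).comp hN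
  have hpair : Measurable fun p : PlanarTree ℝ × PlanarTree ℝ =>
      φ (completeCount K p.1 + completeCount K p.2) :=
    hφ.comp ((hN.comp measurable_fst).add (hN.comp measurable_snd))
  have hA : ∀ a, Measurable fun b => φ (completeCount K a + completeCount K b) :=
    fun a => hpair.comp measurable_prodMk_left
  -- Used for both the sum and the count. Fubini places the integral over the child at which `s` is
  -- evaluated innermost.
  have gen : ∀ (s : PlanarTree ℝ → ℝ≥0∞), Measurable s →
      (∀ a b, ∀ x, (node x a b).order ≠ K → s (node x a b) = s a + s b) → ∀ x,
      ∫⁻ a, ∫⁻ b, φ (completeCount K (node x a b)) * s (node x a b) ∂ν ∂μ =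
      ∫⁻ b, ∫⁻ a, φ (completeCount K b + completeCount K a) * s a ∂μ ∂ν +
        ∫⁻ a, ∫⁻ b, φ (completeCount K a + completeCount K b) * s b ∂ν ∂μ := by
    intro s hs hadd x
    rw [lintegral_lintegral_swap (μ := ν) (ν := μ)
      (f := fun b a => φ (completeCount K b + completeCount K a) * s a)]
    · rw [← lintegral_add_left]
      · refine lintegral_congr_ae ?_
        filter_upwards [hord] with a ha
        rw [← lintegral_add_right]
        · refine lintegral_congr_ae ?_
          filter_upwards [ha] with b hb
          rw [hadd a b x (hb x), mul_add, completeCount_node_eq, if_neg (hb x),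
            add_comm (completeCount K b)]
        · exact (hA a).mul hs
      · exact ((hpair.comp measurable_swap).mul (hs.comp measurable_fst)).lintegral_prod_right'
    · exact (hpair.mul (hs.comp measurable_snd)).aemeasurable
  have e1 := gen (completeSum K f) hS fun a b x h => by
    rw [completeSum_node_eq, if_neg h]
  have e2 := gen (fun t => (completeCount K t : ℝ≥0∞)) hNe fun a b x h => by
    rw [completeCount_node_eq, if_neg h, Nat.cast_add]
  rw [lintegral_nodeLaw (f := fun t => φ (completeCount K t) * completeSum K f t)
      ((hφ.comp hN).mul hS),
    lintegral_nodeLaw (f := fun t => φ (completeCount K t) * completeCount K t)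
      ((hφ.comp hN).mul hNe)]
  have m1 : Measurable fun b => ∫⁻ a, φ (completeCount K b + completeCount K a) *
      completeCount K a ∂μ :=
    (hpair.mul (hNe.comp measurable_snd)).lintegral_prod_right'
  have m2 : Measurable fun a => ∫⁻ b, φ (completeCount K a + completeCount K b) *
      completeCount K b ∂ν :=
    (hpair.mul (hNe.comp measurable_snd)).lintegral_prod_right'
  -- The hypotheses are applied with the weights shifted by the count of the other child.
  have hμ' := fun m => hμ (fun n => φ (m + n)) f hf
  have hν' := fun m => hν (fun n => φ (m + n)) f hf
  simp only [e1, e2, hμ', hν']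
  rw [lintegral_const_mul _ m1, lintegral_const_mul _ m2, ← mul_add, lintegral_const,
    lintegral_const, mul_assoc]

section tokunaga

variable {c γ : ℝ} (hc : 1 ≤ c) (hγ : 0 < γ)

theorem coordinatedWith_self (K : ℕ) :
    CoordinatedWith (K + 1) (fun f => ∫⁻ t, f (Tree.mk t) ∂tokLaw hc hγ K) (tokLaw hc hγ K) := by
  intro φ f hf
  have h1 : ∀ᵐ t ∂tokLaw hc hγ K, φ (completeCount (K + 1) t) * completeSum (K + 1) f t =
      φ 1 * f (Tree.mk t) := by
    filter_upwards [tokLaw_order hc hγ K] with t ht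
    rw [completeCount, completeSum, completeSubtrees_of_order_eq ht, Multiset.map_singleton,
      Multiset.sum_singleton, Multiset.card_singleton]
  have h2 : ∀ᵐ t ∂tokLaw hc hγ K, φ (completeCount (K + 1) t) * completeCount (K + 1) t =
      φ 1 := by
    filter_upwards [tokLaw_order hc hγ K] with t ht
    rw [completeCount, completeSubtrees_of_order_eq ht, Multiset.card_singleton]
    simp
  rw [lintegral_congr_ae h1, lintegral_congr_ae h2, lintegral_const_mul (f := fun t => f (Tree.mk t)) _ (hf.comp measurable_mk)]
  simp [mul_comm]

/-- A tree of order `K + 1` is its own only complete subtree of that order, and a leaf of another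
order has none. Everything else is obtained by grafting, which preserves the property. -/
theorem coordinatedWith_tokLaw (K H : ℕ) :
    CoordinatedWith (K + 1) (fun f => ∫⁻ t, f (Tree.mk t) ∂tokLaw hc hγ K) (tokLaw hc hγ H) := by
  set E : (Tree ℝ → ℝ≥0∞) → ℝ≥0∞ := fun f => ∫⁻ t, f (Tree.mk t) ∂tokLaw hc hγ K with hE
  by_cases hHK : H = K
  · subst hHK
    exact coordinatedWith_self hc hγ H
  have h0 : 0 < γ * c := mul_pos hγ (by linarith)
  have := isProbabilityMeasure_expMeasure h0
  have hfix : ∀ i, (i ≠ K → CoordinatedWith (K + 1) E (tokLaw hc hγ i)) →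
      CoordinatedWith (K + 1) E (tokLaw hc hγ i) := by
    intro i h
    by_cases hi : i = K
    · subst hi
      exact coordinatedWith_self hc hγ i
    · exact h hi
  have hmeas : ∀ H : ℕ, MeasurableSet {t : PlanarTree ℝ | t.order = H + 1} :=
    fun H => measurableSet_order_eq _
  -- The order is carried along to ensure that the new top vertex does not have order `K + 1`. Laws
  -- of index `K` are excluded from the induction; as grafted subtrees they are supplied by `hfix`.
  refine (tokLaw_induction (A := fun H μ => (∀ᵐ t ∂μ, t.order = H + 1) ∧
    (H ≠ K → CoordinatedWith (K + 1) E μ)) hc hγ ?_ ?_ ?_ ?_ ?_ H).2 hHK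
  · refine ⟨?_, fun hK φ f hf => ?_⟩
    · rw [ae_map_iff measurable_leaf.aemeasurable (hmeas 0)]
      exact Eventually.of_forall fun x => rfl
    · have hφ : Measurable fun t : PlanarTree ℝ => φ (completeCount (K + 1) t) :=
        (measurable_of_countable φ).comp (measurable_completeCount _)
      have hNe : Measurable fun t : PlanarTree ℝ => (completeCount (K + 1) t : ℝ≥0∞) :=
        (measurable_of_countable (fun n : ℕ => (n : ℝ≥0∞))).comp (measurable_completeCount _)
      rw [lintegral_map (f := fun t => φ (completeCount (K + 1) t) * completeSum (K + 1) f t)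
          (hφ.mul (measurable_completeSum _ hf)) measurable_leaf,
        lintegral_map (f := fun t => φ (completeCount (K + 1) t) * completeCount (K + 1) t)
          (hφ.mul hNe) measurable_leaf]
      have : ∀ x : ℝ, (Tree.mk (leaf x)).completeSubtrees (K + 1) = 0 :=
        completeSubtrees_leaf (by omega)
      simp [completeSum, completeCount, this]
  · rintro j ⟨hj, hj'⟩
    have hnode : ∀ᵐ a ∂tokLaw hc hγ j, ∀ᵐ b ∂tokLaw hc hγ j, ∀ x,
        (node x a b).order = j + 1 + 1 := by
      filter_upwards [hj] with a ha
      filter_upwards [hj] with b hb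
      intro x
      simp [order, ha, hb]
    refine ⟨ae_nodeLaw (hmeas _) hnode, fun hjK => (hfix j hj').nodeLaw (hfix j hj') ?_⟩
    filter_upwards [hnode] with a ha
    filter_upwards [ha] with b hb
    intro x
    rw [hb x]
    omega
  · rintro j i ν hij hν ⟨hj, hj'⟩ ⟨hi, hi'⟩
    have hnode : ∀ᵐ a ∂ν, ∀ᵐ b ∂tokLaw hc hγ i, ∀ x, (node x a b).order = j + 1 := by
      filter_upwards [hj] with a ha
      filter_upwards [hi] with b hb
      intro x
      simp only [order, ha, hb]
      split_ifs <;> omega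
    refine ⟨ae_nodeLaw (hmeas _) hnode, fun hjK => (hj' hjK).nodeLaw (hfix i hi') ?_⟩
    filter_upwards [hnode] with a ha
    filter_upwards [ha] with b hb
    intro x
    rw [hb x]
    omega
  · rintro j r μ ⟨h1, h2⟩
    refine ⟨Measure.ae_smul_measure h1 r, fun hjK φ f hf => ?_⟩
    rw [lintegral_smul_measure, lintegral_smul_measure, h2 hjK φ f hf, smul_eq_mul, smul_eq_mul,
      mul_left_comm]
  · intro j ι _ μ h
    refine ⟨Measure.ae_sum_iff.2 fun i => (h i).1, fun hjK φ f hf => ?_⟩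
    rw [lintegral_sum_measure, lintegral_sum_measure, ← ENNReal.tsum_mul_left]
    exact tsum_congr fun i => (h i).2 hjK φ f hf

theorem subtreeLaw_treeLaw {K H : ℕ} (hKH : K ≤ H) :
    subtreeLaw (tokunaga c γ hc hγ).treeLaw (K + 1) (H + 1) =
      orderLaw (tokunaga c γ hc hγ).treeLaw (K + 1) := by
  rw [subtreeLaw, orderLaw_treeLaw, orderLaw_treeLaw]
  have hval : ∀ (A : Set (Tree ℝ)), MeasurableSet A → ∀ t : PlanarTree ℝ,
      uniformLaw ((Tree.mk t).completeSubtrees (K + 1)) A =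
        (completeCount (K + 1) t : ℝ≥0∞)⁻¹ * completeSum (K + 1) (A.indicator 1) t :=
    fun A hA t => uniformLaw_apply _ hA
  have hN : Measurable fun t : PlanarTree ℝ => (completeCount (K + 1) t : ℝ≥0∞)⁻¹ :=
    (measurable_of_countable (fun n : ℕ => (n : ℝ≥0∞)⁻¹)).comp (measurable_completeCount _)
  have hm : Measurable fun T : Tree ℝ => uniformLaw (T.completeSubtrees (K + 1)) := by
    refine Tree.measurable_of_mk (Measure.measurable_of_measurable_coe _ fun A hA => ?_)
    simp only [hval A hA]
    exact hN.mul (measurable_completeSum _ (measurable_one.indicator hA))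
  ext A hA
  have hind : Measurable (A.indicator (1 : Tree ℝ → ℝ≥0∞)) := measurable_one.indicator hA
  rw [Measure.bind_apply hA hm.aemeasurable,
    lintegral_map (f := fun T : Tree ℝ => uniformLaw (T.completeSubtrees (K + 1)) A)
      ((Measure.measurable_coe hA).comp hm) measurable_mk]
  simp only [hval A hA]
  -- The weight `n ↦ n⁻¹` turns the sum over complete subtrees into the uniform average. The
  -- remaining integrand `n⁻¹ * n` is one because a tree of order `H + 1 ≥ K + 1` has a complete
  -- subtree of order `K + 1`.
  rw [coordinatedWith_tokLaw hc hγ K H (fun n => (n : ℝ≥0∞)⁻¹) _ hind]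
  have h1 : ∀ᵐ t ∂tokLaw hc hγ H,
      (completeCount (K + 1) t : ℝ≥0∞)⁻¹ * completeCount (K + 1) t = 1 := by
    filter_upwards [tokLaw_order hc hγ H] with t ht
    refine ENNReal.inv_mul_cancel ?_ (ENNReal.natCast_ne_top _)
    have : (Tree.mk t).completeSubtrees (K + 1) ≠ 0 := completeSubtrees_ne_zero (by omega) (by omega)
    simpa [completeCount] using this
  rw [lintegral_congr_ae h1, lintegral_one, measure_univ, mul_one,
    ← lintegral_indicator_one hA, lintegral_map hind measurable_mk]

end tokunaga

/-! ### Independent edge lengths -/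

section iid

variable {ρ : Measure ℝ}

theorem iidLengths_node (a b : PlanarTree Unit) :
    iidLengths ρ (node () a b) = nodeLaw ρ (iidLengths ρ a) (iidLengths ρ b) := rfl

instance isProbabilityMeasure_iidLengths [IsProbabilityMeasure ρ] (σ : PlanarTree Unit) :
    IsProbabilityMeasure (iidLengths ρ σ) := by
  induction σ with
  | leaf x => exact Measure.isProbabilityMeasure_map measurable_leaf.aemeasurable
  | node x a b ha hb =>
    rw [iidLengths_node]
    infer_instance

theorem iidLengths_shape [IsProbabilityMeasure ρ] (σ : PlanarTree Unit) :
    ∀ᵐ t ∂iidLengths ρ σ, t.shape = σ := by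
  induction σ with
  | leaf x =>
    refine (ae_map_iff measurable_leaf.aemeasurable (measurableSet_shape {leaf x})).2 ?_
    exact Eventually.of_forall fun x => rfl
  | node x a b ha hb =>
    rw [iidLengths_node]
    refine ae_nodeLaw (measurableSet_shape {node x a b}) ?_
    filter_upwards [ha] with t ht
    filter_upwards [hb] with s hs
    intro y
    rw [shape_node, ht, hs]

/-- Interchange the two offspring of the first internal vertex. -/
def flipRoot : PlanarTree ℝ → PlanarTree ℝ
  | leaf x => leaf x
  | node x a b => node x b a

/-- Transform the two trees attached to the first internal vertex. -/
def mapChildren (f g : PlanarTree ℝ → PlanarTree ℝ) : PlanarTree ℝ → PlanarTree ℝ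
  | leaf x => leaf x
  | node x a b => node x (f a) (g b)

theorem measurable_flipRoot : Measurable flipRoot :=
  measurable_of_leaf_node measurable_leaf
    (measurable_fst.planarNode measurable_snd.snd measurable_snd.fst)

theorem measurable_mapChildren {f g : PlanarTree ℝ → PlanarTree ℝ} (hf : Measurable f)
    (hg : Measurable g) : Measurable (mapChildren f g) :=
  measurable_of_leaf_node measurable_leaf
    (measurable_fst.planarNode (hf.comp measurable_snd.fst) (hg.comp measurable_snd.snd))

theorem flipRoot_same (t : PlanarTree ℝ) : Same (flipRoot t) t := by
  cases t with
  | leaf x => exact .leaf x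
  | node x a b => exact .swap x (.refl b) (.refl a)

theorem mapChildren_same {f g : PlanarTree ℝ → PlanarTree ℝ} (hf : ∀ t, Same (f t) t)
    (hg : ∀ t, Same (g t) t) (t : PlanarTree ℝ) : Same (mapChildren f g t) t := by
  cases t with
  | leaf x => exact .leaf x
  | node x a b => exact .node x (hf a) (hg b)

theorem map_flipRoot_nodeLaw {μ ν : Measure (PlanarTree ℝ)} [SFinite μ] [SFinite ν] :
    (nodeLaw ρ μ ν).map flipRoot = nodeLaw ρ ν μ := by
  refine Measure.ext_of_lintegral _ fun f hf => ?_
  rw [lintegral_map hf measurable_flipRoot,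
    lintegral_nodeLaw (f := fun t => f (flipRoot t)) (hf.comp measurable_flipRoot),
    lintegral_nodeLaw hf]
  refine lintegral_congr fun x => ?_
  refine lintegral_lintegral_swap (f := fun a b => f (node x b a)) ?_
  exact (hf.comp (measurable_const.planarNode measurable_snd measurable_fst)).aemeasurable

theorem map_mapChildren_nodeLaw [SFinite ρ] {μ ν : Measure (PlanarTree ℝ)} [SFinite μ] [SFinite ν]
    {f g : PlanarTree ℝ → PlanarTree ℝ} (hf : Measurable f) (hg : Measurable g) :
    (nodeLaw ρ μ ν).map (mapChildren f g) = nodeLaw ρ (μ.map f) (ν.map g) := by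
  rw [map_nodeLaw (g := id) (measurable_mapChildren hf hg) measurable_id hf hg
    (Eventually.of_forall fun a => Eventually.of_forall fun b x => rfl), Measure.map_id]

/-- Two embeddings of a combinatorial tree, with i.i.d. edge lengths, are related by a measurable
change of the embedding. -/
theorem PlanarTree.Same.exists_map_iidLengths [IsProbabilityMeasure ρ] {σ τ : PlanarTree Unit}
    (h : Same σ τ) : ∃ f : PlanarTree ℝ → PlanarTree ℝ, Measurable f ∧ (∀ t, Same (f t) t) ∧
      iidLengths ρ τ = (iidLengths ρ σ).map f := by
  induction h with
  | leaf x => exact ⟨id, measurable_id, Same.refl, Measure.map_id.symm⟩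
  | node x _ _ ha hb =>
    obtain ⟨f, hf, hfs, hfe⟩ := ha
    obtain ⟨g, hg, hgs, hge⟩ := hb
    refine ⟨mapChildren f g, measurable_mapChildren hf hg, mapChildren_same hfs hgs, ?_⟩
    rw [iidLengths_node, iidLengths_node, map_mapChildren_nodeLaw hf hg, hfe, hge]
  | swap x _ _ ha hb =>
    obtain ⟨f, hf, hfs, hfe⟩ := ha
    obtain ⟨g, hg, hgs, hge⟩ := hb
    have hm := measurable_mapChildren hf hg
    refine ⟨flipRoot ∘ mapChildren f g, measurable_flipRoot.comp hm,
      fun t => (flipRoot_same _).trans (mapChildren_same hfs hgs t), ?_⟩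
    rw [← Measure.map_map measurable_flipRoot hm, iidLengths_node, iidLengths_node,
      map_mapChildren_nodeLaw hf hg, map_flipRoot_nodeLaw, hfe, hge]

/-- The change of embedding moves each tree within its own class, so it is invisible after
`Tree.mk`. -/
theorem PlanarTree.Same.map_mk_iidLengths [IsProbabilityMeasure ρ] {σ τ : PlanarTree Unit}
    (h : Same σ τ) : (iidLengths ρ σ).map Tree.mk = (iidLengths ρ τ).map Tree.mk := by
  obtain ⟨f, hf, hfs, hfe⟩ := h.exists_map_iidLengths (ρ := ρ)
  rw [hfe, Measure.map_map measurable_mk hf]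
  congr 1
  funext t
  exact (Quotient.sound (hfs t)).symm

/-- A superposition of the laws of trees with i.i.d. edge lengths of law `ρ`. -/
def IsIIDMixture (ρ : Measure ℝ) (μ : Measure (PlanarTree ℝ)) : Prop :=
  ∃ (ι : Type) (_ : Countable ι) (w : ι → ℝ≥0∞) (σ : ι → PlanarTree Unit),
    μ = Measure.sum fun i => w i • iidLengths ρ (σ i)

theorem IsIIDMixture.smul {μ : Measure (PlanarTree ℝ)} (h : IsIIDMixture ρ μ) (r : ℝ≥0∞) :
    IsIIDMixture ρ (r • μ) := by
  obtain ⟨ι, hι, w, σ, rfl⟩ := h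
  refine ⟨ι, hι, fun i => r * w i, σ, ?_⟩
  ext A hA
  simp only [Measure.smul_apply, Measure.sum_apply _ hA, smul_eq_mul, ← ENNReal.tsum_mul_left,
    mul_assoc]

theorem IsIIDMixture.sum {κ : Type} [Countable κ] {μ : κ → Measure (PlanarTree ℝ)}
    (h : ∀ k, IsIIDMixture ρ (μ k)) : IsIIDMixture ρ (Measure.sum μ) := by
  choose ι hι w σ hμ using h
  refine ⟨Σ k, ι k, inferInstance, fun p => w p.1 p.2, fun p => σ p.1 p.2, ?_⟩
  ext A hA
  rw [Measure.sum_apply _ hA, Measure.sum_apply _ hA,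
    ENNReal.tsum_sigma fun k i => (w k i • iidLengths ρ (σ k i)) A]
  refine tsum_congr fun k => ?_
  rw [hμ k, Measure.sum_apply _ hA]

theorem IsIIDMixture.nodeLaw [IsProbabilityMeasure ρ] {μ ν : Measure (PlanarTree ℝ)}
    (hμ : IsIIDMixture ρ μ) (hν : IsIIDMixture ρ ν) : IsIIDMixture ρ (nodeLaw ρ μ ν) := by
  obtain ⟨ι, hι, w, σ, rfl⟩ := hμ
  obtain ⟨κ, hκ, v, τ, rfl⟩ := hν
  refine ⟨ι × κ, inferInstance, fun p => w p.1 * v p.2, fun p => node () (σ p.1) (τ p.2), ?_⟩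
  rw [HBP.nodeLaw, Measure.prod_sum, Measure.prod_sum_right,
    Measure.map_sum measurable_node.aemeasurable]
  congr 1
  funext p
  rw [Measure.prod_smul_left, Measure.prod_smul_right, Measure.prod_smul_right,
    Measure.prod_smul_right, smul_smul, Measure.map_smul]
  rfl

/-- Components whose shape is an embedding of `τ` all have the same image under `Tree.mk`, and the
others do not charge this shape. The restriction is a multiple of one probability law, and
conditioning removes the factor. -/
theorem IsIIDMixture.hasIIDEdgeLengths [IsProbabilityMeasure ρ] {μ : Measure (PlanarTree ℝ)}
    [IsFiniteMeasure μ] (h : IsIIDMixture ρ μ) : HasIIDEdgeLengths (μ.map Tree.mk) ρ := by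
  classical
  obtain ⟨ι, hι, w, σ, hμ⟩ := h
  intro τ hτ
  have hm := Tree.measurableSet_shape (Tree.mk τ)
  have key : (μ.map Tree.mk).restrict {T | T.shape = Tree.mk τ} =
      (∑' i, if Tree.mk (σ i) = Tree.mk τ then w i else 0) •
        (iidLengths ρ τ).map Tree.mk := by
    ext A hA
    rw [Measure.restrict_apply hA, Measure.map_apply measurable_mk (hA.inter hm), hμ,
      Measure.sum_apply _ (measurable_mk (hA.inter hm)), Measure.smul_apply, smul_eq_mul,
      ← ENNReal.tsum_mul_right]
    refine tsum_congr fun i => ?_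
    rw [Measure.smul_apply, smul_eq_mul]
    split_ifs with hi
    · have hs : Same (σ i) τ := Quotient.exact hi
      rw [← hs.map_mk_iidLengths, Measure.map_apply measurable_mk hA]
      congr 1
      refine measure_congr ?_
      filter_upwards [iidLengths_shape (ρ := ρ) (σ i)] with t ht
      refine propext ⟨fun h => h.1, fun h => ⟨h, ?_⟩⟩
      change Tree.mk t.shape = Tree.mk τ
      rw [ht, hi]
    · have : iidLengths ρ (σ i) (Tree.mk ⁻¹' (A ∩ {T | T.shape = Tree.mk τ})) = 0 := by
        refine measure_mono_null ?_ (ae_iff.1 (iidLengths_shape (ρ := ρ) (σ i)))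
        intro t ht ht'
        have h2 : Tree.mk t.shape = Tree.mk τ := ht.2
        exact hi (ht' ▸ h2)
      rw [this, mul_zero, zero_mul]
  set W := ∑' i, if Tree.mk (σ i) = Tree.mk τ then w i else 0
  have := Measure.isProbabilityMeasure_map (μ := iidLengths ρ τ) measurable_mk.aemeasurable
  have hW : (μ.map Tree.mk) {T | T.shape = Tree.mk τ} = W := by
    rw [← Measure.restrict_apply_univ, key]
    simp
  have htop : W ≠ ⊤ := by
    rw [← hW]
    exact measure_ne_top _ _
  rw [lawGivenShape, ProbabilityTheory.cond, key, hW, smul_smul,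
    ENNReal.inv_mul_cancel (hW ▸ hτ) htop, one_smul]

end iid

section tokunaga

variable {c γ : ℝ} (hc : 1 ≤ c) (hγ : 0 < γ)

/-- Every event creates a root edge with the same law `expMeasure (γ * c)`, whatever its type; only
the weights depend on the shape. -/
theorem isIIDMixture_tokLaw (K : ℕ) : IsIIDMixture (expMeasure (γ * c)) (tokLaw hc hγ K) := by
  have := isProbabilityMeasure_expMeasure (mul_pos hγ (show 0 < c by linarith))
  refine tokLaw_induction (A := fun _ μ => IsIIDMixture (expMeasure (γ * c)) μ) hc hγ ?_ ?_ ?_ ?_ ?_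
    K
  · refine ⟨Unit, inferInstance, fun _ => 1, fun _ => leaf (), ?_⟩
    rw [Measure.sum_fintype]
    simp [iidLengths]
  · exact fun K h => h.nodeLaw h
  · exact fun K i ν _ _ h1 h2 => h1.nodeLaw h2
  · exact fun K r μ h => h.smul r
  · exact fun K ι _ μ h => IsIIDMixture.sum h

theorem hasIIDEdgeLengths_treeLaw :
    HasIIDEdgeLengths (tokunaga c γ hc hγ).treeLaw (expMeasure (γ * c)) := by
  have := isProbabilityMeasure_expMeasure (mul_pos hγ (show 0 < c by linarith))
  rw [treeLaw_eq]
  have h : IsIIDMixture (expMeasure (γ * c)) (planarLaw hc hγ) :=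
    IsIIDMixture.sum fun K => (isIIDMixture_tokLaw hc hγ K).smul _
  exact h.hasIIDEdgeLengths

/-! ### Self-similarity -/

theorem Tree.shape_scale (ζ : ℝ) (T : Tree ℝ) : (Tree.scale ζ T).shape = T.shape := by
  induction T using Quotient.inductionOn with
  | h t =>
    have : ∀ t : PlanarTree ℝ, (t.map fun x => ζ * x).shape = t.shape := by
      intro t
      induction t with
      | leaf x => rfl
      | node x a b ha hb => simp only [PlanarTree.map, shape_node, ha, hb]
    exact congrArg Tree.mk (this t)

theorem lawGivenShape_map_scale (η : Measure (Tree ℝ)) (ζ : ℝ) (τ : Tree Unit) :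
    lawGivenShape (η.map (Tree.scale ζ)) τ = (lawGivenShape η τ).map (Tree.scale ζ) := by
  have hm := Tree.measurableSet_shape τ
  have hpre : Tree.scale ζ ⁻¹' {T : Tree ℝ | T.shape = τ} = {T | T.shape = τ} := by
    ext T
    simp [Tree.shape_scale]
  rw [lawGivenShape, ProbabilityTheory.cond, Measure.restrict_map (Tree.measurable_scale ζ) hm,
    Measure.map_apply (Tree.measurable_scale ζ) hm, hpre, lawGivenShape, ProbabilityTheory.cond,
    Measure.map_smul]

theorem treeLaw_order (K : ℕ) : (tokunaga c γ hc hγ).treeLaw {T | T.order = K + 1} ≠ 0 := by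
  rw [treeLaw_eq, Measure.map_apply measurable_mk (Tree.measurableSet_order _)]
  change planarLaw hc hγ {t | t.order = K + 1} ≠ 0
  rw [planarLaw_order]
  exact rootProb_ne_zero K

theorem Tree.order_shape (T : Tree ℝ) : T.shape.order = T.order := by
  induction T using Quotient.inductionOn with
  | h t => exact PlanarTree.order_shape t

theorem isSelfSimilar_treeLaw : IsSelfSimilar (tokunaga c γ hc hγ).treeLaw c where
  isProbability := inferInstance
  coord_shape K H hK hKH τ hτ := by
    obtain ⟨k, rfl⟩ : ∃ k, K = k + 1 := ⟨K - 1, by omega⟩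
    obtain ⟨h, rfl⟩ : ∃ h, H = h + 1 := ⟨H - 1, by omega⟩
    rw [subtreeLaw_treeLaw hc hγ (by omega)]
  coord_length K H hK hKH τ hτ := by
    obtain ⟨k, rfl⟩ : ∃ k, K = k + 1 := ⟨K - 1, by omega⟩
    obtain ⟨h, rfl⟩ : ∃ h, H = h + 1 := ⟨H - 1, by omega⟩
    -- The shape determines the order, so conditioning on the order first is redundant.
    have hsub : {T : Tree ℝ | T.order = k + 1} ∩ {T | T.shape = τ} = {T | T.shape = τ} := by
      ext T
      constructor
      · exact fun h => h.2
      · intro h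
        refine ⟨?_, h⟩
        change T.order = k + 1
        rw [← hτ, ← h, Tree.order_shape]
    rw [subtreeLaw_treeLaw hc hγ (by omega), lawGivenShape, orderLaw,
      cond_cond_eq_cond_inter (Tree.measurableSet_order _) (Tree.measurableSet_shape _), hsub,
      lawGivenShape]
  prune_shape τ := by
    rw [prunedLaw_treeLaw, Measure.map_apply (Tree.measurable_scale c) (Tree.measurableSet_shape _)]
    congr 1
    ext T
    simp [Tree.shape_scale]
  exponent_pos := by linarith
  prune_length τ := by rw [prunedLaw_treeLaw, lawGivenShape_map_scale]

/-! ### Uniqueness of the scaling exponent -/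

/-- The length of the root edge. -/
def Tree.rootLength : Tree ℝ → ℝ :=
  Quotient.lift (lengthAt []) fun _ _ h => by cases h <;> rfl

theorem Tree.measurable_rootLength : Measurable Tree.rootLength :=
  Tree.measurable_of_mk (measurable_lengthAt [])

theorem treeLaw_leaf_ne_zero :
    (tokunaga c γ hc hγ).treeLaw {T | T.shape = Tree.mk (leaf ())} ≠ 0 := by
  refine fun h => treeLaw_order hc hγ 0 (measure_mono_null ?_ h)
  intro T
  induction T using Quotient.inductionOn with
  | h t =>
    intro ht
    cases t with
    | leaf x => rfl
    | node x a b =>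
      exfalso
      have h1 : (node x a b).order = 0 + 1 := ht
      have := one_le_order a
      have := one_le_order b
      simp only [order] at h1
      split_ifs at h1 <;> omega

/-- Given that the tree is a single edge, its length is exponential of rate `γ * c`.
Prune-invariance in lengths for `ζ` and for `c` gives the same law, so the rates `γ * c / ζ` and `γ
* c / c` agree. -/
theorem scalingExponent_unique {ζ : ℝ} (h : IsSelfSimilar (tokunaga c γ hc hγ).treeLaw ζ) :
    ζ = c := by
  have hc0 : 0 < c := by linarith
  have ha := mul_pos hγ hc0
  have hleaf : lawGivenShape (tokunaga c γ hc hγ).treeLaw (Tree.mk (leaf ())) =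
      ((expMeasure (γ * c)).map leaf).map Tree.mk :=
    hasIIDEdgeLengths_treeLaw hc hγ (leaf ()) (treeLaw_leaf_ne_zero hc hγ)
  have h1 : (lawGivenShape (tokunaga c γ hc hγ).treeLaw (Tree.mk (leaf ()))).map (Tree.scale ζ) =
      (lawGivenShape (tokunaga c γ hc hγ).treeLaw (Tree.mk (leaf ()))).map (Tree.scale c) := by
    rw [← h.prune_length, ← (isSelfSimilar_treeLaw hc hγ).prune_length]
  have h2 : ∀ z : ℝ, 0 < z → (((((expMeasure (γ * c)).map leaf).map Tree.mk).map
      (Tree.scale z)).map Tree.rootLength) = expMeasure (γ * c / z) := by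
    intro z hz
    rw [Measure.map_map measurable_mk measurable_leaf, Measure.map_map (Tree.measurable_scale z)
      (measurable_mk.comp measurable_leaf), Measure.map_map Tree.measurable_rootLength
      ((Tree.measurable_scale z).comp (measurable_mk.comp measurable_leaf)),
      ← map_mul_expMeasure ha hz]
    rfl
  have h3 : expMeasure (γ * c / ζ) = expMeasure (γ * c / c) := by
    rw [← h2 ζ h.exponent_pos, ← h2 c hc0, ← hleaf, h1]
  -- The survival probability at the single point `1` already determines the rate.
  have h4 := congrArg (fun μ => μ (Set.Ioi 1)) h3
  simp only [expMeasure_Ioi (div_pos ha h.exponent_pos) zero_le_one,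
    expMeasure_Ioi (div_pos ha hc0) zero_le_one] at h4
  rw [ENNReal.ofReal_eq_ofReal_iff (Real.exp_pos _).le (Real.exp_pos _).le, Real.exp_eq_exp] at h4
  have hζ := h.exponent_pos
  field_simp at h4
  linarith

end tokunaga

/-! ### Criticality -/

namespace PlanarTree

open Classical in
/-- The number of edges of order `j`, at combinatorial distance `n` from the root edge, that contain
a point at distance `s` from the root. -/
noncomputable def aliveAt (j : ℕ) : ℕ → ℝ → PlanarTree ℝ → ℝ≥0∞
  | 0, s, leaf x => if s < x then (if j = 1 then 1 else 0) else 0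
  | _ + 1, _, leaf _ => 0
  | 0, s, node x a b => if s < x then (if (node x a b).order = j then 1 else 0) else 0
  | n + 1, s, node x a b =>
      if s < x then 0 else aliveAt j n (s - x) a + aliveAt j n (s - x) b

/-- Sorting the living edges by depth makes the mean count accessible by induction on the depth. -/
theorem tsum_aliveAt (j : ℕ) (s : ℝ) (t : PlanarTree ℝ) :
    ∑' n, aliveAt j n s t = (alive j s t : ℝ≥0∞) := by
  induction t generalizing s with
  | leaf x =>
    rw [tsum_eq_single 0]
    · simp only [aliveAt, alive]
      split_ifs <;> simp
    · intro n hn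
      cases n with
      | zero => exact absurd rfl hn
      | succ n => rfl
  | node x a b ha hb =>
    rw [tsum_eq_zero_add' ENNReal.summable]
    simp only [aliveAt, alive]
    split_ifs
    · simp
    · simp
    · rw [ENNReal.tsum_add, ha, hb, zero_add, Nat.cast_add]

/-- The recursion shifts time by the root length, so the induction needs joint measurability in time
and lengths. -/
theorem measurable_aliveAt_fill (j : ℕ) (σ : PlanarTree Unit) (n : ℕ) :
    Measurable fun p : ℝ × (List Bool → ℝ) => aliveAt j n p.1 (fill σ p.2) := by
  classical
  induction σ generalizing n with
  | leaf x =>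
    cases n with
    | zero =>
      exact Measurable.ite (measurableSet_lt measurable_fst
        ((measurable_pi_apply _).comp measurable_snd)) measurable_const measurable_const
    | succ n => exact measurable_const
  | node x a b ha hb =>
    have hx : Measurable fun p : ℝ × (List Bool → ℝ) => p.2 [] :=
      (measurable_pi_apply _).comp measurable_snd
    have hs : ∀ e : Bool, Measurable fun p : ℝ × (List Bool → ℝ) => fun q => p.2 (e :: q) :=
      fun e => measurable_pi_lambda _ fun q => (measurable_pi_apply _).comp measurable_snd
    cases n with
    | zero =>
      refine Measurable.ite (measurableSet_lt measurable_fst hx) ?_ measurable_const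
      refine Measurable.ite ?_ measurable_const measurable_const
      have hm : Measurable fun p : ℝ × (List Bool → ℝ) => fill (node x a b) p.2 :=
        (measurable_fill (node x a b)).comp measurable_snd
      exact (measurable_order.comp hm) (measurableSet_singleton j)
    | succ n =>
      refine Measurable.ite (measurableSet_lt measurable_fst hx) measurable_const ?_
      exact ((ha n).comp ((measurable_fst.sub hx).prodMk (hs false))).add
        ((hb n).comp ((measurable_fst.sub hx).prodMk (hs true)))

theorem measurable_aliveAt (j n : ℕ) (s : ℝ) : Measurable (aliveAt j n s) :=
  measurable_of_fill fun σ => (measurable_aliveAt_fill j σ n).comp measurable_prodMk_left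

end PlanarTree

/-! ### Poisson weights and mean profiles -/

/-- The probability of exactly `n` events up to time `s` of a Poisson process of rate `a`. -/
noncomputable def poissonProb (a : ℝ) (n : ℕ) (s : ℝ) : ℝ :=
  Real.exp (-(a * s)) * (a * s) ^ n / n.factorial

theorem poissonProb_nonneg {a s : ℝ} (ha : 0 < a) (hs : 0 ≤ s) (n : ℕ) :
    0 ≤ poissonProb a n s := by
  unfold poissonProb; positivity

/-- Condition on the first event: `n` events in the remaining time `s - x` make `n + 1` in total. -/
theorem lintegral_poissonProb {a s : ℝ} (ha : 0 < a) (hs : 0 ≤ s) (n : ℕ) :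
    ∫⁻ x in Set.Iic s, ENNReal.ofReal (poissonProb a n (s - x)) ∂expMeasure a =
      ENNReal.ofReal (poissonProb a (n + 1) s) := by
  have hcont : Continuous fun x => poissonProb a n (s - x) := by
    unfold poissonProb; fun_prop
  rw [lintegral_Iic_expMeasure ha hs hcont
    fun x _ hx => poissonProb_nonneg ha (sub_nonneg.2 hx) n]
  congr 1
  -- The two exponentials multiply to the constant `exp (-(a * s))`, so the primitive is essentially
  -- a power of `s - x`.
  have hd : ∀ x ∈ Set.uIcc 0 s, HasDerivAt
      (fun x => -(Real.exp (-(a * s)) * (a * (s - x)) ^ (n + 1) / (n + 1).factorial))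
      (a * Real.exp (-(a * x)) * poissonProb a n (s - x)) x := by
    intro x _
    have h1 : HasDerivAt (fun x => a * (s - x)) (a * (-1)) x :=
      ((hasDerivAt_id x).const_sub s).const_mul a
    have h2 := (((h1.pow (n + 1)).const_mul (Real.exp (-(a * s)))).div_const
      ((n + 1).factorial : ℝ)).neg
    convert! h2 using 1
    have hexp : Real.exp (-(a * s)) = Real.exp (-(a * x)) * Real.exp (-(a * (s - x))) := by
      rw [← Real.exp_add]; congr 1; ring
    have hf : (n.factorial : ℝ) ≠ 0 := by positivity
    rw [poissonProb, hexp, Nat.factorial_succ]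
    push_cast
    field_simp
  rw [intervalIntegral.integral_eq_sub_of_hasDerivAt hd
    (Continuous.intervalIntegrable (by fun_prop) _ _)]
  simp [poissonProb]

theorem tsum_poissonProb {a s : ℝ} (ha : 0 < a) (hs : 0 ≤ s) :
    ∑' n, ENNReal.ofReal (poissonProb a n s) = 1 := by
  have h : HasSum (fun n => poissonProb a n s) 1 := by
    have h1 := (NormedSpace.expSeries_div_hasSum_exp (𝔸 := ℝ) (a * s)).mul_left
      (Real.exp (-(a * s)))
    rw [← Real.exp_eq_exp_ℝ, ← Real.exp_add, neg_add_cancel, Real.exp_zero] at h1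
    refine h1.congr_fun fun n => ?_
    rw [poissonProb, mul_div_assoc]
  rw [← ENNReal.ofReal_tsum_of_nonneg (fun n => poissonProb_nonneg ha hs n) h.summable, h.tsum_eq,
    ENNReal.ofReal_one]

/-- On average, the tree has `m` edges of order `j` at combinatorial distance `n` from the root
edge, and each of them is alive at time `s` with the probability that a Poisson process of rate `a`
has `n` events up to time `s`. -/
def HasProfile (a : ℝ) (j n : ℕ) (μ : Measure (PlanarTree ℝ)) (m : ℝ≥0∞) : Prop :=
  ∀ s, 0 ≤ s → ∫⁻ t, aliveAt j n s t ∂μ = ENNReal.ofReal (poissonProb a n s) * m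

section profile

variable {a : ℝ} {j n : ℕ} {μ ν : Measure (PlanarTree ℝ)} {m m' : ℝ≥0∞}

theorem HasProfile.add (h : HasProfile a j n μ m) (h' : HasProfile a j n ν m') :
    HasProfile a j n (μ + ν) (m + m') := by
  intro s hs
  rw [lintegral_add_measure, h s hs, h' s hs, mul_add]

theorem HasProfile.smul (h : HasProfile a j n μ m) (r : ℝ≥0∞) :
    HasProfile a j n (r • μ) (r * m) := by
  intro s hs
  rw [lintegral_smul_measure, h s hs, smul_eq_mul, mul_left_comm]

theorem HasProfile.finsetSum {ι : Type*} [Fintype ι] {μ : ι → Measure (PlanarTree ℝ)}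
    {m : ι → ℝ≥0∞} (h : ∀ i, HasProfile a j n (μ i) (m i)) :
    HasProfile a j n (∑ i, μ i) (∑ i, m i) := by
  intro s hs
  rw [lintegral_finsetSum_measure, Finset.mul_sum]
  exact Finset.sum_congr rfl fun i _ => h i s hs

-- At depth zero only the root edge counts; it is alive exactly when its length exceeds `s`, and
-- `exp (-(a * s))` is the Poisson weight of zero events.
open Classical in
theorem hasProfile_zero_nodeLaw (ha : 0 < a) [IsProbabilityMeasure μ] [IsProbabilityMeasure ν]
    {k : ℕ} (hk : ∀ᵐ s ∂μ, ∀ᵐ t ∂ν, ∀ x, (node x s t).order = k) :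
    HasProfile a j 0 (nodeLaw (expMeasure a) μ ν) (if k = j then 1 else 0) := by
  intro s hs
  have e : ∀ x, ∫⁻ t, ∫⁻ u, aliveAt j 0 s (node x t u) ∂ν ∂μ =
      (Set.Ioi s).indicator (fun _ => if k = j then 1 else 0) x := by
    intro x
    have h1 : ∀ᵐ t ∂μ, ∫⁻ u, aliveAt j 0 s (node x t u) ∂ν =
        (Set.Ioi s).indicator (fun _ => if k = j then 1 else 0) x := by
      filter_upwards [hk] with t ht
      have h2 : ∀ᵐ u ∂ν, aliveAt j 0 s (node x t u) =
          (Set.Ioi s).indicator (fun _ => if k = j then 1 else 0) x := by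
        filter_upwards [ht] with u hu
        simp [aliveAt, hu, Set.indicator_apply]
      rw [lintegral_congr_ae h2]
      simp
    rw [lintegral_congr_ae h1]
    simp
  rw [lintegral_nodeLaw (measurable_aliveAt j 0 s), lintegral_congr e,
    lintegral_indicator_const measurableSet_Ioi, expMeasure_Ioi ha hs, mul_comm]
  simp [poissonProb]

/-- Conditioning on the root length convolves the common Poisson weight with one more exponential
time, while the mean numbers of the two children add up. -/
theorem HasProfile.nodeLaw (ha : 0 < a) [IsProbabilityMeasure μ] [IsProbabilityMeasure ν]
    (h : HasProfile a j n μ m) (h' : HasProfile a j n ν m') :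
    HasProfile a j (n + 1) (nodeLaw (expMeasure a) μ ν) (m + m') := by
  intro s hs
  have e : ∀ x, ∫⁻ t, ∫⁻ u, aliveAt j (n + 1) s (node x t u) ∂ν ∂μ =
      (Set.Iic s).indicator (fun x => ENNReal.ofReal (poissonProb a n (s - x)) * (m + m')) x := by
    intro x
    by_cases hx : s < x
    · simp [aliveAt, hx, not_le.2 hx]
    · have hx' : 0 ≤ s - x := by linarith
      have hm := measurable_aliveAt j n (s - x)
      simp only [aliveAt, if_neg hx]
      rw [Set.indicator_of_mem (Set.mem_Iic.2 (not_lt.1 hx)), mul_add, ← h _ hx', ← h' _ hx']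
      have h1 : ∀ t, ∫⁻ u, (aliveAt j n (s - x) t + aliveAt j n (s - x) u) ∂ν =
          aliveAt j n (s - x) t + ∫⁻ u, aliveAt j n (s - x) u ∂ν := by
        intro t
        rw [lintegral_add_left measurable_const]
        simp
      rw [lintegral_congr h1, lintegral_add_left hm]
      simp
  have hp : Measurable fun x => ENNReal.ofReal (poissonProb a n (s - x)) := by
    unfold poissonProb; fun_prop
  rw [lintegral_nodeLaw (measurable_aliveAt j (n + 1) s), lintegral_congr e,
    lintegral_indicator measurableSet_Iic, lintegral_mul_const _ hp, lintegral_poissonProb ha hs]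

end profile

/-! ### The mean matrix and its invariant distribution -/

/-- The mean number of edges next to the root edge, weighted by a function of their order, on the
event of immediate termination. -/
noncomputable def splitMean (c : ℝ) (v : ℕ → ℝ≥0∞) : ℕ → ℝ≥0∞
  | 0 => 0
  | K + 1 => ENNReal.ofReal (stopProb c (K + 1)) * (v K + v K)

/-- The action of the mean matrix of the embedded multitype branching process, with types the
orders of the edges, on a vector. -/
noncomputable def meanStep (c : ℝ) (v : ℕ → ℝ≥0∞) (K : ℕ) : ℝ≥0∞ :=
  splitMean c v K + ∑ i : Fin K, ENNReal.ofReal (birthProb c i) * (v K + v i)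

/-- For the geometric law with ratio `1/2` the mass strictly beyond `i` equals the mass at `i`. This
is where the choice `p_K = 2^(-K)` balances the side branches. -/
theorem tsum_rootProb_gt (i : ℕ) : ∑' K, (if i < K then rootProb K else 0) = rootProb i := by
  induction i with
  | zero =>
    rw [tsum_eq_zero_add' ENNReal.summable]
    simp only [lt_self_iff_false, if_false, Nat.zero_lt_succ, if_true, rootProb_succ, zero_add]
    rw [ENNReal.tsum_mul_left, tsum_rootProb, rootProb_eq]
    simp
  | succ i ih =>
    rw [tsum_eq_zero_add' ENNReal.summable, if_neg (by omega), zero_add, rootProb_succ, ← ih,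
      ← ENNReal.tsum_mul_left]
    refine tsum_congr fun K => ?_
    simp only [Nat.add_lt_add_iff_right, rootProb_succ, mul_ite, mul_zero]

theorem tsum_fin_eq (K : ℕ) (f : ℕ → ℝ≥0∞) :
    ∑ i : Fin K, f i = ∑' i, if i < K then f i else 0 := by
  rw [Fin.sum_univ_eq_sum_range f, tsum_eq_sum (s := Finset.range K)]
  · exact Finset.sum_congr rfl fun i hi => (if_pos (Finset.mem_range.1 hi)).symm
  · exact fun i hi => if_neg fun h => hi (Finset.mem_range.2 h)

/-- The distribution of the order of the root is invariant under the mean matrix. -/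
theorem tsum_meanStep {c : ℝ} (hc : 1 ≤ c) (v : ℕ → ℝ≥0∞) :
    ∑' K, rootProb K * meanStep c v K = ∑' K, rootProb K * v K := by
  have h1 : ∀ K, meanStep c v K = splitMean c v K + ENNReal.ofReal (1 - stopProb c K) * v K +
      ∑' i, if i < K then ENNReal.ofReal (birthProb c i) * v i else 0 := by
    intro K
    rw [← tsum_fin_eq K fun i => ENNReal.ofReal (birthProb c i) * v i, meanStep]
    simp only [mul_add, Finset.sum_add_distrib]
    rw [← Finset.sum_mul, sum_ofReal_birthProb hc, add_assoc]
  -- The two offspring of a termination compensate the factor `1/2` between consecutive root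
  -- probabilities.
  have h2 : ∑' K, rootProb K * splitMean c v K =
      ∑' K, rootProb K * (ENNReal.ofReal (stopProb c (K + 1)) * v K) := by
    rw [tsum_eq_zero_add' ENNReal.summable, splitMean, mul_zero, zero_add]
    refine tsum_congr fun K => ?_
    rw [rootProb_succ, splitMean, ← two_mul]
    calc 2⁻¹ * rootProb K * (ENNReal.ofReal (stopProb c (K + 1)) * (2 * v K))
        = (2⁻¹ * 2) * (rootProb K * (ENNReal.ofReal (stopProb c (K + 1)) * v K)) := by ring
      _ = _ := by rw [ENNReal.inv_mul_cancel (by simp) (by simp), one_mul]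
  -- Parents of every larger order bear offspring of index `i` with the same probability, so after
  -- exchanging the sums only the tail of `rootProb` remains.
  have h3 : ∑' K, rootProb K * ∑' i, (if i < K then ENNReal.ofReal (birthProb c i) * v i else 0) =
      ∑' i, rootProb i * (ENNReal.ofReal (birthProb c i) * v i) := by
    simp only [← ENNReal.tsum_mul_left]
    rw [ENNReal.tsum_comm]
    refine tsum_congr fun i => ?_
    conv_rhs => rw [← tsum_rootProb_gt i, ← ENNReal.tsum_mul_right]
    refine tsum_congr fun K => ?_
    split_ifs <;> simp
  simp only [h1, mul_add]
  rw [ENNReal.tsum_add, ENNReal.tsum_add, h2, h3, ← ENNReal.tsum_add, ← ENNReal.tsum_add]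
  refine tsum_congr fun K => ?_
  have hs := stopProb_le_one hc K
  -- The three sources of edges of index `K` have total weight `c⁻¹ ^ (K+1) + (1 - c⁻¹ ^ K) + (c -
  -- 1) * c⁻¹ ^ (K+1) = 1`: termination one order above, continuation, and birth.
  have e : ENNReal.ofReal (stopProb c (K + 1)) + ENNReal.ofReal (1 - stopProb c K) +
      ENNReal.ofReal (birthProb c K) = 1 := by
    rw [← ENNReal.ofReal_add (stopProb_pos hc _).le (by linarith),
      ← ENNReal.ofReal_add (add_nonneg (stopProb_pos hc _).le (by linarith))
        (birthProb_nonneg hc K), ← ENNReal.ofReal_one]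
    congr 1
    have hcc : c * c⁻¹ = 1 := mul_inv_cancel₀ (by linarith)
    simp only [stopProb, birthProb, pow_succ]
    linear_combination (c⁻¹ ^ K) * hcc
  rw [← mul_add, ← mul_add, ← add_mul, ← add_mul, e, one_mul]

section tokunaga

variable {c γ : ℝ} (hc : 1 ≤ c) (hγ : 0 < γ)

open Classical in
theorem hasProfile_zero_tokLaw (j K : ℕ) :
    HasProfile (γ * c) j 0 (tokLaw hc hγ K) (if K + 1 = j then 1 else 0) := by
  have ha := mul_pos hγ (show 0 < c by linarith)
  have := isProbabilityMeasure_expMeasure ha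
  cases K with
  | zero =>
    intro s hs
    rw [tokLaw_eq]
    simp only [Finset.univ_eq_empty, Finset.sum_empty, add_zero]
    rw [tokPart_zero_zero, lintegral_map (measurable_aliveAt j 0 s) measurable_leaf]
    have e : ∀ x, aliveAt j 0 s (leaf x) =
        (Set.Ioi s).indicator (fun _ => if 0 + 1 = j then 1 else 0) x := by
      intro x
      simp [aliveAt, Set.indicator_apply, eq_comm]
    rw [lintegral_congr e, lintegral_indicator_const measurableSet_Ioi, expMeasure_Ioi ha hs,
      mul_comm]
    simp [poissonProb]
  | succ K =>
    have h1 : HasProfile (γ * c) j 0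
        (nodeLaw (expMeasure (γ * c)) (tokLaw hc hγ K) (tokLaw hc hγ K))
        (if K + 1 + 1 = j then 1 else 0) := by
      refine hasProfile_zero_nodeLaw ha ?_
      filter_upwards [tokLaw_order hc hγ K] with s hs
      filter_upwards [tokLaw_order hc hγ K] with t ht
      intro x
      simp [order, hs, ht]
    have h2 : ∀ i : Fin (K + 1), HasProfile (γ * c) j 0
        (nodeLaw (expMeasure (γ * c)) (tokLaw hc hγ (K + 1)) (tokLaw hc hγ i))
        (if K + 1 + 1 = j then 1 else 0) := by
      intro i
      refine hasProfile_zero_nodeLaw ha ?_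
      filter_upwards [tokLaw_order hc hγ (K + 1)] with s hs
      filter_upwards [tokLaw_order hc hγ i] with t ht
      intro x
      have := i.isLt
      simp only [order, hs, ht]
      split_ifs <;> omega
    have h3 := (h1.smul (ENNReal.ofReal (stopProb c (K + 1)))).add
      (HasProfile.finsetSum fun i => (h2 i).smul (ENNReal.ofReal (birthProb c i)))
    rw [← tokPart_succ_zero, ← tokLaw_eq, ← Finset.sum_mul, ← add_mul, sum_ofReal_birthProb hc,
      ← ENNReal.ofReal_add (stopProb_pos hc _).le (by linarith [stopProb_le_one hc (K + 1)]),
      add_sub_cancel, ENNReal.ofReal_one, one_mul] at h3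
    exact h3

-- Induction on the depth through the first-event equation. The law of index `K` also occurs on its
-- own right-hand side, but below the root edge, hence at smaller depth.
open Classical in
theorem hasProfile_tokLaw (j n K : ℕ) :
    HasProfile (γ * c) j n (tokLaw hc hγ K)
      ((meanStep c)^[n] (fun K => if K + 1 = j then 1 else 0) K) := by
  have ha := mul_pos hγ (show 0 < c by linarith)
  have := isProbabilityMeasure_expMeasure ha
  induction n generalizing K with
  | zero => exact hasProfile_zero_tokLaw hc hγ j K
  | succ n ih =>
    rw [Function.iterate_succ_apply']
    cases K with
    | zero =>
      intro s hs
      rw [tokLaw_eq]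
      simp only [Finset.univ_eq_empty, Finset.sum_empty, add_zero]
      rw [tokPart_zero_zero, lintegral_map (measurable_aliveAt j (n + 1) s) measurable_leaf]
      simp [aliveAt, meanStep, splitMean]
    | succ K =>
      have h3 := (((ih K).nodeLaw ha (ih K)).smul (ENNReal.ofReal (stopProb c (K + 1)))).add
        (HasProfile.finsetSum fun i : Fin (K + 1) =>
          ((ih (K + 1)).nodeLaw ha (ih i)).smul (ENNReal.ofReal (birthProb c i)))
      rw [← tokPart_succ_zero, ← tokLaw_eq] at h3
      exact h3

theorem tsum_iterate_meanStep {c : ℝ} (hc : 1 ≤ c) (v : ℕ → ℝ≥0∞) (n : ℕ) :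
    ∑' K, rootProb K * (meanStep c)^[n] v K = ∑' K, rootProb K * v K := by
  induction n with
  | zero => rfl
  | succ n ih => simp only [Function.iterate_succ_apply', tsum_meanStep hc, ih]

/-- By invariance under the mean matrix every depth contributes the same mean `rootProb l`, and the
Poisson weights of the depths sum to one. -/
theorem meanAlive_treeLaw (l : ℕ) {s : ℝ} (hs : 0 ≤ s) :
    (tokunaga c γ hc hγ).meanAlive (l + 1) s = rootProb l := by
  classical
  have ha := mul_pos hγ (show 0 < c by linarith)
  have halive : ∀ t : PlanarTree ℝ, ((Tree.mk t).alive (l + 1) s : ℝ≥0∞) =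
      ∑' n, aliveAt (l + 1) n s t := fun t => (tsum_aliveAt (l + 1) s t).symm
  have hm : Measurable fun T : Tree ℝ => (T.alive (l + 1) s : ℝ≥0∞) := by
    refine Tree.measurable_of_mk ?_
    simp only [halive]
    exact Measurable.tsum fun n => measurable_aliveAt _ _ _
  rw [Hierarchical.meanAlive, treeLaw_eq, lintegral_map hm measurable_mk]
  simp only [halive]
  rw [lintegral_tsum fun n => (measurable_aliveAt _ _ _).aemeasurable]
  have h1 : ∀ n, ∫⁻ t, aliveAt (l + 1) n s t ∂planarLaw hc hγ =
      ENNReal.ofReal (poissonProb (γ * c) n s) * rootProb l := by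
    intro n
    rw [planarLaw, lintegral_sum_measure]
    have h2 : ∀ K, ∫⁻ t, aliveAt (l + 1) n s t ∂(rootProb K • tokLaw hc hγ K) =
        ENNReal.ofReal (poissonProb (γ * c) n s) * (rootProb K *
          (meanStep c)^[n] (fun K => if K + 1 = l + 1 then 1 else 0) K) := by
      intro K
      rw [lintegral_smul_measure, hasProfile_tokLaw hc hγ (l + 1) n K s hs, smul_eq_mul,
        mul_left_comm]
    rw [tsum_congr h2, ENNReal.tsum_mul_left, tsum_iterate_meanStep hc,
      tsum_eq_single l fun K hK => by rw [if_neg (by omega), mul_zero], if_pos rfl, mul_one]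
  rw [tsum_congr h1, ENNReal.tsum_mul_right, tsum_poissonProb ha hs, one_mul]

theorem isCritical_tokunaga : (tokunaga c γ hc hγ).IsCritical := by
  intro s hs
  simp only [Hierarchical.width, meanAlive_treeLaw hc hγ _ hs, tsum_rootProb]

end tokunaga

/-! ### Time-invariance -/

theorem summable_norm_L1 (x : Hierarchical.L1) : HasSum (fun n => ‖x n‖) ‖x‖ := by
  simpa using lp.hasSum_norm (p := 1) (by simp) x

/-- The operator on `ℓ¹` that maps the `m`-th basis vector to `v m`. -/
theorem exists_clm_of_columns (v : ℕ → Hierarchical.L1) {B : ℝ} (hv : ∀ m, ‖v m‖ ≤ B) :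
    ∃ A : Hierarchical.L1 →L[ℝ] Hierarchical.L1, ∀ x : Hierarchical.L1,
      HasSum (fun m => x m • v m) (A x) := by
  have hb : ∀ (x : Hierarchical.L1) m, ‖x m • v m‖ ≤ ‖x m‖ * B := fun x m => by
    rw [norm_smul]
    exact mul_le_mul_of_nonneg_left (hv m) (norm_nonneg _)
  have hs : ∀ x : Hierarchical.L1, Summable fun m => x m • v m := fun x =>
    Summable.of_norm_bounded ((summable_norm_L1 x).mul_right B).summable (hb x)
  let A₀ : Hierarchical.L1 →ₗ[ℝ] Hierarchical.L1 :=
    { toFun := fun x => ∑' m, x m • v m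
      map_add' := fun x y => by
        rw [← (hs x).tsum_add (hs y)]
        refine tsum_congr fun m => ?_
        rw [lp.coeFn_add, Pi.add_apply, add_smul]
      map_smul' := fun r x => by
        rw [RingHom.id_apply, ← (hs x).tsum_const_smul]
        refine tsum_congr fun m => ?_
        rw [lp.coeFn_smul, Pi.smul_apply, smul_assoc] }
  refine ⟨A₀.mkContinuous B fun x => ?_, fun x => (hs x).hasSum⟩
  rw [mul_comm]
  exact tsum_of_norm_bounded ((summable_norm_L1 x).mul_right B) (hb x)

/-- A bounded operator that annihilates a vector generates a semigroup that fixes it. -/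
theorem exp_smul_apply_of_apply_eq_zero {E : Type*} [NormedAddCommGroup E] [NormedSpace ℝ E]
    [CompleteSpace E] (A : E →L[ℝ] E) {x : E} (hx : A x = 0) (s : ℝ) :
    NormedSpace.exp (s • A) x = x := by
  have h := (NormedSpace.exp_series_hasSum_exp' (𝕂 := ℝ) (s • A)).mapL
    (ContinuousLinearMap.apply ℝ E x)
  have h0 : ∀ n : ℕ, n ≠ 0 →
      ContinuousLinearMap.apply ℝ E x (((n.factorial : ℝ)⁻¹) • (s • A) ^ n) = 0 := by
    intro n hn
    obtain ⟨k, rfl⟩ := Nat.exists_eq_succ_of_ne_zero hn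
    have h1 : (s • A) x = 0 := by rw [smul_apply, hx, smul_zero]
    rw [Nat.succ_eq_add_one, pow_succ, ContinuousLinearMap.apply_apply,
      smul_apply, mul_apply_eq_comp, h1, map_zero, smul_zero]
  have h1 := h.unique (hasSum_single 0 h0)
  simpa using h1

section tokunaga

variable {c γ : ℝ} (hc : 1 ≤ c) (hγ : 0 < γ)

theorem tokunaga_T (k : ℕ) : (tokunaga c γ hc hγ).T (k + 1) = (c - 1) * c ^ k := rfl

/-- The entries of the generator. -/
noncomputable def generatorEntry (n m : ℕ) : ℝ :=
  (tokunaga c γ hc hγ).G n m * (tokunaga c γ hc hγ).rate (m + 1)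

theorem generatorEntry_of_lt {n m : ℕ} (h : m < n) : generatorEntry hc hγ n m = 0 := by
  rw [generatorEntry, Hierarchical.G, if_neg (by omega), if_neg (by omega), if_neg (by omega),
    zero_mul]

theorem generatorEntry_self (n : ℕ) : generatorEntry hc hγ n n = -(γ * c * stopProb c n) := by
  rw [generatorEntry, Hierarchical.G, if_pos rfl, tokunaga_rate, neg_one_mul]

theorem generatorEntry_add (n k : ℕ) : generatorEntry hc hγ n (n + k + 1) =
    ((c - 1) * c ^ k + if k = 0 then 2 else 0) * (γ * c * stopProb c (n + k + 1)) := by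
  rw [generatorEntry, Hierarchical.G, if_neg (by omega), tokunaga_rate]
  rcases Nat.eq_zero_or_pos k with rfl | hk
  · rw [if_pos (by omega), tokunaga_T, if_pos rfl]
  · rw [if_neg (by omega), if_pos (by omega), if_neg (by omega), add_zero,
      show n + k + 1 - n = k + 1 by omega, tokunaga_T]

/-- Column `m` carries the rate `γ c · c⁻¹ ^ m`, while the geometric sum of its Toeplitz entries is
at most `c ^ m + 2 ≤ 3 c ^ m`. The powers of `c` cancel, and uniformly bounded columns suffice for a
bounded operator on `ℓ¹`. -/
theorem sum_abs_generatorEntry_le (m : ℕ) :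
    ∑ n ∈ Finset.range (m + 1), |generatorEntry hc hγ n m| ≤ 3 * (γ * c) := by
  have hc0 : 0 < c := by linarith
  have hr : 0 < γ * c * stopProb c m := mul_pos (mul_pos hγ hc0) (stopProb_pos hc m)
  have hpow : c ^ m * stopProb c m = 1 := by
    rw [stopProb, ← mul_pow, mul_inv_cancel₀ hc0.ne', one_pow]
  have h1 : (1 : ℝ) ≤ c ^ m := one_le_pow₀ hc
  have hentry : ∀ k ∈ Finset.range m, |generatorEntry hc hγ (m - 1 - k) m| =
      ((c - 1) * c ^ k + if k = 0 then 2 else 0) * (γ * c * stopProb c m) := by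
    intro k hk
    have hk' := Finset.mem_range.1 hk
    have e := generatorEntry_add hc hγ (m - 1 - k) k
    rw [show m - 1 - k + k + 1 = m by omega] at e
    rw [e, abs_of_nonneg]
    refine mul_nonneg (add_nonneg (mul_nonneg (by linarith) (by positivity)) ?_) hr.le
    split_ifs <;> norm_num
  have hgeom : ∑ k ∈ Finset.range m, (c - 1) * c ^ k = c ^ m - 1 := by
    rw [← Finset.mul_sum, mul_geom_sum]
  have hone : ∑ k ∈ Finset.range m, (if k = 0 then (2 : ℝ) else 0) ≤ 2 := by
    rw [Finset.sum_ite_eq' (Finset.range m) 0 fun _ => (2 : ℝ)]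
    split_ifs <;> norm_num
  -- The column is reindexed by the distance to the diagonal.
  rw [Finset.sum_range_succ, ← Finset.sum_range_reflect, Finset.sum_congr rfl hentry,
    generatorEntry_self, abs_neg, abs_of_pos hr, ← Finset.sum_mul, Finset.sum_add_distrib, hgeom]
  calc (c ^ m - 1 + ∑ k ∈ Finset.range m, (if k = 0 then (2 : ℝ) else 0)) *
        (γ * c * stopProb c m) + γ * c * stopProb c m
      ≤ (c ^ m - 1 + 2) * (γ * c * stopProb c m) + γ * c * stopProb c m := by gcongr
    _ = (c ^ m + 2) * (γ * c * stopProb c m) := by ring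
    _ ≤ (3 * c ^ m) * (γ * c * stopProb c m) := by gcongr; linarith
    _ = 3 * (γ * c) * (c ^ m * stopProb c m) := by ring
    _ = 3 * (γ * c) := by rw [hpow, mul_one]

/-- The columns of the generator. -/
noncomputable def generatorColumn (m : ℕ) : Hierarchical.L1 :=
  ∑ n ∈ Finset.range (m + 1), lp.single 1 n (generatorEntry hc hγ n m)

theorem generatorColumn_apply (n m : ℕ) :
    generatorColumn hc hγ m n = generatorEntry hc hγ n m := by
  rw [generatorColumn, lp.coeFn_sum, Finset.sum_apply]
  simp only [lp.coeFn_single]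
  rcases lt_or_ge m n with h | h
  · rw [generatorEntry_of_lt hc hγ h]
    refine Finset.sum_eq_zero fun k hk => ?_
    have := Finset.mem_range.1 hk
    rw [Pi.single_apply, if_neg (by omega)]
  · rw [Finset.sum_eq_single n, Pi.single_eq_same]
    · intro k _ hk
      rw [Pi.single_apply, if_neg hk.symm]
    · intro hn
      exact absurd (Finset.mem_range.2 (by omega)) hn

theorem norm_generatorColumn_le (m : ℕ) : ‖generatorColumn hc hγ m‖ ≤ 3 * (γ * c) := by
  refine (norm_sum_le _ _).trans (le_trans (le_of_eq ?_) (sum_abs_generatorEntry_le hc hγ m))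
  refine Finset.sum_congr rfl fun n _ => ?_
  rw [lp.norm_single (by simp), Real.norm_eq_abs]

/-- The distribution of the order of the root branch is in the kernel of the generator. -/
theorem hasSum_generatorEntry_initial (n : ℕ) :
    HasSum (fun m => generatorEntry hc hγ n m * (2 : ℝ)⁻¹ ^ (m + 1)) 0 := by
  have hc0 : 0 < c := by linarith
  have hcc : c * c⁻¹ = 1 := mul_inv_cancel₀ hc0.ne'
  -- This is the absolute value of the diagonal contribution; the entries above the diagonal must
  -- sum to it.
  set r : ℝ := γ * c * stopProb c n * (2 : ℝ)⁻¹ ^ (n + 1) with hr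
  have hsingle : HasSum (fun k : ℕ => if k = 0 then c⁻¹ else 0) c⁻¹ := by
    simpa using hasSum_ite_eq (0 : ℕ) (c⁻¹)
  have hgeom : HasSum (fun k : ℕ => (1 - c⁻¹) * ((2 : ℝ)⁻¹ * (2 : ℝ)⁻¹ ^ k)) (1 - c⁻¹) := by
    have h := ((hasSum_geometric_of_lt_one (r := (2 : ℝ)⁻¹) (by norm_num) (by norm_num)).mul_left
      ((2 : ℝ)⁻¹)).mul_left (1 - c⁻¹)
    rwa [show (2 : ℝ)⁻¹ * (1 - 2⁻¹)⁻¹ = 1 by norm_num, mul_one] at h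
  have htail : HasSum (fun k => generatorEntry hc hγ n (n + k + 1) * (2 : ℝ)⁻¹ ^ (n + k + 1 + 1))
      r := by
    -- The entries `T_k` contribute the fraction `1 - c⁻¹` of `r`, and the extra `2` on the first
    -- superdiagonal contributes `c⁻¹`.
    have h := (hgeom.add hsingle).mul_left r
    rw [sub_add_cancel, mul_one] at h
    refine h.congr_fun fun k => ?_
    have hck : c ^ k * c⁻¹ ^ k = 1 := by rw [← mul_pow, hcc, one_pow]
    rw [generatorEntry_add, hr]
    simp only [stopProb, pow_succ, pow_add]
    rcases Nat.eq_zero_or_pos k with rfl | hk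
    · simp only [if_true, pow_zero]
      linear_combination (γ * c * c⁻¹ ^ n * 2⁻¹ ^ n * 2⁻¹ * 2⁻¹) * hcc
    · simp only [if_neg hk.ne', add_zero]
      linear_combination (γ * c * c⁻¹ ^ n * 2⁻¹ ^ n * 2⁻¹ * 2⁻¹ ^ k * 2⁻¹) *
        ((c - 1) * c⁻¹ * hck + hcc)
  have h0 : HasSum (fun k => generatorEntry hc hγ n (n + k) * (2 : ℝ)⁻¹ ^ (n + k + 1)) 0 := by
    rw [← hasSum_nat_add_iff' 1]
    simpa [generatorEntry_self, hr, add_assoc] using htail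
  rw [← hasSum_nat_add_iff' n, Finset.sum_eq_zero, sub_zero]
  · simpa only [add_comm n] using h0
  · intro m hm
    rw [generatorEntry_of_lt hc hγ (Finset.mem_range.1 hm), zero_mul]

theorem isTimeInvariant_tokunaga : (tokunaga c γ hc hγ).IsTimeInvariant := by
  obtain ⟨A, hA⟩ := exists_clm_of_columns (generatorColumn hc hγ)
    (norm_generatorColumn_le hc hγ)
  have hgen : (tokunaga c γ hc hγ).IsGenerator A := by
    intro x n
    -- Evaluation at a coordinate is continuous, so the convergent sum of columns yields the
    -- entrywise sums.
    have h := (hA x).mapL (lp.evalCLM ℝ (fun _ : ℕ => ℝ) 1 n)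
    refine h.congr_fun fun m => ?_
    change _ = x m * generatorColumn hc hγ m n
    rw [generatorColumn_apply, generatorEntry]
    ring
  refine ⟨A, hgen, fun s _ => exp_smul_apply_of_apply_eq_zero A ?_ s⟩
  ext n
  exact (hgen (tokunaga c γ hc hγ).initial n).unique (hasSum_generatorEntry_initial hc hγ n)

/-! ### Characteristics of the Tokunaga sequence -/

/-- For `c > 1`, `T_k = ((c - 1) / c) * c ^ k` and the `k`-th root of the positive prefactor tends
to one. For `c = 1` the prefactor is zero. -/
theorem tokunaga_L : (tokunaga c γ hc hγ).L = if 1 < c then ENNReal.ofReal c else 0 := by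
  have hc0 : 0 < c := by linarith
  unfold Hierarchical.L
  refine Tendsto.limsup_eq ?_
  split_ifs with h
  · have hq : 0 < (c - 1) / c := div_pos (by linarith) hc0
    have h1 : Tendsto (fun k : ℕ => ENNReal.ofReal (((c - 1) / c) ^ (1 / (k : ℝ)) * c)) atTop
        (𝓝 (ENNReal.ofReal (((c - 1) / c) ^ (0 : ℝ) * c))) := by
      refine ENNReal.tendsto_ofReal (Tendsto.mul_const c ?_)
      exact (Real.continuousAt_const_rpow hq.ne').tendsto.comp tendsto_one_div_atTop_nhds_zero_nat
    rw [Real.rpow_zero, one_mul] at h1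
    refine h1.congr' ?_
    filter_upwards [eventually_ge_atTop 1] with k hk
    obtain ⟨m, rfl⟩ : ∃ m, k = m + 1 := ⟨k - 1, by omega⟩
    have e : (tokunaga c γ hc hγ).T (m + 1) = (c - 1) / c * c ^ (m + 1) := by
      rw [tokunaga_T, pow_succ]
      field_simp
    rw [e, ENNReal.ofReal_rpow_of_nonneg (by positivity) (by positivity),
      Real.mul_rpow hq.le (by positivity), ← Real.rpow_natCast c (m + 1), ← Real.rpow_mul hc0.le,
      mul_one_div_cancel (by positivity), Real.rpow_one]
  · have h1 : c = 1 := le_antisymm (not_lt.1 h) hc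
    refine tendsto_const_nhds.congr' ?_
    filter_upwards [eventually_ge_atTop 1] with k hk
    have e : (tokunaga c γ hc hγ).T k = 0 := by
      simp [tokunaga, h1]
    have : (0 : ℝ) < 1 / k := by positivity
    rw [e, ENNReal.ofReal_zero, ENNReal.zero_rpow_of_pos this]

theorem tokunaga_hasSum {z : ℂ} (hz : ‖z‖ₑ * (tokunaga c γ hc hγ).L < 1) :
    HasSum (fun n : ℕ => z ^ (n + 1) * ((tokunaga c γ hc hγ).T (n + 1) : ℂ))
      ((c - 1) * z / (1 - c * z)) := by
  simp only [tokunaga_T]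
  rw [tokunaga_L] at hz
  split_ifs at hz with h
  · have hn : ‖(c : ℂ) * z‖ < 1 := by
      rw [← ofReal_norm, ← ENNReal.ofReal_mul (norm_nonneg _), ENNReal.ofReal_lt_one] at hz
      rw [norm_mul, Complex.norm_real, Real.norm_of_nonneg (by linarith), mul_comm]
      exact hz
    have h1 := (hasSum_geometric_of_norm_lt_one hn).mul_left (((c : ℂ) - 1) * z)
    rw [← div_eq_mul_inv] at h1
    refine h1.congr_fun fun n => ?_
    push_cast
    ring
  · have h1 : c = 1 := le_antisymm (not_lt.1 h) hc
    subst h1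
    simp

theorem tokunaga_tHat {z : ℂ} (hz : ‖z‖ₑ * (tokunaga c γ hc hγ).L < 1) (hcz : (c : ℂ) * z ≠ 1) :
    (tokunaga c γ hc hγ).tHat z = (1 - 2 * c * z) * (z - 1) / (1 - c * z) := by
  have h0 : 1 - (c : ℂ) * z ≠ 0 := sub_ne_zero.2 hcz.symm
  rw [Hierarchical.tHat, (tokunaga_hasSum hc hγ hz).tsum_eq]
  rw [eq_div_iff h0, add_mul, div_mul_cancel₀ _ h0]
  ring

/-- The factorised numerator has roots `1` and `1 / (2c)`: the first exceeds `1/2`, the second lies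
in `(0, 1/2]` and inside the disc of convergence. -/
theorem tokunaga_isSmallRoot_iff (v : ℝ) :
    (tokunaga c γ hc hγ).IsSmallRoot v ↔ v = (2 * c)⁻¹ := by
  have hc0 : 0 < c := by linarith
  constructor
  · rintro ⟨h1, h2, h3, h4⟩
    have h3' : ‖(v : ℂ)‖ₑ * (tokunaga c γ hc hγ).L < 1 := by
      rwa [← ofReal_norm, Complex.norm_real, ofReal_norm]
    -- For `c > 1` the disc condition excludes the pole; for `c = 1` the disc is the whole plane and
    -- `v ≤ 1/2` excludes it.
    have hcv : c * v ≠ 1 := by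
      rw [tokunaga_L] at h3
      split_ifs at h3 with h
      · rw [← ofReal_norm, ← ENNReal.ofReal_mul (norm_nonneg _), ENNReal.ofReal_lt_one,
          Real.norm_of_nonneg h1.le] at h3
        linarith
      · have : c = 1 := le_antisymm (not_lt.1 h) hc
        subst this
        linarith
    have hcv' : (c : ℂ) * v ≠ 1 := by exact_mod_cast hcv
    rw [tokunaga_tHat hc hγ h3' hcv', div_eq_zero_iff, or_iff_left (sub_ne_zero.2 hcv'.symm)] at h4
    have h5 : (1 - 2 * c * v) * (v - 1) = 0 := by exact_mod_cast h4
    rcases mul_eq_zero.1 h5 with h6 | h6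
    · field_simp
      linarith
    · linarith
  · rintro rfl
    have hpos : (0 : ℝ) < (2 * c)⁻¹ := by positivity
    have h3 : ‖(2 * c)⁻¹‖ₑ * (tokunaga c γ hc hγ).L < 1 := by
      rw [tokunaga_L]
      split_ifs
      · rw [← ofReal_norm, ← ENNReal.ofReal_mul (norm_nonneg _), ENNReal.ofReal_lt_one,
          Real.norm_of_nonneg hpos.le]
        have : (2 * c)⁻¹ * c = 1 / 2 := by field_simp
        rw [this]
        norm_num
      · simp
    refine ⟨hpos, ?_, h3, ?_⟩
    · rw [one_div]
      exact inv_anti₀ (by norm_num) (by linarith)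
    · have hcz : (c : ℂ) * (((2 * c)⁻¹ : ℝ) : ℂ) ≠ 1 := by
        have : c * (2 * c)⁻¹ = 1 / 2 := by field_simp
        rw [← Complex.ofReal_mul, this]
        norm_num
      rw [tokunaga_tHat hc hγ _ hcz]
      · have h6 : (1 : ℂ) - 2 * c * (((2 * c)⁻¹ : ℝ) : ℂ) = 0 := by
          have : (c : ℂ) ≠ 0 := by exact_mod_cast hc0.ne'
          push_cast
          field_simp
          simp
        rw [h6, zero_mul, zero_div]
      · rwa [← ofReal_norm, Complex.norm_real, ofReal_norm]

theorem tokunaga_isHortonExponent_iff (R : ℝ) :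
    (tokunaga c γ hc hγ).IsHortonExponent R ↔ R = 2 * c := by
  constructor
  · rintro ⟨w, hw, rfl⟩
    have h := (hw _).1 ((tokunaga_isSmallRoot_iff hc hγ _).2 rfl)
    rw [← h, inv_inv]
  · rintro rfl
    exact ⟨(2 * c)⁻¹, tokunaga_isSmallRoot_iff hc hγ, (inv_inv _).symm⟩

end tokunaga

end HBP

theorem proposition9 (c γ : ℝ) (hc : 1 ≤ c) (hγ : 0 < γ) :
    -- the process is self-similar, and its scaling exponent is `c`
    (∀ ζ : ℝ, IsSelfSimilar (tokunaga c γ hc hγ).treeLaw ζ ↔ ζ = c) ∧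
    -- it is critical and time-invariant
    (tokunaga c γ hc hγ).IsCritical ∧
    (tokunaga c γ hc hγ).IsTimeInvariant ∧
    -- independently of the shape, the edge lengths are i.i.d. exponential with rate `γ c`
    HasIIDEdgeLengths (tokunaga c γ hc hγ).treeLaw (expMeasure (γ * c)) ∧
    -- `L = c` (for `c > 1`; in the degenerate case `c = 1` all `T_k` vanish and `L = 0`)
    (tokunaga c γ hc hγ).L = (if 1 < c then ENNReal.ofReal c else 0) ∧
    -- the generating function, on the disc `|z| < 1 / L`
    (∀ z : ℂ, ‖z‖ₑ * (tokunaga c γ hc hγ).L < 1 → (c : ℂ) * z ≠ 1 →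
      Summable (fun n : ℕ => z ^ (n + 1) * ((tokunaga c γ hc hγ).T (n + 1) : ℂ)) ∧
      (tokunaga c γ hc hγ).tHat z = (1 - 2 * c * z) * (z - 1) / (1 - c * z)) ∧
    -- the Horton exponent is `R = 2c`
    (∀ R : ℝ, (tokunaga c γ hc hγ).IsHortonExponent R ↔ R = 2 * c) ∧
    -- `p_c = 1 - ζ / R = 1 / 2` for the above `ζ` and `R`
    (∀ ζ R : ℝ, IsSelfSimilar (tokunaga c γ hc hγ).treeLaw ζ →
      (tokunaga c γ hc hγ).IsHortonExponent R → criticalProb ζ R = 1 / 2) := by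
  refine ⟨fun ζ => ⟨scalingExponent_unique hc hγ, fun h => h ▸ isSelfSimilar_treeLaw hc hγ⟩,
    isCritical_tokunaga hc hγ, isTimeInvariant_tokunaga hc hγ, hasIIDEdgeLengths_treeLaw hc hγ,
    tokunaga_L hc hγ, fun z hz hcz => ⟨(tokunaga_hasSum hc hγ hz).summable,
      tokunaga_tHat hc hγ hz hcz⟩, tokunaga_isHortonExponent_iff hc hγ, fun ζ R hζ hR => ?_⟩
  have hc0 : c ≠ 0 := by linarith
  rw [scalingExponent_unique hc hγ hζ, (tokunaga_isHortonExponent_iff hc hγ R).1 hR, criticalProb]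
  field_simp
  norm_num
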